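/- Let $n\ge 0$ be an integer, $k\in\mathbb C$ and $\alpha=k+n+2$. For $N\ge 0$ put $I_N=\{\pm1,\dots,\pm N\}$, and let $p(i)=0$ if $i>0$, $p(i)=1$ if $i<0$. For $i\in I_n$ let "$n+i$" and "$-n+i$" denote the images of $i$ under the order isomorphisms of $I_n$ onto the positive and onto the negative part of $I_{2n}$ (so $n+i$ is the integer $n+i$ if $i>0$ and $n+i+1$ if $i<0$; $-n+i$ is the integer $-n+i-1$ if $i>0$ and $-n+i$ if $i<0$). Let $e_{i,j}$ ($i,j\in I_{2n}$) be the matrix units of $\mathfrak{gl}(4n)$ and $F_{i,j}=e_{i,j}-(-1)^{p(i)+p(j)}e_{-j,-i}$; these span $\mathfrak{sp}(4n)$. Let $\mathfrak b=\mathfrak g_0\oplus\mathfrak g_{-2}$, where $\mathfrak g_0$ is spanned by the $F_{i,j}$ with $p(i)=p(j)$ and $\mathfrak g_{-2}$ by the $F_{i,j}$ with $p(i)=0$, $p(j)=1$. Let $\mathfrak a=\mathfrak b\oplus\bigoplus\mathbb C\psi_{i,j}$ ($p(i)=0$, $p(j)=1$) be the Lie superalgebra with even part $\mathfrak b$ and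 with odd elements $\psi_{i,j}=\psi_{-j,-i}$ that span a copy of the $\mathfrak b$-module $\mathfrak g_{-2}$ ($\psi_{i,j}$ corresponding to $F_{i,j}$), and $[\psi_{i,j},\psi_{a,b}]=0$. Let $\kappa$ be the invariant form on $\mathfrak a$ with $$\kappa(F_{i,j},F_{a,b})=\alpha\bigl(\delta_{i,b}\delta_{j,a}-(-1)^{p(i)+p(j)}\delta_{-j,b}\delta_{-i,a}\bigr)+(-1)^{p(i)+p(a)}\delta_{i,j}\delta_{a,b},\qquad \kappa(F_{i,j},\psi_{a,b})=\kappa(\psi_{i,j},\psi_{a,b})=0 .$$ Let $V^\kappa(\mathfrak b)$ and $V^\kappa(\mathfrak a)$ be the universal affine vertex (super)algebras, identified with $U(\mathfrak b[t^{-1}]t^{-1})$ and $U(\mathfrak a[t^{-1}]t^{-1})$, write $x[-s]=xt^{-s}$, and let $|0\rangle$ be the vacuum vector and $\partial$ the translation operator. Theorem. There is exactly one odd linear map $d_0\colon V^\kappa(\mathfrak b)\to V^\kappa(\mathfrak a)$ which is a derivation of the $(-1)$-product, $d_0(u_{(-1)}v)=(d_0u)_{(-1)}v+u_{(-1)}d_0v$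 for all $u,v\in V^\kappa(\mathfrak b)$, which satisfies $d_0|0\rangle=0$ and $[d_0,\partial]=0$, and for which, for all $a,b\in I_n$, $$d_0(F_{-n+a,-n+b}[-1])=\psi_{n+a,-n+b}[-1],\qquad d_0(F_{n+a,n+b}[-1])=-\psi_{n+a,-n+b}[-1],$$ $$d_0(F_{n+a,-n+b}[-1])=\sum_{u\in I_n}F_{-n+u,-n+b}[-1]\,\psi_{n+a,-n+u}[-1]-\sum_{u\in I_n}\psi_{n+u,-n+b}[-1]\,F_{n+a,n+u}[-1]+(k+n+1)\,\psi_{n+a,-n+b}[-2].$$ For all $i,j\in I_n$ the elements $$W^{(1)}_{i,j}=F_{-n+i,-n+j}[-1]+F_{n+i,n+j}[-1],$$ $$W^{(2)}_{i,j}=F_{n+i,-n+j}[-1]+(\alpha-1)F_{n+i,n+j}[-2]+\sum_{u\in I_n}F_{-n+u,-n+j}[-1]\,F_{n+i,n+u}[-1]$$ of $V^\kappa(\mathfrak b)$ lie in the kernel of $d_0$, that is, in the rectangular $W$-algebra $\mathcal W^k(\mathfrak{sp}(4n),(2^{2n}))=\{y\in V^\kappa(\mathfrak b)\mid d_0(y)=0\}$.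 -/

import Mathlib

namespace RectW

noncomputable section

/-! ### Universal affine vertex superalgebras

`L` is a complex Lie algebra, `M` an `L`-module, and `L ⊕ ΠM` the Lie superalgebra with even part `L`,
odd part `M`, brackets `[x, y] = ⁅x, y⁆`, `[x, m] = ⁅x, m⁆`, `[m, m'] = 0`. The form `κ` on `L` is
extended by zero to `L ⊕ ΠM`. -/

section Affine

universe u v w

/-- The symbols `x tᵐ` with `x` in the even part `L` or in the odd part `M`. -/
inductive ModeGen (L : Type u) (M : Type v) : Type (max u v)
  | even (x : L) (m : ℤ) : ModeGen L M
  | odd (y : M) (m : ℤ) : ModeGen L M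

/-- The exponent of `t` in a symbol. -/
def ModeGen.exponent {L : Type u} {M : Type v} : ModeGen L M → ℤ
  | .even _ m => m
  | .odd _ m => m

variable {L : Type u} {M : Type v} [LieRing L] [LieAlgebra ℂ L]
  [AddCommGroup M] [Module ℂ M] [LieRingModule L M]

local notation "gE" => fun x m => FreeAlgebra.ι ℂ (ModeGen.even (M := M) x m)
local notation "gO" => fun y m => FreeAlgebra.ι ℂ (ModeGen.odd (L := L) y m)

variable (M) in
/-- The relations of the enveloping algebra of the affine Lie superalgebra
`(L ⊕ ΠM)[t, t⁻¹] ⊕ ℂK`, with `K = 1`: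
`[x tᵐ, y tˡ] = [x, y] tᵐ⁺ˡ + m δ_{m+l,0} κ(x, y)`, a supercommutator on the left. -/
inductive ModeRel (κ : LinearMap.BilinForm ℂ L) :
    FreeAlgebra ℂ (ModeGen L M) → FreeAlgebra ℂ (ModeGen L M) → Prop
  | even_add (x y : L) (m : ℤ) : ModeRel κ (gE (x + y) m) (gE x m + gE y m)
  | even_smul (c : ℂ) (x : L) (m : ℤ) : ModeRel κ (gE (c • x) m) (c • gE x m)
  | odd_add (x y : M) (m : ℤ) : ModeRel κ (gO (x + y) m) (gO x m + gO y m)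
  | odd_smul (c : ℂ) (x : M) (m : ℤ) : ModeRel κ (gO (c • x) m) (c • gO x m)
  | even_even (x y : L) (m l : ℤ) : ModeRel κ (gE x m * gE y l - gE y l * gE x m)
      (gE ⁅x, y⁆ (m + l) +
        algebraMap ℂ _ (if m + l = 0 then (m : ℂ) * κ x y else 0))
  | even_odd (x : L) (y : M) (m l : ℤ) : ModeRel κ (gE x m * gO y l - gO y l * gE x m)
      (gO ⁅x, y⁆ (m + l))
  | odd_odd (x y : M) (m l : ℤ) : ModeRel κ (gO x m * gO y l + gO y l * gO x m) 0

variable (M) in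
/-- The enveloping algebra of the affine Lie superalgebra of `(L ⊕ ΠM, κ)` with `K = 1`. -/
def ModeAlgebra (κ : LinearMap.BilinForm ℂ L) : Type (max u v) := RingQuot (ModeRel M κ)

instance (κ : LinearMap.BilinForm ℂ L) : Ring (ModeAlgebra M κ) :=
  inferInstanceAs (Ring (RingQuot (ModeRel M κ)))

instance (κ : LinearMap.BilinForm ℂ L) : Algebra ℂ (ModeAlgebra M κ) :=
  inferInstanceAs (Algebra ℂ (RingQuot (ModeRel M κ)))

namespace ModeAlgebra

variable {κ : LinearMap.BilinForm ℂ L}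

/-- The quotient map. -/
def mk (κ : LinearMap.BilinForm ℂ L) : FreeAlgebra ℂ (ModeGen L M) →ₐ[ℂ] ModeAlgebra M κ :=
  RingQuot.mkAlgHom ℂ (ModeRel M κ)

theorem mk_rel {a b : FreeAlgebra ℂ (ModeGen L M)} (h : ModeRel M κ a b) : mk κ a = mk κ b :=
  RingQuot.mkAlgHom_rel ℂ h

/-- The class of a symbol. -/
def gen (κ : LinearMap.BilinForm ℂ L) (g : ModeGen L M) : ModeAlgebra M κ :=
  mk κ (FreeAlgebra.ι ℂ g)

/-- The universal property of the mode algebra. -/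
def lift {A : Type w} [Ring A] [Algebra ℂ A] (f : ModeGen L M → A)
    (hf : ∀ ⦃a b⦄, ModeRel M κ a b → FreeAlgebra.lift ℂ f a = FreeAlgebra.lift ℂ f b) :
    ModeAlgebra M κ →ₐ[ℂ] A :=
  RingQuot.liftAlgHom ℂ ⟨FreeAlgebra.lift ℂ f, hf⟩

theorem lift_gen {A : Type w} [Ring A] [Algebra ℂ A] (f : ModeGen L M → A)
    (hf : ∀ ⦃a b⦄, ModeRel M κ a b → FreeAlgebra.lift ℂ f a = FreeAlgebra.lift ℂ f b)
    (g : ModeGen L M) : lift (κ := κ) f hf (gen κ g) = f g := by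
  refine (RingQuot.liftAlgHom_mkAlgHom_apply ℂ (FreeAlgebra.lift ℂ f) hf _).trans ?_
  rw [FreeAlgebra.lift_ι_apply]

theorem hom_ext {A : Type w} [Ring A] [Algebra ℂ A] {f g : ModeAlgebra M κ →ₐ[ℂ] A}
    (h : ∀ x, f (gen κ x) = g (gen κ x)) : f = g := by
  apply RingQuot.ringQuot_ext'
  apply FreeAlgebra.hom_ext
  funext x
  exact h x

section relations

variable (κ)

theorem even_add (x y : L) (m : ℤ) :
    gen (M := M) κ (.even (x + y) m) = gen κ (.even x m) + gen κ (.even y m) := by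
  have h := mk_rel (ModeRel.even_add (M := M) (κ := κ) x y m)
  rw [map_add] at h
  exact h

theorem even_smul (c : ℂ) (x : L) (m : ℤ) :
    gen (M := M) κ (.even (c • x) m) = c • gen κ (.even x m) := by
  have h := mk_rel (ModeRel.even_smul (M := M) (κ := κ) c x m)
  rw [map_smul] at h
  exact h

theorem odd_add (x y : M) (m : ℤ) :
    gen (L := L) κ (.odd (x + y) m) = gen κ (.odd x m) + gen κ (.odd y m) := by
  have h := mk_rel (ModeRel.odd_add (L := L) (κ := κ) x y m)
  rw [map_add] at h
  exact h

theorem odd_smul (c : ℂ) (x : M) (m : ℤ) :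
    gen (L := L) κ (.odd (c • x) m) = c • gen κ (.odd x m) := by
  have h := mk_rel (ModeRel.odd_smul (L := L) (κ := κ) c x m)
  rw [map_smul] at h
  exact h

theorem even_even (x y : L) (m l : ℤ) :
    gen (M := M) κ (.even x m) * gen κ (.even y l) - gen κ (.even y l) * gen κ (.even x m) =
      gen κ (.even ⁅x, y⁆ (m + l)) +
        algebraMap ℂ _ (if m + l = 0 then (m : ℂ) * κ x y else 0) := by
  have h := mk_rel (ModeRel.even_even (M := M) (κ := κ) x y m l)
  rw [map_sub, map_mul, map_mul, map_add, AlgHom.commutes] at h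
  exact h

theorem even_odd (x : L) (y : M) (m l : ℤ) :
    gen κ (.even x m) * gen κ (.odd y l) - gen κ (.odd y l) * gen κ (.even x m) =
      gen κ (.odd ⁅x, y⁆ (m + l)) := by
  have h := mk_rel (ModeRel.even_odd (κ := κ) x y m l)
  rw [map_sub, map_mul, map_mul] at h
  exact h

theorem odd_odd (x y : M) (m l : ℤ) :
    gen (L := L) κ (.odd x m) * gen κ (.odd y l) + gen κ (.odd y l) * gen κ (.odd x m) = 0 := by
  have h := mk_rel (ModeRel.odd_odd (L := L) (κ := κ) x y m l)
  rw [map_add, map_mul, map_mul, map_zero] at h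
  exact h

end relations

/-- The parity automorphism: `x tᵐ ↦ x tᵐ` for `x` even, `y tᵐ ↦ - y tᵐ` for `y` odd. -/
def parity (κ : LinearMap.BilinForm ℂ L) : ModeAlgebra M κ →ₐ[ℂ] ModeAlgebra M κ :=
  lift (fun g => match g with
    | .even x m => gen κ (.even x m)
    | .odd y m => - gen κ (.odd y m)) (by
      intro a b h
      induction h with
      | even_add x y m => simpa using even_add κ x y m
      | even_smul c x m => simpa using even_smul κ c x m
      | odd_add x y m => simp [odd_add κ x y m, add_comm]
      | odd_smul c x m => simp [odd_smul κ c x m]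
      | even_even x y m l =>
        rw [map_sub, map_mul, map_mul, map_add, AlgHom.commutes]
        simpa using even_even κ x y m l
      | even_odd x y m l =>
        simp only [map_sub, map_mul, FreeAlgebra.lift_ι_apply, ← even_odd κ x y m l]
        noncomm_ring
      | odd_odd x y m l =>
        simpa using odd_odd κ x y m l)

/-- The homomorphism `a ↦ (a, ∂a)` to the dual numbers, where `∂(x tᵐ) = -m x tᵐ⁻¹`. -/
def dualTranslation (κ : LinearMap.BilinForm ℂ L) :
    ModeAlgebra M κ →ₐ[ℂ] DualNumber (ModeAlgebra M κ) :=
  lift (fun g => match g with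
    | .even x m => TrivSqZeroExt.inl (gen κ (.even x m)) +
        TrivSqZeroExt.inr ((-m : ℂ) • gen κ (.even x (m - 1)))
    | .odd y m => TrivSqZeroExt.inl (gen κ (.odd y m)) +
        TrivSqZeroExt.inr ((-m : ℂ) • gen κ (.odd y (m - 1)))) (by
      intro a b h
      induction h with
      | even_add x y m =>
        ext <;> simp [even_add κ]
        abel
      | even_smul c x m =>
        ext <;> simp [even_smul κ, smul_comm c]
      | odd_add x y m =>
        ext <;> simp [odd_add κ]
        abel
      | odd_smul c x m =>
        ext <;> simp [odd_smul κ, smul_comm c]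
      | even_even x y m l =>
        rw [map_sub, map_mul, map_mul, map_add, AlgHom.commutes]
        simp only [FreeAlgebra.lift_ι_apply]
        ext
        · simpa [TrivSqZeroExt.algebraMap_eq_inl'] using even_even κ x y m l
        · have h1 := even_even (M := M) κ x y m (l - 1)
          have h2 := even_even (M := M) κ x y (m - 1) l
          have e1 : m + (l - 1) = m + l - 1 := by ring
          have e2 : m - 1 + l = m + l - 1 := by ring
          rw [e1] at h1
          rw [e2] at h2
          have h3 : (-l : ℂ) • algebraMap ℂ (ModeAlgebra M κ)
              (if m + l - 1 = 0 then (m : ℂ) * κ x y else 0) +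
              (-m : ℂ) • algebraMap ℂ (ModeAlgebra M κ)
              (if m + l - 1 = 0 then ((m - 1 : ℤ) : ℂ) * κ x y else 0) = 0 := by
            split_ifs with h
            · have h' : (l : ℂ) = 1 - m := by
                have : l = 1 - m := by linarith
                rw [this]; push_cast; ring
              rw [Algebra.algebraMap_eq_smul_one, Algebra.algebraMap_eq_smul_one, smul_smul,
                smul_smul, ← add_smul, h']
              convert zero_smul ℂ (1 : ModeAlgebra M κ) using 2
              push_cast
              ring
            · simp
          simp [TrivSqZeroExt.algebraMap_eq_inl']
          linear_combination (norm := module) (-l : ℂ) • h1 + (-m : ℂ) • h2 + h3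
      | even_odd x y m l =>
        simp only [map_sub, map_mul, FreeAlgebra.lift_ι_apply]
        ext
        · simpa using even_odd κ x y m l
        · have h1 := even_odd κ x y m (l - 1)
          have h2 := even_odd κ x y (m - 1) l
          have e1 : m + (l - 1) = m + l - 1 := by ring
          have e2 : m - 1 + l = m + l - 1 := by ring
          rw [e1] at h1
          rw [e2] at h2
          simp
          linear_combination (norm := module) (-l : ℂ) • h1 + (-m : ℂ) • h2
      | odd_odd x y m l =>
        simp only [map_add, map_mul, map_zero, FreeAlgebra.lift_ι_apply]
        ext
        · simpa using odd_odd κ x y m l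
        · have h1 := odd_odd (L := L) κ x y m (l - 1)
          have h2 := odd_odd (L := L) κ x y (m - 1) l
          simp
          linear_combination (norm := module) (-l : ℂ) • h1 + (-m : ℂ) • h2)

theorem parity_gen (g : ModeGen L M) :
    parity κ (gen κ g) = match g with
      | .even _ _ => gen κ g
      | .odd _ _ => - gen κ g := by
  rw [parity, lift_gen]
  cases g <;> rfl

theorem fst_dualTranslation (a : ModeAlgebra M κ) : (dualTranslation κ a).fst = a := by
  have h : (TrivSqZeroExt.fstHom ℂ (ModeAlgebra M κ) (ModeAlgebra M κ)).comp (dualTranslation κ) =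
      AlgHom.id ℂ _ := by
    apply hom_ext
    intro g
    simp only [AlgHom.comp_apply, dualTranslation, lift_gen]
    cases g <;> simp
  exact DFunLike.congr_fun h a

/-- The derivation `∂` of the mode algebra with `∂(x tᵐ) = -m x tᵐ⁻¹`. -/
def translation (κ : LinearMap.BilinForm ℂ L) : ModeAlgebra M κ →ₗ[ℂ] ModeAlgebra M κ :=
  (TrivSqZeroExt.sndHom (ModeAlgebra M κ) (ModeAlgebra M κ)).restrictScalars ℂ ∘ₗ
    (dualTranslation κ).toLinearMap

theorem translation_apply (a : ModeAlgebra M κ) :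
    translation κ a = (dualTranslation κ a).snd := rfl

theorem translation_mul (a b : ModeAlgebra M κ) :
    translation κ (a * b) = translation κ a * b + a * translation κ b := by
  simp only [translation_apply, map_mul, TrivSqZeroExt.snd_mul, fst_dualTranslation,
    smul_eq_mul, op_smul_eq_mul]
  exact add_comm _ _

theorem translation_gen (g : ModeGen L M) :
    translation κ (gen κ g) = match g with
      | .even x m => (-m : ℂ) • gen κ (.even x (m - 1))
      | .odd y m => (-m : ℂ) • gen κ (.odd y (m - 1)) := by
  rw [translation_apply, dualTranslation, lift_gen]
  cases g <;> simp

/-- The homomorphism of mode algebras induced by an `L`-linear map of the odd parts. -/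
def map {M' : Type w} [AddCommGroup M'] [Module ℂ M'] [LieRingModule L M']
    (κ : LinearMap.BilinForm ℂ L) (φ : M →ₗ⁅ℂ, L⁆ M') : ModeAlgebra M κ →ₐ[ℂ] ModeAlgebra M' κ :=
  lift (fun g => match g with
    | .even x m => gen κ (.even x m)
    | .odd y m => gen κ (.odd (φ y) m)) (by
      intro a b h
      induction h with
      | even_add x y m => simpa using even_add κ x y m
      | even_smul c x m => simpa using even_smul κ c x m
      | odd_add x y m => simpa using odd_add κ (φ x) (φ y) m
      | odd_smul c x m => simpa using odd_smul κ c (φ x) m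
      | even_even x y m l =>
        rw [map_sub, map_mul, map_mul, map_add, AlgHom.commutes]
        simpa using even_even κ x y m l
      | even_odd x y m l =>
        simpa using even_odd κ x (φ y) m l
      | odd_odd x y m l =>
        simpa using odd_odd κ (φ x) (φ y) m l)

theorem map_gen {M' : Type w} [AddCommGroup M'] [Module ℂ M'] [LieRingModule L M']
    (φ : M →ₗ⁅ℂ, L⁆ M') (g : ModeGen L M) :
    map κ φ (gen κ g) = match g with
      | .even x m => gen κ (.even x m)
      | .odd y m => gen κ (.odd (φ y) m) := by
  rw [map, lift_gen]

variable (M) in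
/-- The left ideal generated by all `x tᵐ` with `m ≥ 0`. -/
def annihilationIdeal (κ : LinearMap.BilinForm ℂ L) :
    Submodule (ModeAlgebra M κ) (ModeAlgebra M κ) :=
  Submodule.span _ {a | ∃ g : ModeGen L M, 0 ≤ g.exponent ∧ a = gen κ g}

theorem gen_mem {g : ModeGen L M} (h : 0 ≤ g.exponent) : gen κ g ∈ annihilationIdeal M κ :=
  Submodule.subset_span ⟨g, h, rfl⟩

theorem parity_mem {a : ModeAlgebra M κ} (ha : a ∈ annihilationIdeal M κ) :
    parity κ a ∈ annihilationIdeal M κ := by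
  induction ha using Submodule.span_induction with
  | mem a h =>
    obtain ⟨g, hg, rfl⟩ := h
    rw [parity_gen]
    cases g
    · exact gen_mem hg
    · exact neg_mem (gen_mem hg)
  | zero => simp
  | add a b _ _ h1 h2 => rw [map_add]; exact add_mem h1 h2
  | smul r a _ h =>
    rw [smul_eq_mul, map_mul]
    exact Submodule.smul_mem _ _ h

theorem translation_mem {a : ModeAlgebra M κ} (ha : a ∈ annihilationIdeal M κ) :
    translation κ a ∈ annihilationIdeal M κ := by
  induction ha using Submodule.span_induction with
  | mem a h =>
    obtain ⟨g, hg, rfl⟩ := h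
    rw [translation_gen]
    cases g with
    | even x m =>
      change 0 ≤ m at hg
      rcases hg.eq_or_lt with h | h
      · simp [← h]
      · exact Submodule.smul_of_tower_mem _ _ (gen_mem (by change 0 ≤ m - 1; omega))
    | odd x m =>
      change 0 ≤ m at hg
      rcases hg.eq_or_lt with h | h
      · simp [← h]
      · exact Submodule.smul_of_tower_mem _ _ (gen_mem (by change 0 ≤ m - 1; omega))
  | zero => simp
  | add a b _ _ h1 h2 => rw [map_add]; exact add_mem h1 h2
  | smul r a ha h =>
    rw [smul_eq_mul, translation_mul]
    exact add_mem (Submodule.smul_mem _ (translation κ r) ha) (Submodule.smul_mem _ r h)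

theorem map_mem {M' : Type w} [AddCommGroup M'] [Module ℂ M'] [LieRingModule L M']
    (φ : M →ₗ⁅ℂ, L⁆ M') {a : ModeAlgebra M κ} (ha : a ∈ annihilationIdeal M κ) :
    map κ φ a ∈ annihilationIdeal M' κ := by
  induction ha using Submodule.span_induction with
  | mem a h =>
    obtain ⟨g, hg, rfl⟩ := h
    rw [map_gen]
    cases g
    · exact gen_mem hg
    · exact gen_mem hg
  | zero => simp
  | add a b _ _ h1 h2 => rw [map_add]; exact add_mem h1 h2
  | smul r a _ h =>
    rw [smul_eq_mul, map_mul]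
    exact Submodule.smul_mem _ _ h

end ModeAlgebra

variable (M) in
/-- The universal affine vertex superalgebra of `(L ⊕ ΠM, κ)`: the module over the affine Lie
superalgebra induced from the vacuum, on which `K = 1` and which `x tᵐ` with `m ≥ 0` annihilates. It is
identified with `U((L ⊕ ΠM)[t⁻¹]t⁻¹)` by letting elements of the latter act on the vacuum. -/
def UniversalAffine (κ : LinearMap.BilinForm ℂ L) : Type (max u v) :=
  ModeAlgebra M κ ⧸ ModeAlgebra.annihilationIdeal M κ

namespace UniversalAffine

variable {κ : LinearMap.BilinForm ℂ L}

instance : AddCommGroup (UniversalAffine M κ) :=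
  inferInstanceAs (AddCommGroup (ModeAlgebra M κ ⧸ ModeAlgebra.annihilationIdeal M κ))

instance : Module (ModeAlgebra M κ) (UniversalAffine M κ) :=
  inferInstanceAs (Module (ModeAlgebra M κ) (ModeAlgebra M κ ⧸ ModeAlgebra.annihilationIdeal M κ))

instance : Module ℂ (UniversalAffine M κ) :=
  inferInstanceAs (Module ℂ (ModeAlgebra M κ ⧸ ModeAlgebra.annihilationIdeal M κ))

instance : IsScalarTower ℂ (ModeAlgebra M κ) (UniversalAffine M κ) :=
  inferInstanceAs (IsScalarTower ℂ (ModeAlgebra M κ)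
    (ModeAlgebra M κ ⧸ ModeAlgebra.annihilationIdeal M κ))

/-- The quotient map, `a ↦ a|0⟩`. -/
def toVac (κ : LinearMap.BilinForm ℂ L) : ModeAlgebra M κ →ₗ[ℂ] UniversalAffine M κ :=
  (Submodule.mkQ (ModeAlgebra.annihilationIdeal M κ)).restrictScalars ℂ

/-- Descent of a linear map along `a ↦ a|0⟩`. -/
def descend {V : Type w} [AddCommGroup V] [Module ℂ V] (f : ModeAlgebra M κ →ₗ[ℂ] V)
    (hf : ∀ a ∈ ModeAlgebra.annihilationIdeal M κ, f a = 0) : UniversalAffine M κ →ₗ[ℂ] V :=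
  ((ModeAlgebra.annihilationIdeal M κ).restrictScalars ℂ).liftQ f hf ∘ₗ
    (Submodule.Quotient.restrictScalarsEquiv ℂ
      (ModeAlgebra.annihilationIdeal M κ)).symm.toLinearMap

theorem toVac_eq_zero {a : ModeAlgebra M κ} (ha : a ∈ ModeAlgebra.annihilationIdeal M κ) :
    toVac κ a = 0 :=
  (Submodule.Quotient.mk_eq_zero _).2 ha

theorem descend_toVac {V : Type w} [AddCommGroup V] [Module ℂ V] (f : ModeAlgebra M κ →ₗ[ℂ] V)
    (hf : ∀ a ∈ ModeAlgebra.annihilationIdeal M κ, f a = 0) (a : ModeAlgebra M κ) :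
    descend f hf (toVac κ a) = f a := rfl

variable (M κ) in
/-- The vacuum vector `|0⟩`. -/
def vac : UniversalAffine M κ := toVac κ 1

/-- The operator `x tᵐ` for `x` even. -/
def even (x : L) (m : ℤ) : Module.End ℂ (UniversalAffine M κ) :=
  Algebra.lsmul ℂ ℂ _ (ModeAlgebra.gen (M := M) κ (.even x m))

/-- The operator `y tᵐ` for `y` odd. -/
def odd (y : M) (m : ℤ) : Module.End ℂ (UniversalAffine M κ) :=
  Algebra.lsmul ℂ ℂ _ (ModeAlgebra.gen (L := L) κ (.odd y m))

/-- The parity involution: `1` on the even part, `-1` on the odd part. -/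
def parity : Module.End ℂ (UniversalAffine M κ) :=
  descend (toVac κ ∘ₗ (ModeAlgebra.parity κ).toLinearMap)
    fun _ ha => toVac_eq_zero (ModeAlgebra.parity_mem ha)

/-- The translation operator `∂`: `∂|0⟩ = 0` and `[∂, x tᵐ] = -m x tᵐ⁻¹`. -/
def translation : Module.End ℂ (UniversalAffine M κ) :=
  descend (toVac κ ∘ₗ ModeAlgebra.translation κ)
    fun _ ha => toVac_eq_zero (ModeAlgebra.translation_mem ha)

/-- The map induced by an `L`-linear map of the odd parts. -/
def map {M' : Type w} [AddCommGroup M'] [Module ℂ M'] [LieRingModule L M']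
    (φ : M →ₗ⁅ℂ, L⁆ M') : UniversalAffine M κ →ₗ[ℂ] UniversalAffine M' κ :=
  descend (toVac κ ∘ₗ (ModeAlgebra.map κ φ).toLinearMap)
    fun _ ha => toVac_eq_zero (ModeAlgebra.map_mem φ ha)

/-- `A(z) = ∑ₘ A m z⁻ᵐ⁻¹` is the vertex operator of the state `u`: it is a field, it is local with
respect to all currents `x(z) = ∑ₘ x tᵐ z⁻ᵐ⁻¹`, that is `(z - w)ᴺ [A(z), x(w)] = 0` for some `N`
(supercommutator), and `A(z)|0⟩ = exp(z∂)u`. For every `u` exactly one family `A` has these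
properties. In `odd_local` conjugation by the parity involution produces the sign of the
supercommutator, for `u` of mixed parity too. -/
structure IsVertexOperator (u : UniversalAffine M κ)
    (A : ℤ → Module.End ℂ (UniversalAffine M κ)) : Prop where
  truncated : ∀ v, ∃ N : ℤ, ∀ m ≥ N, A m v = 0
  even_local : ∀ x : L, ∃ N : ℕ, ∀ m l : ℤ, ∑ i ∈ Finset.range (N + 1),
    ((-1 : ℂ) ^ i * (N.choose i : ℂ)) •
      (A (m + N - i) * even x (l + i) - even x (l + i) * A (m + N - i)) = 0
  odd_local : ∀ y : M, ∃ N : ℕ, ∀ m l : ℤ, ∑ i ∈ Finset.range (N + 1),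
    ((-1 : ℂ) ^ i * (N.choose i : ℂ)) •
      (A (m + N - i) * odd y (l + i) -
        odd y (l + i) * (parity * A (m + N - i) * parity)) = 0
  vac_nonneg : ∀ m : ℤ, 0 ≤ m → A m (vac M κ) = 0
  vac_neg : ∀ j : ℕ, (j.factorial : ℂ) • A (-(j : ℤ) - 1) (vac M κ) = (translation ^ j) u

open Classical in
/-- The vertex operator of a state, as the family of its modes. -/
def vertexOperator (u : UniversalAffine M κ) : ℤ → Module.End ℂ (UniversalAffine M κ) :=
  if h : ∃ A, IsVertexOperator u A then h.choose else 0

/-- The `m`-th product `u₍ₘ₎ v`. -/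
def nProd (m : ℤ) (u v : UniversalAffine M κ) : UniversalAffine M κ := vertexOperator u m v

end UniversalAffine

end Affine

/-! ### The rectangular W-algebra of `sp(4n)` -/

/-- The index set `I_N = {±1, …, ±N}`. -/
def Idx (N : ℕ) : Type := {i : ℤ // i ∈ (Finset.Icc (-(N : ℤ)) N).erase 0}

namespace Idx

variable {N : ℕ}

instance : DecidableEq (Idx N) :=
  inferInstanceAs (DecidableEq {i : ℤ // i ∈ (Finset.Icc (-(N : ℤ)) N).erase 0})

instance : Fintype (Idx N) :=
  inferInstanceAs (Fintype {i : ℤ // i ∈ (Finset.Icc (-(N : ℤ)) N).erase 0})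

theorem ne_zero (i : Idx N) : i.1 ≠ 0 := (Finset.mem_erase.1 i.2).1

theorem bounds (i : Idx N) : -(N : ℤ) ≤ i.1 ∧ i.1 ≤ N :=
  Finset.mem_Icc.1 (Finset.mem_erase.1 i.2).2

/-- Constructor from an integer. -/
def of (i : ℤ) (h0 : i ≠ 0) (h1 : -(N : ℤ) ≤ i) (h2 : i ≤ N) : Idx N :=
  ⟨i, Finset.mem_erase.2 ⟨h0, Finset.mem_Icc.2 ⟨h1, h2⟩⟩⟩

instance : Neg (Idx N) :=
  ⟨fun i => of (-i.1) (neg_ne_zero.2 i.ne_zero) (by have := i.bounds; omega)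
    (by have := i.bounds; omega)⟩

instance : InvolutiveNeg (Idx N) where
  neg_neg _ := Subtype.ext (neg_neg _)

/-- The parity `p(i)`: `0` if `i > 0`, `1` if `i < 0`. -/
def p (i : Idx N) : ℕ := if 0 < i.1 then 0 else 1

theorem p_neg (i : Idx N) : (-i).p = 1 - i.p := by
  have h := i.ne_zero
  have h' : (-i).1 = -i.1 := rfl
  unfold p
  rw [h']
  split_ifs <;> omega

/-- The order isomorphism of `I_n` onto the positive part of `I_{2n}`, written `n + i`. -/
def hi {n : ℕ} (i : Idx n) : Idx (2 * n) :=
  of (if 0 < i.1 then n + i.1 else n + i.1 + 1)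
    (by have := i.bounds; have := i.ne_zero; split_ifs <;> omega)
    (by have := i.bounds; have := i.ne_zero; push_cast; split_ifs <;> omega)
    (by have := i.bounds; have := i.ne_zero; push_cast; split_ifs <;> omega)

/-- The order isomorphism of `I_n` onto the negative part of `I_{2n}`, written `-n + i`. -/
def lo {n : ℕ} (i : Idx n) : Idx (2 * n) :=
  of (if 0 < i.1 then -n + i.1 - 1 else -n + i.1)
    (by have := i.bounds; have := i.ne_zero; split_ifs <;> omega)
    (by have := i.bounds; have := i.ne_zero; push_cast; split_ifs <;> omega)
    (by have := i.bounds; have := i.ne_zero; push_cast; split_ifs <;> omega)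

theorem p_hi {n : ℕ} (i : Idx n) : (hi i).p = 0 := by
  have := i.bounds
  have := i.ne_zero
  have h : 0 < (hi i).1 := by
    change 0 < (if 0 < i.1 then (n : ℤ) + i.1 else n + i.1 + 1)
    split_ifs <;> omega
  simp [p, h]

theorem p_lo {n : ℕ} (i : Idx n) : (lo i).p = 1 := by
  have := i.bounds
  have := i.ne_zero
  have h : ¬ 0 < (lo i).1 := by
    change ¬ 0 < (if 0 < i.1 then -(n : ℤ) + i.1 - 1 else -n + i.1)
    split_ifs <;> omega
  simp [p, h]

end Idx

variable (n : ℕ)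

/-- The sign `(-1)^{p(i)+p(j)}`. -/
def sgn {N : ℕ} (i j : Idx N) : ℂ := (-1) ^ (i.p + j.p)

/-- The matrix `F_{i,j} = e_{i,j} - (-1)^{p(i)+p(j)} e_{-j,-i}`. -/
def F {N : ℕ} (i j : Idx N) : Matrix (Idx N) (Idx N) ℂ :=
  Matrix.single i j 1 - sgn i j • Matrix.single (-j) (-i) 1

/-- The commutator of matrices. -/
instance (N : ℕ) : LieRing (Matrix (Idx N) (Idx N) ℂ) := LieRing.ofAssociativeRing

/-- The Lie algebra `𝔟 = 𝔤₀ ⊕ 𝔤₋₂` spanned by the `F_{i,j}` with `p(i) = p(j)` or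
`p(i) = 0, p(j) = 1`: the matrices in `sp(4n)` whose entries with `p(i) = 1, p(j) = 0` vanish. -/
def b : LieSubalgebra ℂ (Matrix (Idx (2 * n)) (Idx (2 * n)) ℂ) where
  carrier := {A | (∀ i j, A (-j) (-i) = - (sgn i j * A i j)) ∧
    ∀ i j, i.p = 1 → j.p = 0 → A i j = 0}
  zero_mem' := by simp
  add_mem' := by
    rintro A B ⟨hA, hA'⟩ ⟨hB, hB'⟩
    refine ⟨fun i j => ?_, fun i j hi hj => ?_⟩
    · simp only [Matrix.add_apply, hA, hB]; ring
    · simp [hA' i j hi hj, hB' i j hi hj]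
  smul_mem' := by
    rintro c A ⟨hA, hA'⟩
    refine ⟨fun i j => ?_, fun i j hi hj => ?_⟩
    · simp only [Matrix.smul_apply, smul_eq_mul, hA]; ring
    · simp [hA' i j hi hj]
  lie_mem' := by
    rintro A B ⟨hA, hA'⟩ ⟨hB, hB'⟩
    have key : ∀ (X Y : Matrix (Idx (2 * n)) (Idx (2 * n)) ℂ),
        (∀ i j, X (-j) (-i) = - (sgn i j * X i j)) → (∀ i j, Y (-j) (-i) = - (sgn i j * Y i j)) →
        ∀ i j, (X * Y) (-j) (-i) = sgn i j * (Y * X) i j := by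
      intro X Y hX hY i j
      rw [Matrix.mul_apply, Matrix.mul_apply, Finset.mul_sum,
        ← Equiv.sum_comp (Equiv.neg (Idx (2 * n)))]
      refine Finset.sum_congr rfl fun u _ => ?_
      rw [Equiv.neg_apply, hX u j, hY i u]
      have : sgn u j * sgn i u = sgn i j := by
        have h : ((-1 : ℂ) ^ u.p) * (-1) ^ u.p = 1 := by rw [← mul_pow]; simp
        simp only [sgn, pow_add]
        linear_combination (-1) ^ i.p * (-1) ^ j.p * h
      rw [← this]
      ring
    have van : ∀ (X Y : Matrix (Idx (2 * n)) (Idx (2 * n)) ℂ),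
        (∀ i j, i.p = 1 → j.p = 0 → X i j = 0) → (∀ i j, i.p = 1 → j.p = 0 → Y i j = 0) →
        ∀ i j, i.p = 1 → j.p = 0 → (X * Y) i j = 0 := by
      intro X Y hX hY i j hi hj
      rw [Matrix.mul_apply]
      refine Finset.sum_eq_zero fun u _ => ?_
      by_cases hu : 0 < u.1
      · rw [hX i u hi (by simp [Idx.p, hu]), zero_mul]
      · rw [hY u j (by simp [Idx.p, hu]) hj, mul_zero]
    refine ⟨fun i j => ?_, fun i j hi hj => ?_⟩
    · rw [Ring.lie_def, Matrix.sub_apply, Matrix.sub_apply, key A B hA hB, key B A hB hA]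
      ring
    · rw [Ring.lie_def, Matrix.sub_apply, van A B hA' hB' i j hi hj, van B A hB' hA' i j hi hj,
        sub_zero]

theorem F_mem (i j : Idx (2 * n)) (h : ¬ (i.p = 1 ∧ j.p = 0)) : F i j ∈ b n := by
  have hp : ∀ u : Idx (2 * n), u.p = 0 ∨ u.p = 1 := fun u => by unfold Idx.p; split_ifs <;> simp
  refine ⟨fun u v => ?_, fun u v hu hv => ?_⟩
  · have e : sgn i j * sgn i j = 1 := by rw [sgn, ← mul_pow]; simp
    have c1 : (i = -v ∧ j = -u) ↔ (-j = u ∧ -i = v) := by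
      rw [neg_eq_iff_eq_neg, neg_eq_iff_eq_neg, and_comm]
    have c2 : (-j = -v ∧ -i = -u) ↔ (i = u ∧ j = v) := by
      rw [neg_inj, neg_inj, and_comm]
    have e1 : i = u ∧ j = v → sgn u v = sgn i j := by rintro ⟨rfl, rfl⟩; rfl
    have e2 : -j = u ∧ -i = v → sgn u v = sgn i j := by
      rintro ⟨rfl, rfl⟩
      rcases hp i with h | h <;> rcases hp j with h' | h' <;> simp [sgn, Idx.p_neg, h, h']
    simp only [F, Matrix.sub_apply, Matrix.smul_apply, Matrix.single_apply, smul_eq_mul, c1, c2]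
    by_cases h1 : i = u ∧ j = v
    · rw [e1 h1]
      split_ifs
      · linear_combination (-e)
      · ring
    · by_cases h2 : -j = u ∧ -i = v
      · rw [e2 h2, if_neg h1, if_pos h2]
        linear_combination (-e)
      · simp [h1, h2]
  · have h1 : ¬ (i = u ∧ j = v) := by
      rintro ⟨rfl, rfl⟩
      exact h ⟨hu, hv⟩
    have h2 : ¬ (-j = u ∧ -i = v) := by
      rintro ⟨rfl, rfl⟩
      rw [Idx.p_neg] at hu hv
      have := hp i
      have := hp j
      omega
    simp [F, h1, h2]

/-- The ideal `𝔤₋₂` of `𝔟`, spanned by the `F_{i,j}` with `p(i) = 0, p(j) = 1`. As a module over `𝔟`,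
with odd parity, it is the span of the `ψ_{i,j}`. -/
def gm2 : LieIdeal ℂ (b n) where
  carrier := {x | ∀ i j, i.p = j.p → x.1 i j = 0}
  zero_mem' := by simp
  add_mem' := by
    intro x y hx hy i j h
    simp [hx i j h, hy i j h]
  smul_mem' := by
    intro c x hx i j h
    simp [hx i j h]
  lie_mem := by
    intro x y hy i j h
    have hp : ∀ u : Idx (2 * n), u.p = 0 ∨ u.p = 1 := fun u => by unfold Idx.p; split_ifs <;> simp
    change (x.1 * y.1 - y.1 * x.1) i j = 0
    rw [Matrix.sub_apply, Matrix.mul_apply, Matrix.mul_apply, Finset.sum_eq_zero,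
      Finset.sum_eq_zero, sub_zero]
    · intro u _
      by_cases hu : i.p = u.p
      · rw [hy i u hu, zero_mul]
      · rcases hp i with hi | hi
        · rw [x.2.2 u j (by have := hp u; omega) (by omega), mul_zero]
        · rw [y.2.2 i u hi (by have := hp u; omega), zero_mul]
    · intro u _
      by_cases hu : u.p = j.p
      · rw [hy u j hu, mul_zero]
      · rcases hp i with hi | hi
        · rw [y.2.2 u j (by have := hp u; omega) (by omega), mul_zero]
        · rw [x.2.2 i u hi (by have := hp u; omega), zero_mul]

/-- `F_{-n+i,-n+j} ∈ 𝔟`. -/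
def Flo (i j : Idx n) : b n := ⟨F i.lo j.lo, F_mem n _ _ (by simp [Idx.p_lo])⟩

/-- `F_{n+i,n+j} ∈ 𝔟`. -/
def Fhi (i j : Idx n) : b n := ⟨F i.hi j.hi, F_mem n _ _ (by simp [Idx.p_hi])⟩

/-- `F_{n+i,-n+j} ∈ 𝔟`. -/
def Fhl (i j : Idx n) : b n := ⟨F i.hi j.lo, F_mem n _ _ (by simp [Idx.p_hi])⟩

/-- `ψ_{n+i,-n+j}`. -/
def psi (i j : Idx n) : gm2 n := ⟨Fhl n i j, by
  intro u v h
  have h1 : ¬ (i.hi = u ∧ j.lo = v) := by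
    rintro ⟨rfl, rfl⟩
    simp [Idx.p_hi, Idx.p_lo] at h
  have h2 : ¬ (-j.lo = u ∧ -i.hi = v) := by
    rintro ⟨rfl, rfl⟩
    simp [Idx.p_neg, Idx.p_hi, Idx.p_lo] at h
  change F i.hi j.lo u v = 0
  simp [F, h1, h2]⟩

/-- `α = k + n + 2`. -/
def alpha (k : ℂ) : ℂ := k + n + 2

/-- The trace of the block of `x` with positive indices. -/
def posTrace : b n →ₗ[ℂ] ℂ where
  toFun x := ∑ i : Idx n, x.1 i.hi i.hi
  map_add' x y := by simp [Finset.sum_add_distrib]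
  map_smul' c x := by simp [Finset.mul_sum]

/-- The form `κ(x, y) = (α/2) tr(xy) + tr₊(x) tr₊(y)` on `𝔟`, that is
`κ(F_{i,j}, F_{a,b}) = α (δ_{i,b} δ_{j,a} - (-1)^{p(i)+p(j)} δ_{-j,b} δ_{-i,a})
  + (-1)^{p(i)+p(a)} δ_{i,j} δ_{a,b}`. -/
def kappa (k : ℂ) : LinearMap.BilinForm ℂ (b n) :=
  LinearMap.mk₂ ℂ (fun x y => alpha n k / 2 * (x.1 * y.1).trace + posTrace n x * posTrace n y)
    (fun x y z => by simp [add_mul, Matrix.trace_add]; ring)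
    (fun c x y => by simp [Matrix.trace_smul]; ring)
    (fun x y z => by simp [mul_add, Matrix.trace_add]; ring)
    (fun c x y => by simp [Matrix.trace_smul]; ring)

/-- `V^κ(𝔞)` for `𝔞 = 𝔟 ⊕ Π𝔤₋₂`. -/
abbrev Va (k : ℂ) : Type := UniversalAffine (gm2 n) (kappa n k)

/-- `V^κ(𝔟)`: the odd part is zero. -/
abbrev Vb (k : ℂ) : Type :=
  UniversalAffine (⊥ : LieSubmodule ℂ (b n) (gm2 n)) (kappa n k)

/-- The homomorphism `V^κ(𝔟) → V^κ(𝔞)` induced by the inclusion `𝔟 ⊆ 𝔞`. -/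
def incl (k : ℂ) : Vb n k →ₗ[ℂ] Va n k :=
  UniversalAffine.map (⊥ : LieSubmodule ℂ (b n) (gm2 n)).incl

open UniversalAffine in
/-- `d : V^κ(𝔟) → V^κ(𝔞)` is the odd derivation of the `(-1)`-product which kills the vacuum, commutes
with `∂` and has the prescribed values on the generators `F_{i,j}[-1]` of `V^κ(𝔟)`. Every index in
`I_{2n}` is `-n + i` or `n + i` for a unique `i ∈ I_n`. -/
structure IsDifferential (k : ℂ) (d : Vb n k →ₗ[ℂ] Va n k) : Prop where
  d_odd : ∀ v, parity (d v) = - d v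
  d_vac : d (vac _ _) = 0
  d_translation : ∀ v, d (translation v) = translation (d v)
  d_leibniz : ∀ u v, d (nProd (-1) u v) =
    nProd (-1) (d u) (incl n k v) + nProd (-1) (incl n k u) (d v)
  d_Flo : ∀ i j, d (even (Flo n i j) (-1) (vac _ _)) =
    odd (psi n i j) (-1) (vac _ _)
  d_Fhi : ∀ i j, d (even (Fhi n i j) (-1) (vac _ _)) =
    - odd (psi n i j) (-1) (vac _ _)
  d_Fhl : ∀ i j, d (even (Fhl n i j) (-1) (vac _ _)) =
    ∑ u, even (Flo n u j) (-1) (odd (psi n i u) (-1) (vac _ _)) -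
    ∑ u, odd (psi n u j) (-1) (even (Fhi n i u) (-1) (vac _ _)) +
    (k + n + 1) • odd (psi n i j) (-2) (vac _ _)

/-- The W-algebra `W^k(sp(4n), f) = {y ∈ V^κ(𝔟) | d y = 0}`, for the differential `d`. -/
def WAlgebra (k : ℂ) (d : Vb n k →ₗ[ℂ] Va n k) : Submodule ℂ (Vb n k) := LinearMap.ker d

open UniversalAffine in
/-- `W⁽¹⁾_{i,j} = F_{-n+i,-n+j}[-1] + F_{n+i,n+j}[-1]`. -/
def W1 (k : ℂ) (i j : Idx n) : Vb n k :=
  even (Flo n i j) (-1) (vac _ _) + even (Fhi n i j) (-1) (vac _ _)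

open UniversalAffine in
/-- `W⁽²⁾_{i,j} = F_{n+i,-n+j}[-1] + (α-1) F_{n+i,n+j}[-2] + ∑ᵤ F_{-n+u,-n+j}[-1] F_{n+i,n+u}[-1]`. -/
def W2 (k : ℂ) (i j : Idx n) : Vb n k :=
  even (Fhl n i j) (-1) (vac _ _) + (alpha n k - 1) • even (Fhi n i j) (-2) (vac _ _) +
    ∑ u, even (Flo n u j) (-1) (even (Fhi n i u) (-1) (vac _ _))

end

end RectW

/-! Uniqueness is formal. `V^κ(𝔟)` is obtained from `|0⟩` by applying `∂` and the operators `x₍₋₁₎`,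
`x ∈ 𝔟` (`submodule_eq_top_of_translation`), so a derivation of the (-1)-product that commutes with
`∂` is fixed by its values on `|0⟩` and on the generators.

For existence, let `δ : 𝔟 → V^κ(𝔞)` be the linear map sending `F` to the prescribed value of
`d₀(F[-1])`. Over the dual numbers, with `ε² = 0`, consider `x tᵐ ↦ x tᵐ + ε Y(δx)₍ₘ₎`. This
respects the affine relations as soon as `[x tᵐ, Y(δy)₍ₗ₎] = Y(x₍₀₎δy)₍ₘ₊ₗ₎` and `x₍₀₎δy - y₍₀₎δx =
δ[x, y]`. The first identity holds when `δy` is primary, that is `x₍ⱼ₎δy = 0` for `j ≥ 1`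
(`even_vertexOperator`); the second says that `δ` is a cocycle. Then `d₀(a|0⟩)` is the
`ε`-coefficient of the image of `a`, applied to the vacuum (`cocycleExtension`). Both conditions on
`δ` are finite checks on the spanning elements (`cocycle_primary`, `cocycle_lie`). The coefficient
`k+n+1` and the summand `tr₊ tr₊` of `κ` are what makes `δ` primary.

The products `u₍ₘ₎v` are given by a characterization of vertex operators, so the basic theory has to
be built. Every state has a field, by normally ordered products and Dong's lemma
(`isLocal_normalOrder`). It has only one, by Goddard's argument: a family of maps that kills `|0⟩`
and is local with respect to all currents vanishes (`eq_zero_of_isLocal_current`). The same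
principle yields the commutator formula and the Leibniz rule for all products
(`cocycleExtension_vertexOperator`).

Finally `W⁽¹⁾` is closed at sight. In `W⁽²⁾` the derivation property turns the quadratic sum into
the negative of the quadratic part of `d₀(F_{n+i,-n+j}[-1])`, and the `ψ[-2]` terms cancel because
`α - 1 = k + n + 1`. -/

namespace RectW

noncomputable section

/-! ### Locality of families of modes -/

section Shift

variable {E E' : Type*} [AddCommGroup E] [Module ℂ E] [AddCommGroup E'] [Module ℂ E']

variable (E) in
/-- Multiplication of a formal distribution in `z, w` by `z - w`, in terms of modes. -/
def shiftSub : Module.End ℂ (ℤ → ℤ → E) where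
  toFun g := fun m l => g (m + 1) l - g m (l + 1)
  map_add' f g := by funext m l; simp; abel
  map_smul' c g := by funext m l; simp [smul_sub]

theorem shiftSub_apply (g : ℤ → ℤ → E) (m l : ℤ) :
    shiftSub E g m l = g (m + 1) l - g m (l + 1) := rfl

theorem shiftSub_pow_succ (N : ℕ) (g : ℤ → ℤ → E) :
    (shiftSub E ^ (N + 1)) g = (shiftSub E ^ N) (shiftSub E g) := by
  rw [pow_succ]; rfl

theorem shiftSub_pow_succ' (N : ℕ) (g : ℤ → ℤ → E) :
    (shiftSub E ^ (N + 1)) g = shiftSub E ((shiftSub E ^ N) g) := by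
  rw [pow_succ']; rfl

/-- The two index shifts commute, so the binomial theorem applies. The right side is the sum that
occurs in `IsVertexOperator`, which makes `IsLocal` the same notion of locality. -/
theorem shiftSub_pow_apply (N : ℕ) (g : ℤ → ℤ → E) (m l : ℤ) :
    (shiftSub E ^ N) g m l = ∑ i ∈ Finset.range (N + 1),
      ((-1 : ℂ) ^ i * (N.choose i : ℂ)) • g (m + N - i) (l + i) := by
  let S₁ : Module.End ℂ (ℤ → ℤ → E) :=
    { toFun := fun g m l => g (m + 1) l
      map_add' := fun _ _ => rfl
      map_smul' := fun _ _ => rfl }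
  let S₂ : Module.End ℂ (ℤ → ℤ → E) :=
    { toFun := fun g m l => g m (l + 1)
      map_add' := fun _ _ => rfl
      map_smul' := fun _ _ => rfl }
  have h₁ : ∀ (k : ℕ) (g : ℤ → ℤ → E) (m l : ℤ), (S₁ ^ k) g m l = g (m + k) l := by
    intro k
    induction k with
    | zero => simp
    | succ k ih =>
      intro g m l
      rw [pow_succ, Module.End.mul_apply, ih]
      change g (m + k + 1) l = _
      push_cast
      rw [add_assoc]
  have h₂ : ∀ (k : ℕ) (g : ℤ → ℤ → E) (m l : ℤ), (S₂ ^ k) g m l = g m (l + k) := by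
    intro k
    induction k with
    | zero => simp
    | succ k ih =>
      intro g m l
      rw [pow_succ, Module.End.mul_apply, ih]
      change g m (l + k + 1) = _
      push_cast
      rw [add_assoc]
  have hd : shiftSub E = (-1 : ℂ) • S₂ + S₁ := by
    ext g m l
    change g (m + 1) l - g m (l + 1) = (-1 : ℂ) • g m (l + 1) + g (m + 1) l
    module
  have hc : Commute ((-1 : ℂ) • S₂) S₁ :=
    Commute.smul_left (show S₂ * S₁ = S₁ * S₂ from rfl) _
  rw [hd, hc.add_pow, LinearMap.sum_apply, Finset.sum_apply, Finset.sum_apply]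
  refine Finset.sum_congr rfl fun i hi => ?_
  have hi' : i ≤ N := by simpa [Nat.lt_succ_iff] using hi
  have e : ((-1 : ℂ) • S₂) ^ i * S₁ ^ (N - i) * (N.choose i : Module.End ℂ (ℤ → ℤ → E)) =
      ((-1 : ℂ) ^ i * (N.choose i : ℂ)) • (S₂ ^ i * S₁ ^ (N - i)) := by
    rw [← Nat.cast_comm, ← nsmul_eq_mul, ← Nat.cast_smul_eq_nsmul ℂ, mul_comm, mul_smul, smul_pow,
      smul_mul_assoc]
  rw [e]
  change ((-1 : ℂ) ^ i * (N.choose i : ℂ)) • (S₂ ^ i) ((S₁ ^ (N - i)) g) m l = _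
  rw [h₂, h₁]
  push_cast [hi']
  congr 2
  ring

/-- A formal distribution in `z, w` is killed by some power of `z - w`. -/
def IsLocal (g : ℤ → ℤ → E) : Prop := ∃ N : ℕ, (shiftSub E ^ N) g = 0

theorem shiftSub_pow_eq_zero_of_le {g : ℤ → ℤ → E} {N N' : ℕ} (h : N ≤ N')
    (hg : (shiftSub E ^ N) g = 0) : (shiftSub E ^ N') g = 0 := by
  obtain ⟨k, rfl⟩ := Nat.exists_eq_add_of_le h
  rw [add_comm, pow_add, Module.End.mul_apply, hg, map_zero]

theorem isLocal_iff {g : ℤ → ℤ → E} : IsLocal g ↔ ∃ N : ℕ, ∀ m l : ℤ,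
    ∑ i ∈ Finset.range (N + 1),
      ((-1 : ℂ) ^ i * (N.choose i : ℂ)) • g (m + N - i) (l + i) = 0 := by
  refine exists_congr fun N => ⟨fun h m l => ?_, fun h => ?_⟩
  · rw [← shiftSub_pow_apply, h]; rfl
  · funext m l
    rw [shiftSub_pow_apply, h]; rfl

theorem isLocal_zero : IsLocal (0 : ℤ → ℤ → E) := ⟨0, rfl⟩

theorem IsLocal.add {g h : ℤ → ℤ → E} (hg : IsLocal g) (hh : IsLocal h) : IsLocal (g + h) := by
  obtain ⟨N, hN⟩ := hg
  obtain ⟨K, hK⟩ := hh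
  refine ⟨max N K, ?_⟩
  rw [map_add, shiftSub_pow_eq_zero_of_le (le_max_left N K) hN,
    shiftSub_pow_eq_zero_of_le (le_max_right N K) hK, add_zero]

theorem IsLocal.smul {g : ℤ → ℤ → E} (c : ℂ) (hg : IsLocal g) : IsLocal (c • g) := by
  obtain ⟨N, hN⟩ := hg
  exact ⟨N, by rw [map_smul, hN, smul_zero]⟩

theorem IsLocal.neg {g : ℤ → ℤ → E} (hg : IsLocal g) : IsLocal (-g) := by
  simpa using hg.smul (-1)

theorem IsLocal.sub {g h : ℤ → ℤ → E} (hg : IsLocal g) (hh : IsLocal h) : IsLocal (g - h) := by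
  rw [sub_eq_add_neg]
  exact hg.add hh.neg

theorem shiftSub_pow_map (T : E →ₗ[ℂ] E') (N : ℕ) (g : ℤ → ℤ → E) :
    (shiftSub E' ^ N) (fun m l => T (g m l)) = fun m l => T ((shiftSub E ^ N) g m l) := by
  induction N generalizing g with
  | zero => rfl
  | succ N ih =>
    rw [shiftSub_pow_succ, shiftSub_pow_succ, ← ih]
    congr 1
    funext m l
    simp [shiftSub_apply]

theorem IsLocal.map {g : ℤ → ℤ → E} (T : E →ₗ[ℂ] E') (hg : IsLocal g) :
    IsLocal fun m l => T (g m l) := by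
  obtain ⟨N, hN⟩ := hg
  refine ⟨N, ?_⟩
  rw [shiftSub_pow_map, hN]
  funext m l
  exact map_zero T

theorem shiftSub_pow_swap (N : ℕ) (g : ℤ → ℤ → E) :
    (shiftSub E ^ N) (fun m l => g l m) = fun m l => (-1 : ℂ) ^ N • (shiftSub E ^ N) g l m := by
  induction N generalizing g with
  | zero => simp
  | succ N ih =>
    have : shiftSub E (fun m l => g l m) = fun m l => (-(shiftSub E g)) l m := by
      funext m l
      simp [shiftSub_apply]
    rw [shiftSub_pow_succ, this, ih, shiftSub_pow_succ]
    funext m l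
    simp [pow_succ]

theorem IsLocal.swap {g : ℤ → ℤ → E} (hg : IsLocal g) : IsLocal fun m l => g l m := by
  obtain ⟨N, hN⟩ := hg
  refine ⟨N, ?_⟩
  rw [shiftSub_pow_swap, hN]
  funext m l
  simp

theorem shiftSub_pow_translate (N : ℕ) (g : ℤ → ℤ → E) (s t : ℤ) :
    (shiftSub E ^ N) (fun m l => g (s + m) (t + l)) =
      fun m l => (shiftSub E ^ N) g (s + m) (t + l) := by
  induction N generalizing g with
  | zero => rfl
  | succ N ih =>
    have : shiftSub E (fun m l => g (s + m) (t + l)) =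
        fun m l => (shiftSub E g) (s + m) (t + l) := by
      funext m l
      simp [shiftSub_apply, add_assoc]
    rw [shiftSub_pow_succ, this, ih, shiftSub_pow_succ]

theorem IsLocal.translate {g : ℤ → ℤ → E} (hg : IsLocal g) (s t : ℤ) :
    IsLocal fun m l => g (s + m) (t + l) := by
  obtain ⟨N, hN⟩ := hg
  refine ⟨N, ?_⟩
  rw [shiftSub_pow_translate, hN]
  rfl

/-- The derivative in the first variable of a local distribution is local. -/
theorem IsLocal.derivative {g : ℤ → ℤ → E} (hg : IsLocal g) :
    IsLocal fun m l => (-m : ℂ) • g (m - 1) l := by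
  obtain ⟨N, hN⟩ := hg
  refine ⟨N + 1, ?_⟩
  induction N generalizing g with
  | zero =>
    have : g = 0 := hN
    subst this
    simp only [Pi.zero_apply, smul_zero]
    exact map_zero _
  | succ N ih =>
    -- The family is `∂_z g`, and `(z - w)∂_z g = ∂_z((z - w)g) - g`. Hence one factor more than for
    -- `g` suffices.
    have h : shiftSub E (fun m l => (-m : ℂ) • g (m - 1) l) =
        (fun m l : ℤ => (-m : ℂ) • (shiftSub E g) (m - 1) l) - g := by
      funext m l
      simp only [shiftSub_apply, Pi.sub_apply, add_sub_cancel_right, sub_add_cancel]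
      push_cast
      module
    rw [shiftSub_pow_succ, h, map_sub, hN, ih (by rw [← shiftSub_pow_succ]; exact hN), sub_zero]

/-- A local distribution whose modes vanish for large second index is zero. -/
theorem eq_zero_of_isLocal {g : ℤ → ℤ → E} (hg : IsLocal g) {L : ℤ}
    (h : ∀ m, ∀ l ≥ L, g m l = 0) : g = 0 := by
  obtain ⟨N, hN⟩ := hg
  induction N generalizing g with
  | zero => exact hN
  | succ N ih =>
    have h0 : shiftSub E g = 0 := ih (fun m l hl => by
      rw [shiftSub_apply, h _ _ hl, h _ _ (by omega), sub_zero])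
      (by rw [← shiftSub_pow_succ]; exact hN)
    -- `(z - w)g = 0` says that `g` depends only on `m + l`, so its vanishing for large `l` spreads
    -- along the antidiagonals to all indices.
    have h1 : ∀ m l, g (m + 1) l = g m (l + 1) := fun m l => by
      have := congrFun (congrFun h0 m) l
      rw [shiftSub_apply] at this
      exact sub_eq_zero.1 this
    have h2 : ∀ (j : ℕ) (m l : ℤ), L ≤ l + j → g m l = 0 := by
      intro j
      induction j with
      | zero => intro m l hl; exact h m l (by simpa using hl)
      | succ j ihj =>
        intro m l hl
        have := h1 (m - 1) l
        rw [sub_add_cancel] at this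
        rw [this]
        exact ihj _ _ (by push_cast at hl; omega)
    funext m l
    exact h2 (L - l).toNat m l (by omega)

/-- The part of Dong's lemma without residues: `(z - w)ᵃ f = 0` and `(z - u)ᵇ f = 0` imply
`(w - u)ᵃ⁺ᵇ f = 0`. -/
theorem shiftSub_pow_of_pow {f : ℤ → ℤ → ℤ → E} {a b : ℕ}
    (ha : ∀ r, (shiftSub E ^ a) (fun m l => f m l r) = 0)
    (hb : ∀ l, (shiftSub E ^ b) (fun m r => f m l r) = 0) (m : ℤ) :
    (shiftSub E ^ (a + b)) (f m) = 0 := by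
  suffices H : ∀ (k a b : ℕ) (f : ℤ → ℤ → ℤ → E), a + b = k →
      (∀ r, (shiftSub E ^ a) (fun m l => f m l r) = 0) →
      (∀ l, (shiftSub E ^ b) (fun m r => f m l r) = 0) → ∀ m, (shiftSub E ^ k) (f m) = 0 from
    H (a + b) a b f rfl ha hb m
  intro k
  induction k with
  | zero =>
    intro a b f hk ha _ m
    obtain rfl : a = 0 := by omega
    funext l r
    exact congrFun (congrFun (ha r) m) l
  | succ k ih =>
    intro a b f hk ha hb m
    have hz : f = 0 → (shiftSub E ^ (k + 1)) (f m) = 0 := by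
      rintro rfl
      exact map_zero _
    rcases a with _ | a
    · exact hz (by funext m l r; exact congrFun (congrFun (ha r) m) l)
    rcases b with _ | b
    · exact hz (by funext m l r; exact congrFun (congrFun (hb l) m) r)
    -- `w - u = (z - u) - (z - w)`. Multiplying `f` by `z - u` lowers `b`, multiplying it by `z - w`
    -- lowers `a`; induction on `a + b` applies to both summands.
    have e : shiftSub E (f m) = (fun l r => f (m + 1) l r - f m l (r + 1)) -
        (fun l r => f (m + 1) l r - f m (l + 1) r) := by
      funext l r
      simp only [shiftSub_apply, Pi.sub_apply]
      abel
    have ha1 : ∀ r, (shiftSub E ^ (a + 1)) (fun m l => f (m + 1) l r - f m l (r + 1)) = 0 := by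
      intro r
      have h1 := shiftSub_pow_translate (a + 1) (fun m l => f m l r) 1 0
      rw [ha] at h1
      have h2 : (fun m l => f (m + 1) l r - f m l (r + 1)) =
          (fun m l => f (1 + m) (0 + l) r) - (fun m l => f m l (r + 1)) := by
        funext m l
        simp [add_comm]
      rw [h2, map_sub, ha]
      rw [show (fun m l => f (1 + m) (0 + l) r) = fun m l => (fun m l => f m l r) (1 + m) (0 + l)
        from rfl, h1]
      simp
      rfl
    have hb1 : ∀ l, (shiftSub E ^ (b + 1)) (fun m r => f (m + 1) l r - f m (l + 1) r) = 0 := by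
      intro l
      have h1 := shiftSub_pow_translate (b + 1) (fun m r => f m l r) 1 0
      rw [hb] at h1
      have h2 : (fun m r => f (m + 1) l r - f m (l + 1) r) =
          (fun m r => f (1 + m) l (0 + r)) - (fun m r => f m (l + 1) r) := by
        funext m l
        simp [add_comm]
      rw [h2, map_sub, hb]
      rw [show (fun m r => f (1 + m) l (0 + r)) = fun m r => (fun m r => f m l r) (1 + m) (0 + r)
        from rfl, h1]
      simp
      rfl
    rw [shiftSub_pow_succ, e, map_sub,
      ih (a + 1) b (fun m l r => f (m + 1) l r - f m l (r + 1)) (by omega) ha1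
        (fun l => (shiftSub_pow_succ b (fun m r => f m l r)).symm.trans (hb l)) m,
      ih a (b + 1) (fun m l r => f (m + 1) l r - f m (l + 1) r) (by omega)
        (fun r => (shiftSub_pow_succ a (fun m l => f m l r)).symm.trans (ha r)) hb1 m, sub_zero]

/-! ### Residues and Dong's lemma -/

/-- The coefficients of `Res_z (z - w)⁻¹`, expanded in `|z| > |w|` on the first argument and in
`|w| > |z|` on the second one. -/
def residue (φ φ' : ℤ → ℤ → E) (s : ℤ) : E :=
  -- The expansions used are `(z - w)⁻¹ = ∑ z⁻¹⁻ⁱ wⁱ` and, in the other region, `-∑ zⁱ w⁻¹⁻ⁱ`. The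
  -- second residue is subtracted, so `φ'` enters with a plus sign. A `finsum` of infinite support
  -- would be `0`; `Truncated` excludes this.
  ∑ᶠ i : ℕ, (φ (-1 - i) (s + i) + φ' i (s - 1 - i))

/-- The finiteness condition that makes `residue` meaningful. -/
def Truncated (φ φ' : ℤ → ℤ → E) : Prop :=
  (∃ L : ℤ, ∀ l ≥ L, ∀ m, φ m l = 0) ∧ ∃ M : ℤ, ∀ m ≥ M, ∀ l, φ' m l = 0

-- Finitely many such statements hold for one common `N`. Identities between residues then become
-- identities between finite sums over the same range, which can be added, mapped and telescoped.
omit [Module ℂ E] in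
open Filter in
theorem Truncated.eventually {φ φ' : ℤ → ℤ → E} (h : Truncated φ φ') (s : ℤ) :
    ∀ᶠ N : ℕ in atTop, residue φ φ' s =
      ∑ i ∈ Finset.range N, (φ (-1 - i) (s + i) + φ' i (s - 1 - i)) := by
  obtain ⟨⟨L, hL⟩, M, hM⟩ := h
  filter_upwards [eventually_ge_atTop (max (L - s).toNat M.toNat)] with N hN
  refine finsum_eq_sum_of_support_subset _ fun i hi => ?_
  rw [Finset.coe_range, Set.mem_Iio]
  by_contra hc
  refine hi ?_
  have := le_max_left (L - s).toNat M.toNat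
  have := le_max_right (L - s).toNat M.toNat
  change φ (-1 - i) (s + i) + φ' i (s - 1 - i) = 0
  rw [hL _ (by omega), hM _ (by omega), add_zero]

omit [Module ℂ E] in
theorem Truncated.sub {φ φ' ψ ψ' : ℤ → ℤ → E} (h : Truncated φ φ') (h' : Truncated ψ ψ') :
    Truncated (φ - ψ) (φ' - ψ') := by
  obtain ⟨⟨L, hL⟩, M, hM⟩ := h
  obtain ⟨⟨L', hL'⟩, M', hM'⟩ := h'
  refine ⟨⟨max L L', fun l hl m => ?_⟩, max M M', fun m hm l => ?_⟩
  · simp [hL l (le_trans (le_max_left _ _) hl), hL' l (le_trans (le_max_right _ _) hl)]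
  · simp [hM m (le_trans (le_max_left _ _) hm), hM' m (le_trans (le_max_right _ _) hm)]

omit [Module ℂ E] in
theorem Truncated.next_left {φ φ' : ℤ → ℤ → E} (h : Truncated φ φ') :
    Truncated (fun m l => φ (m + 1) l) (fun m l => φ' (m + 1) l) := by
  obtain ⟨⟨L, hL⟩, M, hM⟩ := h
  exact ⟨⟨L, fun l hl m => hL _ hl _⟩, M - 1, fun m hm l => hM _ (by omega) _⟩

omit [Module ℂ E] in
theorem Truncated.next_right {φ φ' : ℤ → ℤ → E} (h : Truncated φ φ') :
    Truncated (fun m l => φ m (l + 1)) (fun m l => φ' m (l + 1)) := by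
  obtain ⟨⟨L, hL⟩, M, hM⟩ := h
  exact ⟨⟨L - 1, fun l hl m => hL _ (by omega) _⟩, M, fun m hm l => hM _ hm _⟩

omit [Module ℂ E] in
open Filter in
theorem residue_sub {φ φ' ψ ψ' : ℤ → ℤ → E} (h : Truncated φ φ') (h' : Truncated ψ ψ') (s : ℤ) :
    residue (φ - ψ) (φ' - ψ') s = residue φ φ' s - residue ψ ψ' s := by
  obtain ⟨N, h1, h2, h3⟩ :=
    ((h.eventually s).and ((h'.eventually s).and ((h.sub h').eventually s))).exists
  rw [h1, h2, h3, ← Finset.sum_sub_distrib]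
  refine Finset.sum_congr rfl fun i _ => ?_
  simp only [Pi.sub_apply]
  abel

omit [Module ℂ E] in
theorem residue_translate (φ φ' : ℤ → ℤ → E) (s t : ℤ) :
    residue (fun m l => φ m (l + t)) (fun m l => φ' m (l + t)) s = residue φ φ' (s + t) := by
  refine finsum_congr fun i => ?_
  beta_reduce
  rw [show s + (i : ℤ) + t = s + t + i by ring, show s - 1 - (i : ℤ) + t = s + t - 1 - i by ring]

-- The factor `z - w` cancels the kernel `(z - w)⁻¹` in both expansions, and `Res_z(φ - φ')`
-- remains. In modes the sum telescopes, and truncation removes the upper end.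
open Filter in
theorem residue_shiftSub {φ φ' : ℤ → ℤ → E} (h : Truncated φ φ') (s : ℤ) :
    residue (shiftSub E φ) (shiftSub E φ') s = φ 0 s - φ' 0 s := by
  have h' : Truncated (shiftSub E φ) (shiftSub E φ') := h.next_left.sub h.next_right
  have hN := h'.eventually s
  obtain ⟨⟨L, hL⟩, M, hM⟩ := h
  obtain ⟨N, h1, h2⟩ := (hN.and (eventually_ge_atTop (max (L - s).toNat M.toNat))).exists
  have h3 := le_max_left (L - s).toNat M.toNat
  have h4 := le_max_right (L - s).toNat M.toNat
  have e1 := Finset.sum_range_sub (fun i : ℕ => φ' i (s - i) - φ (-i) (s + i)) N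
  rw [h1]
  refine Eq.trans (Finset.sum_congr rfl fun i _ => ?_) (e1.trans ?_)
  · simp only [shiftSub_apply]
    push_cast
    rw [show -1 - (i : ℤ) + 1 = -i by ring, show s - 1 - (i : ℤ) + 1 = s - i by ring,
      show -((i : ℤ) + 1) = -1 - i by ring, show s - ((i : ℤ) + 1) = s - 1 - i by ring,
      ← add_assoc s]
    abel
  · rw [hL _ (by omega), hM _ (by omega)]
    simp

theorem Truncated.shiftSub_pow {φ φ' : ℤ → ℤ → ℤ → E}
    (h : ∀ r, Truncated (fun m l => φ m l r) (fun m l => φ' m l r)) (n : ℕ) (r : ℤ) :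
    Truncated (fun m l => (shiftSub E ^ n) (φ m) l r)
      (fun m l => (shiftSub E ^ n) (φ' m) l r) := by
  induction n generalizing r with
  | zero => exact h r
  | succ n ih =>
    simp only [shiftSub_pow_succ']
    exact (ih r).next_right.sub (ih (r + 1))

/-- Multiplication by `w - u` does not involve `z`, so it passes under `Res_z` and through the
kernel. -/
theorem residue_shiftSub_pow {φ φ' : ℤ → ℤ → ℤ → E}
    (h : ∀ r, Truncated (fun m l => φ m l r) (fun m l => φ' m l r)) (n : ℕ) :
    (shiftSub E ^ n) (fun l r => residue (fun m l => φ m l r) (fun m l => φ' m l r) l) =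
      fun l r => residue (fun m l => (shiftSub E ^ n) (φ m) l r)
        (fun m l => (shiftSub E ^ n) (φ' m) l r) l := by
  induction n with
  | zero => rfl
  | succ n ih =>
    funext l r
    have h1 := Truncated.shiftSub_pow h n
    rw [shiftSub_pow_succ', ih, shiftSub_apply, ← residue_translate,
      ← residue_sub (h1 r).next_right (h1 (r + 1))]
    simp only [shiftSub_pow_succ']
    rfl

/-- The residue core of Dong's lemma, by induction on `b`. Since `w - u = (z - u) - (z - w)`, one
factor `w - u` gives the residue of `(z - u)φ`, for which `b` has dropped, minus `Res_z(φ - φ')`.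
The latter is killed by `(w - u)ᵃ⁺ᵇ` by `shiftSub_pow_of_pow`. Each round costs two factors, hence
the exponent `a + 2b`. -/
theorem shiftSub_pow_residue {φ φ' : ℤ → ℤ → ℤ → E} {a b : ℕ}
    (h : ∀ r, Truncated (fun m l => φ m l r) (fun m l => φ' m l r))
    (ha : ∀ r, (shiftSub E ^ a) (fun m l => φ m l r - φ' m l r) = 0)
    (hb : ∀ l, (shiftSub E ^ b) (fun m r => φ m l r) = 0)
    (hb' : ∀ l, (shiftSub E ^ b) (fun m r => φ' m l r) = 0) :
    (shiftSub E ^ (a + 2 * b))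
      (fun l r => residue (fun m l => φ m l r) (fun m l => φ' m l r) l) = 0 := by
  induction b generalizing φ φ' with
  | zero =>
    have e : ∀ φ : ℤ → ℤ → ℤ → E, (∀ l, (shiftSub E ^ 0) (fun m r => φ m l r) = 0) →
        ∀ m l r, φ m l r = 0 := fun φ hφ m l r => congrFun (congrFun (hφ l) m) r
    have e' : (fun l r => residue (fun m l => φ m l r) (fun m l => φ' m l r) l) = 0 := by
      funext l r
      simp only [residue, e φ hb, e φ' hb', add_zero, finsum_zero]
      rfl
    rw [e', map_zero]
  | succ b ih =>
    have tr : ∀ r, Truncated (fun m l => φ (m + 1) l r - φ m l (r + 1))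
        (fun m l => φ' (m + 1) l r - φ' m l (r + 1)) := fun r =>
      (h r).next_left.sub (h (r + 1))
    have e : shiftSub E (fun l r => residue (fun m l => φ m l r) (fun m l => φ' m l r) l) =
        (fun l r => residue (fun m l => φ (m + 1) l r - φ m l (r + 1))
          (fun m l => φ' (m + 1) l r - φ' m l (r + 1)) l) -
        (fun m l r => φ m l r - φ' m l r : ℤ → ℤ → ℤ → E) 0 := by
      funext l r
      have tr' : Truncated (shiftSub E fun m l => φ m l r) (shiftSub E fun m l => φ' m l r) :=
        (h r).next_left.sub (h r).next_right
      rw [shiftSub_apply, ← residue_translate, ← residue_sub (h r).next_right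
        (h (r + 1))]
      simp only [Pi.sub_apply]
      rw [← residue_shiftSub (h r), ← residue_sub (tr r) tr']
      congr 1
      · funext m l
        simp [shiftSub_apply]
      · funext m l
        simp [shiftSub_apply]
    have hsub : ∀ l, (shiftSub E ^ (b + 1)) (fun m r => φ m l r - φ' m l r) = 0 := fun l => by
      have := map_sub (shiftSub E ^ (b + 1)) (fun m r => φ m l r) (fun m r => φ' m l r)
      rw [hb, hb', sub_zero] at this
      exact this
    have h1 : (shiftSub E ^ (a + 2 * b)) (fun l r => residue
        (fun m l => φ (m + 1) l r - φ m l (r + 1))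
        (fun m l => φ' (m + 1) l r - φ' m l (r + 1)) l) = 0 := by
      refine ih tr (fun r => ?_) (fun l => ?_) (fun l => ?_)
      · have h2 := shiftSub_pow_translate a (fun m l => φ m l r - φ' m l r) 1 0
        rw [ha] at h2
        have h3 := map_sub (shiftSub E ^ a) (fun m l => φ (1 + m) (0 + l) r -
          φ' (1 + m) (0 + l) r) (fun m l => φ m l (r + 1) - φ' m l (r + 1))
        rw [ha, h2, sub_zero] at h3
        refine Eq.trans ?_ h3
        congr 1
        funext m l
        simp only [Pi.sub_apply, add_comm (1 : ℤ), zero_add]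
        abel
      · exact (shiftSub_pow_succ b _).symm.trans (hb l)
      · exact (shiftSub_pow_succ b _).symm.trans (hb' l)
    rw [show a + 2 * (b + 1) = a + 2 * b + 1 + 1 by ring, shiftSub_pow_succ, e, map_sub,
      shiftSub_pow_eq_zero_of_le (Nat.le_succ _) h1,
      shiftSub_pow_eq_zero_of_le (by omega) (shiftSub_pow_of_pow ha hsub 0), sub_zero]

end Shift

/-! ### Fields, normally ordered products and Dong's lemma -/

section Fields

variable {V : Type*} [AddCommGroup V] [Module ℂ V]

/-- A family of modes which is a field. -/
def IsField (A : ℤ → Module.End ℂ V) : Prop := ∀ v, ∃ N : ℤ, ∀ m ≥ N, A m v = 0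

/-- The commutator, twisted by a sign, of two fields. -/
def signedBracket (ε : ℂ) (A B : ℤ → Module.End ℂ V) (m l : ℤ) : Module.End ℂ V :=
  A m * B l - ε • (B l * A m)

theorem truncated_of_isField {A B : ℤ → Module.End ℂ V} (hA : IsField A) (hB : IsField B) (ε : ℂ)
    (v : V) : Truncated (fun m l => A m (B l v)) (fun m l => ε • B l (A m v)) := by
  obtain ⟨M, hM⟩ := hA v
  obtain ⟨L, hL⟩ := hB v
  exact ⟨⟨L, fun l hl m => by simp [hL l hl]⟩,
    M, fun m hm l => by simp [hM m hm]⟩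

open Filter in
open Classical in
/-- The normally ordered product of two fields. -/
def normalOrder (ε : ℂ) (A B : ℤ → Module.End ℂ V) (s : ℤ) : Module.End ℂ V :=
  if h : IsField A ∧ IsField B then
    { toFun := fun v => residue (fun m l => A m (B l v)) (fun m l => ε • B l (A m v)) s
      map_add' := fun v w => by
        obtain ⟨N, h1, h2, h3⟩ := (((truncated_of_isField h.1 h.2 ε v).eventually s).and
          (((truncated_of_isField h.1 h.2 ε w).eventually s).and
          ((truncated_of_isField h.1 h.2 ε (v + w)).eventually s))).exists
        rw [h1, h2, h3, ← Finset.sum_add_distrib]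
        refine Finset.sum_congr rfl fun i _ => ?_
        simp only [map_add, smul_add]
        abel
      map_smul' := fun c v => by
        obtain ⟨N, h1, h2⟩ := (((truncated_of_isField h.1 h.2 ε v).eventually s).and
          ((truncated_of_isField h.1 h.2 ε (c • v)).eventually s)).exists
        rw [h1, h2, RingHom.id_apply, Finset.smul_sum]
        refine Finset.sum_congr rfl fun i _ => ?_
        simp only [map_smul, smul_add, smul_comm c] }
  else 0

theorem normalOrder_apply {A B : ℤ → Module.End ℂ V} (hA : IsField A) (hB : IsField B) (ε : ℂ)
    (s : ℤ) (v : V) : normalOrder ε A B s v =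
      residue (fun m l => A m (B l v)) (fun m l => ε • B l (A m v)) s := by
  rw [normalOrder, dif_pos ⟨hA, hB⟩]
  rfl

open Filter in
theorem normalOrder_eventually {A B : ℤ → Module.End ℂ V} (hA : IsField A) (hB : IsField B) (ε : ℂ)
    (s : ℤ) (v : V) : ∀ᶠ N : ℕ in atTop, normalOrder ε A B s v =
      ∑ i ∈ Finset.range N, (A (-1 - i) (B (s + i) v) + ε • B (s - 1 - i) (A i v)) := by
  rw [normalOrder_apply hA hB]
  exact (truncated_of_isField hA hB ε v).eventually s

/-- Dong's lemma for the normally ordered product. -/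
theorem isLocal_normalOrder {A B C : ℤ → Module.End ℂ V} (hA : IsField A) (hB : IsField B)
    {ε ε₁ ε₂ : ℂ} (hAB : IsLocal (signedBracket ε A B)) (hAC : IsLocal (signedBracket ε₁ A C))
    (hBC : IsLocal (signedBracket ε₂ B C)) :
    IsLocal (signedBracket (ε₁ * ε₂) (normalOrder ε A B) C) := by
  obtain ⟨a, ha⟩ := hAB
  obtain ⟨b, hb⟩ := hAC
  obtain ⟨c, hc⟩ := hBC
  have hlin : ∀ {g : ℤ → ℤ → Module.End ℂ V} {N : ℕ}, (shiftSub _ ^ N) g = 0 →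
      ∀ T : Module.End ℂ V →ₗ[ℂ] V, (shiftSub V ^ N) (fun m l => T (g m l)) = 0 := by
    intro g N hg T
    rw [shiftSub_pow_map, hg]
    funext m l
    exact map_zero T
  refine ⟨c + (a + 2 * b), ?_⟩
  suffices H : ∀ v : V, (shiftSub V ^ (c + (a + 2 * b)))
      (fun l r => signedBracket (ε₁ * ε₂) (normalOrder ε A B) C l r v) = 0 by
    funext l r
    ext v
    have h := H v
    rw [show (fun l r => signedBracket (ε₁ * ε₂) (normalOrder ε A B) C l r v) = fun l r =>
      (LinearMap.applyₗ v : Module.End ℂ V →ₗ[ℂ] V)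
        (signedBracket (ε₁ * ε₂) (normalOrder ε A B) C l r) from rfl, shiftSub_pow_map] at h
    exact congrFun (congrFun h l) r
  intro v
  -- `φ` and `φ'` are the commutators of `C(u)` with `A(z)B(w)` and with `εB(w)A(z)`, applied to
  -- `v`. The commutator of `C` with the normally ordered product is therefore their residue
  -- (`hres`).
  let φ : ℤ → ℤ → ℤ → V := fun m l r =>
    A m (B l (C r v)) - (ε₁ * ε₂) • C r (A m (B l v))
  let φ' : ℤ → ℤ → ℤ → V := fun m l r =>
    ε • B l (A m (C r v)) - (ε₁ * ε₂) • C r (ε • B l (A m v))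
  have tr : ∀ r, Truncated (fun m l => φ m l r) (fun m l => φ' m l r) := by
    intro r
    obtain ⟨M, hM⟩ := hA v
    obtain ⟨M', hM'⟩ := hA (C r v)
    obtain ⟨L, hL⟩ := hB v
    obtain ⟨L', hL'⟩ := hB (C r v)
    refine ⟨⟨max L L', fun l hl m => ?_⟩, max M M', fun m hm l => ?_⟩
    · simp [φ, hL l (le_trans (le_max_left _ _) hl), hL' l (le_trans (le_max_right _ _) hl)]
    · simp [φ', hM m (le_trans (le_max_left _ _) hm), hM' m (le_trans (le_max_right _ _) hm)]
  have hres : (fun l r => signedBracket (ε₁ * ε₂) (normalOrder ε A B) C l r v) =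
      fun l r => residue (fun m l => φ m l r) (fun m l => φ' m l r) l := by
    funext l r
    obtain ⟨N, h1, h2, h3⟩ := ((normalOrder_eventually hA hB ε l v).and
      ((normalOrder_eventually hA hB ε l (C r v)).and ((tr r).eventually l))).exists
    rw [h3]
    simp only [signedBracket, LinearMap.sub_apply, LinearMap.smul_apply, Module.End.mul_apply]
    rw [h1, h2, map_sum, Finset.smul_sum, ← Finset.sum_sub_distrib]
    refine Finset.sum_congr rfl fun i _ => ?_
    simp only [φ, φ', map_add, smul_add]
    abel
  have hφ : ∀ m l r, φ m l r = A m (signedBracket ε₂ B C l r v) +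
      ε₂ • signedBracket ε₁ A C m r (B l v) := by
    intro m l r
    simp only [φ, signedBracket, LinearMap.sub_apply, LinearMap.smul_apply, Module.End.mul_apply,
      map_sub, map_smul]
    module
  have hφ' : ∀ m l r, φ' m l r = ε • B l (signedBracket ε₁ A C m r v) +
      (ε * ε₁) • signedBracket ε₂ B C l r (A m v) := by
    intro m l r
    simp only [φ', signedBracket, LinearMap.sub_apply, LinearMap.smul_apply, Module.End.mul_apply,
      map_sub, map_smul]
    module
  have hd : ∀ m l r, φ m l r - φ' m l r = signedBracket ε A B m l (C r v) -
      (ε₁ * ε₂) • C r (signedBracket ε A B m l v) := by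
    intro m l r
    simp only [φ, φ', signedBracket, LinearMap.sub_apply, LinearMap.smul_apply,
      Module.End.mul_apply, map_sub, map_smul]
    module
  -- The factor `(w - u)ᶜ` removes the summand with `[B, C]`. What is left contains `[A, C]`, which
  -- a power of `z - u` kills.
  have hψ : ∀ m l r, (shiftSub V ^ c) (φ m) l r =
      (shiftSub V ^ c) (fun l r => ε₂ • signedBracket ε₁ A C m r (B l v)) l r := by
    intro m l r
    have h1 : φ m = (fun l r => (A m ∘ₗ LinearMap.applyₗ v) (signedBracket ε₂ B C l r)) +
        (fun l r => ε₂ • signedBracket ε₁ A C m r (B l v)) := by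
      funext l r
      exact hφ m l r
    rw [h1, map_add, hlin hc, zero_add]
  have hψ' : ∀ m l r, (shiftSub V ^ c) (φ' m) l r =
      (shiftSub V ^ c) (fun l r => ε • B l (signedBracket ε₁ A C m r v)) l r := by
    intro m l r
    have h1 : φ' m = (fun l r => ε • B l (signedBracket ε₁ A C m r v)) +
        (fun l r => ((ε * ε₁) • LinearMap.applyₗ (A m v) : Module.End ℂ V →ₗ[ℂ] V)
          (signedBracket ε₂ B C l r)) := by
      funext l r
      exact hφ' m l r
    rw [h1, map_add, hlin hc, add_zero]
  -- `(w - u)ᶜ` is a linear combination of index translations, so it preserves annihilation by a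
  -- power of `z - u`.
  have hsum : ∀ {f : ℤ → ℤ → ℤ → V} {N : ℕ} (l : ℤ), (∀ l, (shiftSub V ^ N) (f l) = 0) →
      (shiftSub V ^ N) (fun m r => (shiftSub V ^ c) (fun l r => f l m r) l r) = 0 := by
    intro f N l hf
    have e : (fun m r => (shiftSub V ^ c) (fun l r => f l m r) l r) =
        ∑ i ∈ Finset.range (c + 1), ((-1 : ℂ) ^ i * (c.choose i : ℂ)) •
          (fun m r => f (l + c - i) (0 + m) (i + r)) := by
      funext m r
      rw [shiftSub_pow_apply]
      simp [Finset.sum_apply, add_comm]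
    rw [e, map_sum]
    refine Finset.sum_eq_zero fun i _ => ?_
    rw [map_smul, shiftSub_pow_translate, hf]
    exact smul_zero _
  rw [hres, add_comm, pow_add, Module.End.mul_apply, residue_shiftSub_pow tr]
  refine shiftSub_pow_residue (Truncated.shiftSub_pow tr c) (fun r => ?_) (fun l => ?_)
    (fun l => ?_)
  · have e : (fun m l => (shiftSub V ^ c) (φ m) l r - (shiftSub V ^ c) (φ' m) l r) =
        ∑ i ∈ Finset.range (c + 1), ((-1 : ℂ) ^ i * (c.choose i : ℂ)) •
          (fun m l => (φ (0 + m) ((c - i) + l) (r + i) - φ' (0 + m) ((c - i) + l) (r + i))) := by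
      funext m l
      rw [shiftSub_pow_apply, shiftSub_pow_apply, ← Finset.sum_sub_distrib]
      simp only [Finset.sum_apply, Pi.smul_apply, ← smul_sub, zero_add]
      refine Finset.sum_congr rfl fun i _ => ?_
      rw [show (c : ℤ) - i + l = l + c - i by ring]
    rw [e, map_sum]
    refine Finset.sum_eq_zero fun i _ => ?_
    rw [map_smul, shiftSub_pow_translate a (fun m l => φ m l (r + i) - φ' m l (r + i)) 0 (c - i)]
    have h1 : (fun m l => φ m l (r + i) - φ' m l (r + i)) = fun m l =>
        (LinearMap.applyₗ (C (r + i) v) - (ε₁ * ε₂) • (C (r + i) ∘ₗ LinearMap.applyₗ v) :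
          Module.End ℂ V →ₗ[ℂ] V) (signedBracket ε A B m l) := by
      funext m l
      exact hd m l (r + i)
    rw [h1, hlin ha]
    exact smul_zero _
  · simp only [hψ]
    exact hsum (f := fun l m r => ε₂ • signedBracket ε₁ A C m r (B l v)) l fun l =>
      hlin hb (ε₂ • LinearMap.applyₗ (B l v))
  · simp only [hψ']
    exact hsum (f := fun l m r => ε • B l (signedBracket ε₁ A C m r v)) l fun l =>
      hlin hb (ε • (B l ∘ₗ LinearMap.applyₗ v))

end Fields

end

end RectW
namespace RectW

noncomputable section

/-! ### Currents of the universal affine vertex superalgebra -/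

section Currents

universe u v w

variable {L : Type u} {M : Type v} [LieRing L] [LieAlgebra ℂ L]
  [AddCommGroup M] [Module ℂ M] [LieRingModule L M]

namespace UniversalAffine

variable {κ : LinearMap.BilinForm ℂ L}

theorem toVac_surjective : Function.Surjective (toVac (M := M) κ) :=
  Submodule.Quotient.mk_surjective _

theorem mk_surjective : Function.Surjective (ModeAlgebra.mk (M := M) κ) :=
  RingQuot.mkAlgHom_surjective ℂ (ModeRel M κ)

theorem even_toVac (x : L) (m : ℤ) (a : ModeAlgebra M κ) :
    even x m (toVac κ a) = toVac κ (ModeAlgebra.gen κ (.even x m) * a) := rfl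

theorem odd_toVac (y : M) (m : ℤ) (a : ModeAlgebra M κ) :
    odd y m (toVac κ a) = toVac κ (ModeAlgebra.gen κ (.odd y m) * a) := rfl

theorem translation_toVac (a : ModeAlgebra M κ) :
    translation (toVac κ a) = toVac κ (ModeAlgebra.translation κ a) := rfl

theorem parity_toVac (a : ModeAlgebra M κ) :
    parity (toVac κ a) = toVac κ (ModeAlgebra.parity κ a) := rfl

theorem map_toVac {M' : Type w} [AddCommGroup M'] [Module ℂ M'] [LieRingModule L M']
    (φ : M →ₗ⁅ℂ, L⁆ M') (a : ModeAlgebra M κ) :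
    map φ (toVac κ a) = toVac κ (ModeAlgebra.map κ φ a) := rfl

theorem even_add (x y : L) (m : ℤ) :
    even (M := M) (κ := κ) (x + y) m = even x m + even y m := by
  simp only [even, ModeAlgebra.even_add, map_add]

theorem even_smul (c : ℂ) (x : L) (m : ℤ) :
    even (M := M) (κ := κ) (c • x) m = c • even x m := by
  simp only [even, ModeAlgebra.even_smul, map_smul]

theorem odd_add (x y : M) (m : ℤ) :
    odd (L := L) (κ := κ) (x + y) m = odd x m + odd y m := by
  simp only [odd, ModeAlgebra.odd_add, map_add]

theorem odd_smul (c : ℂ) (x : M) (m : ℤ) :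
    odd (L := L) (κ := κ) (c • x) m = c • odd x m := by
  simp only [odd, ModeAlgebra.odd_smul, map_smul]

variable (M κ) in
/-- `x ↦ x tᵐ` as a linear map. -/
def evenHom (m : ℤ) : L →ₗ[ℂ] Module.End ℂ (UniversalAffine M κ) where
  toFun x := even x m
  map_add' x y := even_add x y m
  map_smul' c x := even_smul c x m

variable (M κ) in
/-- `y ↦ y tᵐ` as a linear map. -/
def oddHom (m : ℤ) : M →ₗ[ℂ] Module.End ℂ (UniversalAffine M κ) where
  toFun y := odd y m
  map_add' x y := odd_add x y m
  map_smul' c x := odd_smul c x m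

theorem even_even (x y : L) (m l : ℤ) :
    even (M := M) (κ := κ) x m * even y l - even y l * even x m =
      even ⁅x, y⁆ (m + l) + (if m + l = 0 then (m : ℂ) * κ x y else 0) • 1 := by
  simp only [even, ← map_mul, ← map_sub, ModeAlgebra.even_even]
  rw [map_add, AlgHom.commutes, Algebra.algebraMap_eq_smul_one]

theorem even_odd (x : L) (y : M) (m l : ℤ) :
    even (κ := κ) x m * odd y l - odd y l * even x m = odd ⁅x, y⁆ (m + l) := by
  simp only [even, odd, ← map_mul, ← map_sub, ModeAlgebra.even_odd]

theorem odd_odd (x y : M) (m l : ℤ) :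
    odd (κ := κ) (L := L) x m * odd y l + odd y l * odd x m = 0 := by
  simp only [odd, ← map_mul, ← map_add, ModeAlgebra.odd_odd, map_zero]

/-- The modes of a current. -/
def current : L ⊕ M → ℤ → Module.End ℂ (UniversalAffine M κ)
  | .inl x, m => even x m
  | .inr y, m => odd y m

/-- The parity of a current. -/
def currentParity : L ⊕ M → ℕ
  | .inl _ => 0
  | .inr _ => 1

/-- All four parity cases have one shape, a current in `m + l` plus a central term. Later arguments
use only this shape and need not separate even from odd currents. -/
theorem current_bracket (a b : L ⊕ M) : ∃ (c : L ⊕ M) (k : ℂ), ∀ m l : ℤ,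
    signedBracket ((-1) ^ (currentParity a * currentParity b)) (current (κ := κ) a) (current b) m l =
      current c (m + l) + (if m + l = 0 then (m : ℂ) * k else 0) • 1 := by
  rcases a with x | x <;> rcases b with y | y
  · exact ⟨.inl ⁅x, y⁆, κ x y, fun m l => by
      simpa [signedBracket, current, currentParity] using even_even x y m l⟩
  · exact ⟨.inr ⁅x, y⁆, 0, fun m l => by
      simpa [signedBracket, current, currentParity] using even_odd x y m l⟩
  · refine ⟨.inr (-⁅y, x⁆), 0, fun m l => ?_⟩
    have h := even_odd (κ := κ) y x l m
    have h' : odd (κ := κ) (-⁅y, x⁆) (m + l) = - odd ⁅y, x⁆ (m + l) :=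
      map_neg (oddHom M κ (m + l)) _
    simp only [signedBracket, current, currentParity, h']
    rw [add_comm m l, ← h]
    simp
  · refine ⟨.inr 0, 0, fun m l => ?_⟩
    have h' : odd (L := L) (κ := κ) (0 : M) (m + l) = 0 := map_zero (oddHom M κ (m + l))
    simpa [signedBracket, current, currentParity, h'] using odd_odd x y m l

theorem toVac_eq_smul (a : ModeAlgebra M κ) : toVac κ a = a • vac M κ :=
  congrArg (toVac κ) (mul_one a).symm

theorem current_vac (a : L ⊕ M) {m : ℤ} (hm : 0 ≤ m) : current a m (vac M κ) = 0 := by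
  rcases a with x | x
  · rw [current, vac, even_toVac, mul_one]
    exact toVac_eq_zero (ModeAlgebra.gen_mem hm)
  · rw [current, vac, odd_toVac, mul_one]
    exact toVac_eq_zero (ModeAlgebra.gen_mem hm)

/-- The vacuum is cyclic. -/
theorem submodule_eq_top {P : Submodule ℂ (UniversalAffine M κ)} (hv : vac M κ ∈ P)
    (hP : ∀ a m, ∀ v ∈ P, current a m v ∈ P) : P = ⊤ := by
  have key : ∀ (f : FreeAlgebra ℂ (ModeGen L M)), ∀ v ∈ P, ModeAlgebra.mk κ f • v ∈ P := by
    intro f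
    induction f using FreeAlgebra.induction with
    | grade0 c =>
      intro v hv
      rw [AlgHom.commutes, algebraMap_smul]
      exact P.smul_mem c hv
    | grade1 g =>
      intro v hv
      rcases g with ⟨x, m⟩ | ⟨x, m⟩
      · exact hP (.inl x) m v hv
      · exact hP (.inr x) m v hv
    | mul f g hf hg =>
      intro v hv
      rw [map_mul, mul_smul]
      exact hf _ (hg v hv)
    | add f g hf hg =>
      intro v hv
      rw [map_add, add_smul]
      exact P.add_mem (hf v hv) (hg v hv)
  refine eq_top_iff.2 fun v _ => ?_
  obtain ⟨a, rfl⟩ := toVac_surjective v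
  obtain ⟨f, rfl⟩ := mk_surjective a
  rw [toVac_eq_smul]
  exact key f _ hv

theorem current_isField (a : L ⊕ M) : IsField (current (κ := κ) a) := by
  -- Truncation is required for all currents at once, because commuting `a` past `b` produces a
  -- third current.
  let P : Submodule ℂ (UniversalAffine M κ) :=
    { carrier := {v | ∀ a : L ⊕ M, ∃ N : ℤ, ∀ m ≥ N, current a m v = 0}
      zero_mem' := fun a => ⟨0, fun m _ => map_zero _⟩
      add_mem' := fun {v w} hv hw a => by
        obtain ⟨N, hN⟩ := hv a
        obtain ⟨K, hK⟩ := hw a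
        exact ⟨max N K, fun m hm => by
          rw [map_add, hN m (le_trans (le_max_left _ _) hm),
            hK m (le_trans (le_max_right _ _) hm), add_zero]⟩
      smul_mem' := fun c v hv a => by
        obtain ⟨N, hN⟩ := hv a
        exact ⟨N, fun m hm => by rw [map_smul, hN m hm, smul_zero]⟩ }
  have hP : P = ⊤ := by
    refine submodule_eq_top (fun a => ⟨0, fun m hm => current_vac a hm⟩) fun b l v hv a => ?_
    obtain ⟨c, k, h⟩ := current_bracket (κ := κ) a b
    obtain ⟨N, hN⟩ := hv a
    obtain ⟨K, hK⟩ := hv c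
    refine ⟨max (max N (K - l)) (1 - l), fun m hm => ?_⟩
    have h1 : N ≤ m := le_trans (le_trans (le_max_left _ _) (le_max_left _ _)) hm
    have h2 : K - l ≤ m := le_trans (le_trans (le_max_right _ _) (le_max_left _ _)) hm
    have h3 : 1 - l ≤ m := le_trans (le_max_right _ _) hm
    have e := DFunLike.congr_fun (h m l) v
    simp only [signedBracket, LinearMap.sub_apply, LinearMap.smul_apply, Module.End.mul_apply,
      LinearMap.add_apply, hN m h1, map_zero, smul_zero, sub_zero, hK (m + l) (by omega), zero_add,
      if_neg (show m + l ≠ 0 by omega), zero_smul] at e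
    exact e
  intro v
  have hv : v ∈ P := hP ▸ Submodule.mem_top
  exact hv a

theorem translation_vac : translation (vac M κ) = 0 := by
  have h : ModeAlgebra.translation (M := M) κ 1 = 0 := by
    rw [ModeAlgebra.translation_apply, map_one, TrivSqZeroExt.snd_one]
  rw [vac, translation_toVac, h, map_zero]

theorem parity_vac : parity (vac M κ) = vac M κ := by
  rw [vac, parity_toVac, map_one]

theorem map_vac {M' : Type w} [AddCommGroup M'] [Module ℂ M'] [LieRingModule L M']
    (φ : M →ₗ⁅ℂ, L⁆ M') : map φ (vac M κ) = vac M' κ := by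
  rw [vac, map_toVac, map_one, vac]

theorem translation_current (a : L ⊕ M) (m : ℤ) (v : UniversalAffine M κ) :
    translation (current a m v) =
      current a m (translation v) + (-m : ℂ) • current a (m - 1) v := by
  obtain ⟨b, rfl⟩ := toVac_surjective v
  rcases a with x | x
  · simp only [current, even_toVac, translation_toVac, ModeAlgebra.translation_mul,
      ModeAlgebra.translation_gen, map_add, smul_mul_assoc, map_smul, add_comm]
  · simp only [current, odd_toVac, translation_toVac, ModeAlgebra.translation_mul,
      ModeAlgebra.translation_gen, map_add, smul_mul_assoc, map_smul, add_comm]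

theorem parity_current (a : L ⊕ M) (m : ℤ) (v : UniversalAffine M κ) :
    parity (current a m v) = (-1 : ℂ) ^ currentParity a • current a m (parity v) := by
  obtain ⟨b, rfl⟩ := toVac_surjective v
  rcases a with x | x
  · simp [current, currentParity, even_toVac, parity_toVac, ModeAlgebra.parity_gen]
  · simp [current, currentParity, odd_toVac, parity_toVac, ModeAlgebra.parity_gen]

theorem parity_parity (v : UniversalAffine M κ) : parity (parity v) = v := by
  have h : LinearMap.eqLocus (parity * parity : Module.End ℂ (UniversalAffine M κ)) 1 = ⊤ := by
    refine submodule_eq_top ?_ fun a m v hv => ?_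
    · simp [LinearMap.mem_eqLocus, parity_vac]
    · simp only [LinearMap.mem_eqLocus, Module.End.mul_apply, Module.End.one_apply] at hv ⊢
      rw [parity_current, map_smul, parity_current, hv, smul_smul, ← mul_pow]
      simp
  exact LinearMap.mem_eqLocus.1 (h ▸ Submodule.mem_top)

/-- The vertex superalgebra is generated by the vacuum under `∂` and the operators `a₍₋₁₎` for the
currents `a`. -/
theorem submodule_eq_top_of_translation {P : Submodule ℂ (UniversalAffine M κ)} (hv : vac M κ ∈ P)
    (ht : ∀ v ∈ P, translation v ∈ P) (hP : ∀ a, ∀ v ∈ P, current a (-1) v ∈ P) : P = ⊤ := by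
  -- `[∂, a t⁻ˢ⁻¹] = (s + 1) a t⁻ˢ⁻²`, so stability under `∂` and `a t⁻¹` gives stability under
  -- every negative mode.
  have hneg : ∀ (s : ℕ) (a : L ⊕ M), ∀ v ∈ P, current a (-(s : ℤ) - 1) v ∈ P := by
    intro s a
    induction s with
    | zero => simpa using hP a
    | succ s ih =>
      intro v hv
      have h := translation_current a (-(s : ℤ) - 1) v
      have hs : (s : ℂ) + 1 ≠ 0 := Nat.cast_add_one_ne_zero s
      have e : current a (-((s + 1 : ℕ) : ℤ) - 1) v = ((s : ℂ) + 1)⁻¹ •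
          (translation (current a (-(s : ℤ) - 1) v) - current a (-(s : ℤ) - 1) (translation v)) := by
        rw [h, add_sub_cancel_left, smul_smul]
        push_cast
        rw [show -((s : ℤ) + 1) - 1 = -(s : ℤ) - 1 - 1 by ring,
          show -(-(s : ℂ) - 1) = s + 1 by ring, inv_mul_cancel₀ hs, one_smul]
      rw [e]
      exact P.smul_mem _ (P.sub_mem (ht _ (ih v hv)) (ih _ (ht v hv)))
  let S : Submodule ℂ (UniversalAffine M κ) := sInf {W | vac M κ ∈ W ∧
    ∀ (a : L ⊕ M) (m : ℤ), m < 0 → ∀ w ∈ W, current a m w ∈ W}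
  have hSP : S ≤ P := sInf_le ⟨hv, fun a m hm w hw => by
    have := hneg (-m - 1).toNat a w hw
    rwa [show -((-m - 1).toNat : ℤ) - 1 = m by omega] at this⟩
  have hS0 : vac M κ ∈ S := Submodule.mem_sInf.2 fun W hW => hW.1
  have hSneg : ∀ (a : L ⊕ M) (m : ℤ), m < 0 → ∀ w ∈ S, current a m w ∈ S :=
    fun a m hm w hw => Submodule.mem_sInf.2 fun W hW =>
      hW.2 a m hm w (Submodule.mem_sInf.1 hw W hW)
  -- `S` is generated by negative modes only. That the other modes preserve it is shown by commuting
  -- them to the right until they reach the vacuum; `T` is the subspace on which this works.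
  let T : Submodule ℂ (UniversalAffine M κ) :=
    { carrier := {w | w ∈ S ∧ ∀ (a : L ⊕ M) (m : ℤ), current a m w ∈ S}
      zero_mem' := ⟨S.zero_mem, fun a m => by rw [map_zero]; exact S.zero_mem⟩
      add_mem' := fun {v w} hv hw => ⟨S.add_mem hv.1 hw.1, fun a m => by
        rw [map_add]; exact S.add_mem (hv.2 a m) (hw.2 a m)⟩
      smul_mem' := fun c v hv => ⟨S.smul_mem c hv.1, fun a m => by
        rw [map_smul]; exact S.smul_mem c (hv.2 a m)⟩ }
  have hST : S ≤ T := sInf_le ⟨⟨hS0, fun a m => by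
      rcases lt_or_ge m 0 with h | h
      · exact hSneg a m h _ hS0
      · rw [current_vac a h]; exact S.zero_mem⟩, fun b l hl w hw => ⟨hSneg b l hl w hw.1,
      fun a m => by
        obtain ⟨c, k, h⟩ := current_bracket (κ := κ) a b
        have e := DFunLike.congr_fun (h m l) w
        simp only [signedBracket, LinearMap.sub_apply, LinearMap.smul_apply, Module.End.mul_apply,
          LinearMap.add_apply, Module.End.one_apply, sub_eq_iff_eq_add] at e
        rw [e]
        exact S.add_mem (S.add_mem (hw.2 c _) (S.smul_mem _ hw.1))
          (S.smul_mem _ (hSneg b l hl _ (hw.2 a m)))⟩⟩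
  have : S = ⊤ := submodule_eq_top hS0 fun a m v hv => (hST hv).2 a m
  exact top_le_iff.1 (this ▸ hSP)

/-- The bracket of two currents is a delta function with a current as coefficient, killed by `z -
w`, plus a multiple of its derivative coming from the level, killed by `(z - w)²`. -/
theorem isLocal_current (a b : L ⊕ M) : IsLocal
    (signedBracket ((-1) ^ (currentParity a * currentParity b)) (current (κ := κ) a) (current b)) := by
  obtain ⟨c, k, h⟩ := current_bracket (κ := κ) a b
  refine ⟨2, ?_⟩
  rw [show signedBracket _ _ _ = _ from funext fun m => funext fun l => h m l]
  funext m l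
  rw [pow_two, Module.End.mul_apply]
  simp only [shiftSub_apply, Pi.zero_apply]
  rw [show m + 1 + (l + 1) = m + 1 + 1 + l by ring,
    show m + (l + 1 + 1) = m + 1 + 1 + l by ring]
  split_ifs <;> push_cast <;> module

end UniversalAffine

end Currents

end

end RectW
namespace RectW

noncomputable section

/-! ### Truncation and translation covariance of normally ordered products -/

section Fields

variable {V : Type*} [AddCommGroup V] [Module ℂ V]

theorem signedBracket_symm {ε : ℂ} (hε : ε * ε = 1) {A B : ℤ → Module.End ℂ V}
    (h : IsLocal (signedBracket ε A B)) : IsLocal (signedBracket ε B A) := by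
  convert h.swap.smul (-ε) using 1
  funext m l
  simp only [signedBracket, Pi.smul_apply, smul_sub, smul_smul, neg_mul, hε]
  module

theorem isField_normalOrder {A B : ℤ → Module.End ℂ V} (hA : IsField A) (hB : IsField B) (ε : ℂ) :
    IsField (normalOrder ε A B) := by
  intro v
  obtain ⟨I, hI⟩ := hA v
  obtain ⟨L, hL⟩ := hB v
  -- Only finitely many `i ≥ 0` have `A i v ≠ 0`; a common truncation bound for `B` on these vectors
  -- is needed.
  have hK : ∀ n : ℕ, ∃ K : ℤ, ∀ i < n, ∀ m ≥ K, B m (A i v) = 0 := by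
    intro n
    induction n with
    | zero => exact ⟨0, fun i hi => absurd hi (Nat.not_lt_zero i)⟩
    | succ n ih =>
      obtain ⟨K, hK⟩ := ih
      obtain ⟨K', hK'⟩ := hB (A n v)
      refine ⟨max K K', fun i hi m hm => ?_⟩
      rcases Nat.lt_succ_iff_lt_or_eq.1 hi with h | rfl
      · exact hK i h m (le_trans (le_max_left _ _) hm)
      · exact hK' m (le_trans (le_max_right _ _) hm)
  obtain ⟨K, hK⟩ := hK I.toNat
  refine ⟨max L (K + I.toNat), fun s hs => ?_⟩
  have h1 := le_trans (le_max_left _ _) hs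
  have h2 := le_trans (le_max_right _ _) hs
  rw [normalOrder_apply hA hB, residue]
  refine (finsum_congr fun i => ?_).trans finsum_zero
  rw [hL _ (by omega), map_zero, zero_add]
  rcases lt_or_ge i I.toNat with h | h
  · rw [hK i h _ (by omega), smul_zero]
  · rw [hI _ (by omega), map_zero, smul_zero]

open Filter in
theorem normalOrder_translation {A B : ℤ → Module.End ℂ V} (hA : IsField A) (hB : IsField B) (ε : ℂ)
    {D : Module.End ℂ V} (hDA : ∀ m v, D (A m v) = A m (D v) + (-m : ℂ) • A (m - 1) v)
    (hDB : ∀ m v, D (B m v) = B m (D v) + (-m : ℂ) • B (m - 1) v) (s : ℤ) (v : V) :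
    D (normalOrder ε A B s v) =
      normalOrder ε A B s (D v) + (-s : ℂ) • normalOrder ε A B (s - 1) v := by
  obtain ⟨I, hI⟩ := hA v
  obtain ⟨L, hL⟩ := hB v
  obtain ⟨N, ⟨h1, h2⟩, h3, h4⟩ := (((normalOrder_eventually hA hB ε s v).and
    (normalOrder_eventually hA hB ε s (D v))).and
    ((normalOrder_eventually hA hB ε (s - 1) v).and
    (eventually_ge_atTop (max (I + 1).toNat (L - s + 1).toNat)))).exists
  have h5 := le_trans (le_max_left _ _) h4
  have h6 := le_trans (le_max_right _ _) h4
  -- The difference of the two sides is a telescoping sum with the weight `i`. The weight kills the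
  -- lower end, and truncation kills the upper one.
  have e1 := Finset.sum_range_sub (fun i : ℕ => (i : ℂ) • (A (-1 - i) (B (s - 1 + i) v) +
    ε • B (s - 1 - i) (A (i - 1) v))) N
  rw [hL _ (by omega), hI _ (by omega)] at e1
  simp only [map_zero, smul_zero, add_zero, Nat.cast_zero, zero_smul, sub_zero] at e1
  rw [h1, h2, h3, map_sum, Finset.smul_sum, ← sub_eq_zero, ← Finset.sum_add_distrib,
    ← Finset.sum_sub_distrib, ← e1]
  refine Finset.sum_congr rfl fun i _ => ?_
  simp only [map_add, map_smul, hDA, hDB]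
  push_cast
  rw [show -1 - ((i : ℤ) + 1) = -1 - i - 1 by ring, show s - 1 + ((i : ℤ) + 1) = s + i by ring,
    show s - 1 - ((i : ℤ) + 1) = s - 1 - i - 1 by ring, add_sub_cancel_right,
    show s + (i : ℤ) - 1 = s - 1 + i by ring, show s - 1 - 1 - (i : ℤ) = s - 1 - i - 1 by ring]
  module

end Fields

/-! ### Goddard uniqueness and existence of the field of a state -/

section Currents

universe u v w

variable {L : Type u} {M : Type v} [LieRing L] [LieAlgebra ℂ L]
  [AddCommGroup M] [Module ℂ M] [LieRingModule L M]

namespace UniversalAffine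

variable {κ : LinearMap.BilinForm ℂ L}

/-- A family of maps which is local with respect to all currents and kills the vacuum is zero. -/
theorem eq_zero_of_isLocal_current {W : Type*} [AddCommGroup W] [Module ℂ W]
    {T : ℤ → UniversalAffine M κ →ₗ[ℂ] W} (hvac : ∀ m, T m (vac M κ) = 0)
    (h : ∀ a : L ⊕ M, ∃ (b : ℤ → Module.End ℂ W) (k : ℕ),
      IsLocal fun m l => T m ∘ₗ current a l - b l ∘ₗ T m ∘ₗ parity ^ k) : T = 0 := by
  -- Moving a current past `T m` may insert the parity involution, so vanishing is required at `v`
  -- and at `parity v`.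
  let P : Submodule ℂ (UniversalAffine M κ) :=
    ⨅ m, LinearMap.ker (T m) ⊓ LinearMap.ker (T m ∘ₗ parity)
  have hmem : ∀ v, v ∈ P ↔ ∀ m, T m v = 0 ∧ T m (parity v) = 0 := fun v => by
    simp [P, Submodule.mem_iInf]
  have hpow : ∀ (k : ℕ) (v), v ∈ P → ∀ m, T m ((parity ^ k) v) = 0 := by
    intro k
    induction k with
    | zero => intro v hv m; exact ((hmem v).1 hv m).1
    | succ k ih =>
      intro v hv m
      rw [pow_succ, Module.End.mul_apply]
      refine ih _ ((hmem _).2 fun m => ⟨((hmem v).1 hv m).2, ?_⟩) m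
      rw [parity_parity]
      exact ((hmem v).1 hv m).1
  have hcur : ∀ (a : L ⊕ M) (v), v ∈ P → ∀ m l, T m (current a l v) = 0 := by
    intro a v hv
    obtain ⟨b, k, hb⟩ := h a
    obtain ⟨N, hN⟩ := current_isField a v
    have h1 := hb.map (LinearMap.applyₗ v : (UniversalAffine M κ →ₗ[ℂ] W) →ₗ[ℂ] W)
    have h2 : (fun m l => (LinearMap.applyₗ v : (UniversalAffine M κ →ₗ[ℂ] W) →ₗ[ℂ] W)
        (T m ∘ₗ current a l - b l ∘ₗ T m ∘ₗ parity ^ k)) =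
        fun m l => T m (current a l v) := by
      funext m l
      simp [hpow k v hv m]
    rw [h2] at h1
    -- For `v ∈ P` the second half of the commutator vanishes on `v`, so `T(z)a(w)v` itself is
    -- local. Its modes vanish for large `l` since `a` is a field, and hence it is zero.
    have h3 := eq_zero_of_isLocal h1 (L := N) fun m l hl => by rw [hN l hl, map_zero]
    exact fun m l => congrFun (congrFun h3 m) l
  have hP : P = ⊤ := by
    refine submodule_eq_top ((hmem _).2 fun m => ⟨hvac m, ?_⟩) fun a l v hv =>
      (hmem _).2 fun m => ⟨hcur a v hv m l, ?_⟩
    · rw [parity_vac]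
      exact hvac m
    · rw [parity_current, map_smul, hcur a (parity v), smul_zero]
      refine (hmem _).2 fun m => ⟨((hmem v).1 hv m).2, ?_⟩
      rw [parity_parity]
      exact ((hmem v).1 hv m).1
  funext m
  ext v
  have hv : v ∈ P := hP ▸ Submodule.mem_top
  exact ((hmem v).1 hv m).1

theorem IsVertexOperator.isLocal {u : UniversalAffine M κ}
    {A : ℤ → Module.End ℂ (UniversalAffine M κ)} (h : IsVertexOperator u A) (a : L ⊕ M) :
    IsLocal fun m l => A m * current a l -
      current a l * (parity ^ currentParity a * A m * parity ^ currentParity a) := by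
  rcases a with x | x
  · simpa [current, currentParity] using isLocal_iff.2 (h.even_local x)
  · simpa [current, currentParity] using isLocal_iff.2 (h.odd_local x)

theorem IsVertexOperator.eq_of_vac {u u' : UniversalAffine M κ}
    {A B : ℤ → Module.End ℂ (UniversalAffine M κ)}
    (hA : IsVertexOperator u A) (hB : IsVertexOperator u' B) (h : u = u') : A = B := by
  subst h
  rw [← sub_eq_zero]
  refine eq_zero_of_isLocal_current (fun m => ?_) fun a =>
    ⟨fun l => current a l * parity ^ currentParity a, currentParity a, ?_⟩
  · rcases lt_or_ge m 0 with hm | hm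
    · have h1 := hA.vac_neg (-m - 1).toNat
      have h2 := hB.vac_neg (-m - 1).toNat
      rw [show -((-m - 1).toNat : ℤ) - 1 = m by omega] at h1 h2
      have h3 : (((-m - 1).toNat.factorial : ℕ) : ℂ) ≠ 0 := by
        exact_mod_cast Nat.factorial_ne_zero _
      exact sub_eq_zero.2 (smul_right_injective _ h3 (h1.trans h2.symm))
    · simp [hA.vac_nonneg m hm, hB.vac_nonneg m hm]
  · convert (hA.isLocal a).sub (hB.isLocal a) using 1
    funext m l
    ext v
    simp only [Pi.sub_apply, LinearMap.sub_apply, LinearMap.comp_apply, Module.End.mul_apply,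
      map_sub]
    abel

/-- The field of a state of parity `p`. -/
structure IsStateField (p : ℕ) (u : UniversalAffine M κ)
    (A : ℤ → Module.End ℂ (UniversalAffine M κ)) : Prop where
  isField : IsField A
  parity_apply : ∀ m v, parity (A m v) = (-1 : ℂ) ^ p • A m (parity v)
  translation_apply : ∀ m v,
    translation (A m v) = A m (translation v) + (-m : ℂ) • A (m - 1) v
  vac_nonneg : ∀ m : ℤ, 0 ≤ m → A m (vac M κ) = 0
  vac_neg_one : A (-1) (vac M κ) = u
  -- Locality is demanded against every `C` that is local with respect to the currents. In this form
  -- it is inherited by normally ordered products, and it makes the fields of any two states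
  -- mutually local.
  isLocal : ∀ (q : ℕ) (C : ℤ → Module.End ℂ (UniversalAffine M κ)),
    (∀ a, IsLocal (signedBracket ((-1) ^ (q * currentParity a)) C (current a))) →
    IsLocal (signedBracket ((-1) ^ (p * q)) A C)

theorem neg_one_pow_mul_self (n : ℕ) : (-1 : ℂ) ^ n * (-1) ^ n = 1 := by
  rw [← mul_pow]
  simp

namespace IsStateField

variable {p : ℕ} {u u' : UniversalAffine M κ} {A B : ℤ → Module.End ℂ (UniversalAffine M κ)}

theorem isLocal_current (h : IsStateField p u A) (a : L ⊕ M) :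
    IsLocal (signedBracket ((-1) ^ (p * currentParity a)) A (current a)) :=
  h.isLocal _ _ fun b => UniversalAffine.isLocal_current a b

theorem zero (p : ℕ) : IsStateField p (0 : UniversalAffine M κ) 0 where
  isField v := ⟨0, fun m _ => rfl⟩
  parity_apply m v := by simp
  translation_apply m v := by simp
  vac_nonneg m _ := rfl
  vac_neg_one := rfl
  isLocal q C _ := by
    convert isLocal_zero using 1
    funext m l
    simp [signedBracket]

theorem add (hA : IsStateField p u A) (hB : IsStateField p u' B) :
    IsStateField p (u + u') (A + B) where
  isField v := by
    obtain ⟨N, hN⟩ := hA.isField v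
    obtain ⟨K, hK⟩ := hB.isField v
    exact ⟨max N K, fun m hm => by
      simp [hN m (le_trans (le_max_left _ _) hm), hK m (le_trans (le_max_right _ _) hm)]⟩
  parity_apply m v := by simp [hA.parity_apply, hB.parity_apply]
  translation_apply m v := by
    simp only [Pi.add_apply, LinearMap.add_apply, map_add, hA.translation_apply,
      hB.translation_apply]
    module
  vac_nonneg m hm := by simp [hA.vac_nonneg m hm, hB.vac_nonneg m hm]
  vac_neg_one := by simp [hA.vac_neg_one, hB.vac_neg_one]
  isLocal q C hC := by
    convert (hA.isLocal q C hC).add (hB.isLocal q C hC) using 1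
    funext m l
    simp only [signedBracket, Pi.add_apply, add_mul, mul_add]
    module

theorem smul (c : ℂ) (hA : IsStateField p u A) : IsStateField p (c • u) (c • A) where
  isField v := by
    obtain ⟨N, hN⟩ := hA.isField v
    exact ⟨N, fun m hm => by simp [hN m hm]⟩
  parity_apply m v := by simp [hA.parity_apply, smul_comm c]
  translation_apply m v := by
    simp only [Pi.smul_apply, LinearMap.smul_apply, map_smul, hA.translation_apply]
    module
  vac_nonneg m hm := by simp [hA.vac_nonneg m hm]
  vac_neg_one := by simp [hA.vac_neg_one]
  isLocal q C hC := by
    convert (hA.isLocal q C hC).smul c using 1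
    funext m l
    simp only [signedBracket, Pi.smul_apply, smul_mul_assoc, mul_smul_comm, smul_sub, smul_comm c]

theorem translation (hA : IsStateField p u A) :
    IsStateField p (translation u) (fun m => (-m : ℂ) • A (m - 1)) where
  isField v := by
    obtain ⟨N, hN⟩ := hA.isField v
    exact ⟨N + 1, fun m hm => by rw [LinearMap.smul_apply, hN _ (by omega), smul_zero]⟩
  parity_apply m v := by
    simp only [LinearMap.smul_apply, map_smul, hA.parity_apply, smul_comm (-m : ℂ)]
  translation_apply m v := by
    simp only [LinearMap.smul_apply, map_smul, hA.translation_apply]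
    push_cast
    module
  vac_nonneg m hm := by
    rcases hm.eq_or_lt with rfl | h
    · simp
    · rw [LinearMap.smul_apply, hA.vac_nonneg _ (by omega), smul_zero]
  vac_neg_one := by
    have h := hA.translation_apply (-1) (vac M κ)
    rw [hA.vac_neg_one, translation_vac, map_zero, zero_add] at h
    exact h.symm
  isLocal q C hC := by
    convert (hA.isLocal q C hC).derivative using 1
    funext m l
    simp only [signedBracket, smul_mul_assoc, mul_smul_comm, smul_sub]
    rw [smul_comm]

/-- The inductive step of the state-field correspondence: the normally ordered product of `a(z)` and
`Y(u, z)` is the field of `a₍₋₁₎u`, and Dong's lemma supplies its locality. -/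
theorem normalOrder (hA : IsStateField p u A) (a : L ⊕ M) :
    IsStateField (currentParity a + p) (current a (-1) u)
      (RectW.normalOrder ((-1) ^ (currentParity a * p)) (current a) A) where
  isField := isField_normalOrder (current_isField a) hA.isField _
  parity_apply m v := by
    obtain ⟨N, h1, h2⟩ := ((normalOrder_eventually (current_isField a) hA.isField
      ((-1) ^ (currentParity a * p)) m v).and (normalOrder_eventually (current_isField a) hA.isField
      ((-1) ^ (currentParity a * p)) m (parity v))).exists
    rw [h1, h2, map_sum, Finset.smul_sum]
    refine Finset.sum_congr rfl fun i _ => ?_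
    simp only [map_add, map_smul, parity_current, hA.parity_apply, pow_add]
    module
  translation_apply m v := normalOrder_translation (current_isField a) hA.isField _
    (translation_current a) hA.translation_apply m v
  vac_nonneg m hm := by
    rw [normalOrder_apply (current_isField a) hA.isField, residue]
    refine (finsum_congr fun i => ?_).trans finsum_zero
    rw [hA.vac_nonneg _ (by omega), current_vac a (by omega)]
    simp
  vac_neg_one := by
    rw [normalOrder_apply (current_isField a) hA.isField, residue]
    refine (finsum_eq_single _ 0 fun i hi => ?_).trans ?_
    · rw [hA.vac_nonneg _ (by omega), current_vac a (by omega)]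
      simp
    · simp [hA.vac_neg_one, current_vac a le_rfl]
  isLocal q C hC := by
    rw [add_mul, pow_add]
    refine isLocal_normalOrder (current_isField a) hA.isField ?_ ?_ (hA.isLocal q C hC)
    · refine signedBracket_symm (neg_one_pow_mul_self _) ?_
      rw [mul_comm]
      exact hA.isLocal_current a
    · refine signedBracket_symm (neg_one_pow_mul_self _) ?_
      rw [mul_comm]
      exact hC a

theorem vac_neg (hA : IsStateField p u A) (j : ℕ) :
    (j.factorial : ℂ) • A (-(j : ℤ) - 1) (vac M κ) = (UniversalAffine.translation ^ j) u := by
  induction j with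
  | zero => simp [hA.vac_neg_one]
  | succ j ih =>
    rw [pow_succ', Module.End.mul_apply, ← ih, map_smul, hA.translation_apply, translation_vac,
      map_zero, zero_add, smul_smul, Nat.factorial_succ]
    push_cast
    rw [show -((j : ℤ) + 1) - 1 = -(j : ℤ) - 1 - 1 by ring]
    congr 1
    ring

/-- The vertex operator of a sum of states of opposite parity. -/
theorem isVertexOperator (hA : IsStateField 0 u A) (hB : IsStateField 1 u' B) :
    IsVertexOperator (u + u') (A + B) where
  truncated v := by
    obtain ⟨N, hN⟩ := hA.isField v
    obtain ⟨K, hK⟩ := hB.isField v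
    exact ⟨max N K, fun m hm => by
      simp [hN m (le_trans (le_max_left _ _) hm), hK m (le_trans (le_max_right _ _) hm)]⟩
  even_local x := by
    refine (isLocal_iff (g := fun m l => (A + B) m * even x l - even x l * (A + B) m)).1 ?_
    convert (hA.isLocal_current (.inl x)).add (hB.isLocal_current (.inl x)) using 1
    funext m l
    simp only [signedBracket, Pi.add_apply, current, currentParity, mul_zero, pow_zero, one_smul]
    noncomm_ring
  odd_local y := by
    refine (isLocal_iff (g := fun m l => (A + B) m * odd y l -
      odd y l * (parity * (A + B) m * parity))).1 ?_
    convert (hA.isLocal_current (.inr y)).add (hB.isLocal_current (.inr y)) using 1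
    funext m l
    ext v
    simp [signedBracket, current, currentParity, hA.parity_apply, hB.parity_apply, parity_parity]
    abel
  vac_nonneg m hm := by simp [hA.vac_nonneg m hm, hB.vac_nonneg m hm]
  vac_neg j := by
    rw [Pi.add_apply, LinearMap.add_apply, smul_add, hA.vac_neg, hB.vac_neg, map_add]

theorem isVertexOperator_even (hA : IsStateField 0 u A) : IsVertexOperator u A := by
  simpa using hA.isVertexOperator (zero 1)

theorem isVertexOperator_odd (hB : IsStateField 1 u B) : IsVertexOperator u B := by
  simpa using (zero 0).isVertexOperator hB

end IsStateField

variable (M κ) in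
/-- The states of parity `p` which have a field. -/
def stateSubmodule (p : ℕ) : Submodule ℂ (UniversalAffine M κ) where
  carrier := {u | ∃ A, IsStateField p u A}
  zero_mem' := ⟨0, .zero p⟩
  add_mem' := fun ⟨_, hA⟩ ⟨_, hB⟩ => ⟨_, hA.add hB⟩
  smul_mem' := fun c _ ⟨_, hA⟩ => ⟨_, hA.smul c⟩

/-- The parity enters only through powers of `-1`. This sends an odd current applied to an odd
state, formally of parity `2`, back to the even states. -/
theorem stateSubmodule_add_two (p : ℕ) : stateSubmodule M κ (p + 2) = stateSubmodule M κ p := by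
  have h : ∀ k q : ℕ, (-1 : ℂ) ^ ((k + 2) * q) = (-1) ^ (k * q) := fun k q => by
    rw [add_mul, pow_add, pow_mul (-1 : ℂ) 2]
    simp
  have h' : ∀ k : ℕ, (-1 : ℂ) ^ (k + 2) = (-1) ^ k := fun k => by simpa using h k 1
  ext u
  refine exists_congr fun A => ⟨fun hA => ?_, fun hA => ?_⟩
  · exact ⟨hA.isField, fun m v => by rw [hA.parity_apply, h'], hA.translation_apply,
      hA.vac_nonneg, hA.vac_neg_one, fun q C hC => by rw [← h]; exact hA.isLocal q C hC⟩
  · exact ⟨hA.isField, fun m v => by rw [hA.parity_apply, h'], hA.translation_apply,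
      hA.vac_nonneg, hA.vac_neg_one, fun q C hC => by rw [h]; exact hA.isLocal q C hC⟩

theorem vac_mem_stateSubmodule : vac M κ ∈ stateSubmodule M κ 0 := by
  refine ⟨fun m => if m = -1 then 1 else 0, fun v => ⟨0, fun m hm => ?_⟩, fun m v => ?_,
    fun m v => ?_, fun m hm => ?_, ?_, fun q C _ => ⟨0, ?_⟩⟩
  · rw [if_neg (by omega)]; rfl
  · split_ifs <;> simp
  · by_cases h : m = -1
    · subst h; simp
    · by_cases h0 : m = 0
      · subst h0; simp
      · have : m - 1 ≠ -1 := by omega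
        simp [h, this]
  · rw [if_neg (by omega)]; rfl
  · simp
  · funext m l
    simp only [signedBracket, pow_zero, Module.End.one_apply, zero_mul, one_smul]
    split_ifs <;> simp

theorem translation_mem_stateSubmodule {p : ℕ} {u : UniversalAffine M κ}
    (h : u ∈ stateSubmodule M κ p) : translation u ∈ stateSubmodule M κ p := by
  obtain ⟨A, hA⟩ := h
  exact ⟨_, hA.translation⟩

theorem current_mem_stateSubmodule {p : ℕ} {u : UniversalAffine M κ} (a : L ⊕ M)
    (h : u ∈ stateSubmodule M κ p) :
    current a (-1) u ∈ stateSubmodule M κ (currentParity a + p) := by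
  obtain ⟨A, hA⟩ := h
  exact ⟨_, hA.normalOrder a⟩

/-- The vacuum has the identity field, and states with fields are closed under `∂` and under
`a₍₋₁₎`. These operations generate the whole space. -/
theorem stateSubmodule_sup : stateSubmodule M κ 0 ⊔ stateSubmodule M κ 1 = ⊤ := by
  refine submodule_eq_top_of_translation (Submodule.mem_sup_left vac_mem_stateSubmodule)
    (fun v hv => ?_) fun a v hv => ?_
  · obtain ⟨u, hu, w, hw, rfl⟩ := Submodule.mem_sup.1 hv
    rw [map_add]
    exact Submodule.add_mem_sup (translation_mem_stateSubmodule hu)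
      (translation_mem_stateSubmodule hw)
  · obtain ⟨u, hu, w, hw, rfl⟩ := Submodule.mem_sup.1 hv
    rw [map_add]
    have h1 := current_mem_stateSubmodule a hu
    have h2 := current_mem_stateSubmodule a hw
    rcases a with x | y
    · exact Submodule.add_mem_sup h1 h2
    · rw [add_comm]
      refine Submodule.add_mem_sup ?_ h1
      rw [← stateSubmodule_add_two]
      exact h2

theorem exists_isVertexOperator (u : UniversalAffine M κ) : ∃ A, IsVertexOperator u A := by
  have hu : u ∈ stateSubmodule M κ 0 ⊔ stateSubmodule M κ 1 := by
    rw [stateSubmodule_sup]; exact Submodule.mem_top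
  obtain ⟨v, ⟨A, hA⟩, w, ⟨B, hB⟩, rfl⟩ := Submodule.mem_sup.1 hu
  exact ⟨_, hA.isVertexOperator hB⟩

theorem isVertexOperator_vertexOperator (u : UniversalAffine M κ) :
    IsVertexOperator u (vertexOperator u) := by
  have h := exists_isVertexOperator u
  rw [vertexOperator, dif_pos h]
  exact h.choose_spec

theorem IsVertexOperator.eq {u : UniversalAffine M κ}
    {A : ℤ → Module.End ℂ (UniversalAffine M κ)} (h : IsVertexOperator u A) :
    vertexOperator u = A :=
  (isVertexOperator_vertexOperator u).eq_of_vac h rfl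

theorem isStateField_vertexOperator_even {u : UniversalAffine M κ}
    (h : u ∈ stateSubmodule M κ 0) : IsStateField 0 u (vertexOperator u) := by
  obtain ⟨A, hA⟩ := h
  rwa [hA.isVertexOperator_even.eq]

theorem isStateField_vertexOperator_odd {u : UniversalAffine M κ}
    (h : u ∈ stateSubmodule M κ 1) : IsStateField 1 u (vertexOperator u) := by
  obtain ⟨A, hA⟩ := h
  rwa [hA.isVertexOperator_odd.eq]

end UniversalAffine

end Currents

end

end RectW
namespace RectW

noncomputable section

/-! ### Linearity of vertex operators and the commutator formula for primary states -/

section Currents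

universe u v w

variable {L : Type u} {M : Type v} [LieRing L] [LieAlgebra ℂ L]
  [AddCommGroup M] [Module ℂ M] [LieRingModule L M]

namespace UniversalAffine

variable {κ : LinearMap.BilinForm ℂ L}

theorem IsVertexOperator.isLocal_even {u : UniversalAffine M κ}
    {A : ℤ → Module.End ℂ (UniversalAffine M κ)} (h : IsVertexOperator u A) (x : L) :
    IsLocal fun m l => A m * even x l - even x l * A m :=
  (isLocal_iff (g := fun m l => A m * even x l - even x l * A m)).2 (h.even_local x)

theorem IsVertexOperator.isLocal_odd {u : UniversalAffine M κ}
    {A : ℤ → Module.End ℂ (UniversalAffine M κ)} (h : IsVertexOperator u A) (y : M) :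
    IsLocal fun m l => A m * odd y l - odd y l * (parity * A m * parity) :=
  (isLocal_iff (g := fun m l => A m * odd y l - odd y l * (parity * A m * parity))).2
    (h.odd_local y)

theorem vertexOperator_vac_neg_one (u : UniversalAffine M κ) :
    vertexOperator u (-1) (vac M κ) = u := by
  simpa using (isVertexOperator_vertexOperator u).vac_neg 0

theorem vertexOperator_add (u v : UniversalAffine M κ) :
    vertexOperator (u + v) = vertexOperator u + vertexOperator v := by
  have hu := isVertexOperator_vertexOperator u
  have hv := isVertexOperator_vertexOperator v
  refine IsVertexOperator.eq ⟨fun w => ?_, fun x => ?_, fun y => ?_, fun m hm => ?_, fun j => ?_⟩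
  · obtain ⟨N, hN⟩ := hu.truncated w
    obtain ⟨K, hK⟩ := hv.truncated w
    exact ⟨max N K, fun m hm => by
      simp [hN m (le_trans (le_max_left _ _) hm), hK m (le_trans (le_max_right _ _) hm)]⟩
  · refine (isLocal_iff (g := fun m l => (vertexOperator u + vertexOperator v) m * even x l -
      even x l * (vertexOperator u + vertexOperator v) m)).1 ?_
    convert (hu.isLocal_even x).add (hv.isLocal_even x) using 1
    funext m l
    simp only [Pi.add_apply]
    noncomm_ring
  · refine (isLocal_iff (g := fun m l => (vertexOperator u + vertexOperator v) m * odd y l -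
      odd y l * (parity * (vertexOperator u + vertexOperator v) m * parity))).1 ?_
    convert (hu.isLocal_odd y).add (hv.isLocal_odd y) using 1
    funext m l
    simp only [Pi.add_apply]
    noncomm_ring
  · simp [hu.vac_nonneg m hm, hv.vac_nonneg m hm]
  · rw [Pi.add_apply, LinearMap.add_apply, smul_add, hu.vac_neg, hv.vac_neg, map_add]

theorem vertexOperator_smul (c : ℂ) (u : UniversalAffine M κ) :
    vertexOperator (c • u) = c • vertexOperator u := by
  have hu := isVertexOperator_vertexOperator u
  refine IsVertexOperator.eq ⟨fun w => ?_, fun x => ?_, fun y => ?_, fun m hm => ?_, fun j => ?_⟩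
  · obtain ⟨N, hN⟩ := hu.truncated w
    exact ⟨N, fun m hm => by simp [hN m hm]⟩
  · refine (isLocal_iff (g := fun m l => (c • vertexOperator u) m * even x l -
      even x l * (c • vertexOperator u) m)).1 ?_
    convert (hu.isLocal_even x).smul c using 1
    funext m l
    simp only [Pi.smul_apply, smul_mul_assoc, mul_smul_comm, smul_sub]
  · refine (isLocal_iff (g := fun m l => (c • vertexOperator u) m * odd y l -
      odd y l * (parity * (c • vertexOperator u) m * parity))).1 ?_
    convert (hu.isLocal_odd y).smul c using 1
    funext m l
    simp only [Pi.smul_apply, smul_mul_assoc, mul_smul_comm, smul_sub]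
  · simp [hu.vac_nonneg m hm]
  · rw [Pi.smul_apply, LinearMap.smul_apply, smul_comm, hu.vac_neg, map_smul]

theorem vertexOperator_current (a : L ⊕ M) :
    vertexOperator (current a (-1) (vac M κ)) = current a := by
  refine IsVertexOperator.eq ⟨current_isField a, fun x => ?_, fun y => ?_,
    fun m hm => current_vac a hm, fun j => ?_⟩
  · refine (isLocal_iff (g := fun m l => current a m * even x l - even x l * current a m)).1 ?_
    convert isLocal_current (κ := κ) a (.inl x) using 1
    funext m l
    simp [signedBracket, currentParity, current]
  · refine (isLocal_iff (g := fun m l => current a m * odd y l -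
      odd y l * (parity * current a m * parity))).1 ?_
    convert isLocal_current (κ := κ) a (.inr y) using 1
    funext m l
    ext v
    simp [signedBracket, currentParity, parity_current, parity_parity]
    rfl
  · induction j with
    | zero => simp
    | succ j ih =>
      rw [pow_succ', Module.End.mul_apply, ← ih, map_smul, translation_current, translation_vac,
        map_zero, zero_add, smul_smul, Nat.factorial_succ]
      push_cast
      rw [show -((j : ℤ) + 1) - 1 = -(j : ℤ) - 1 - 1 by ring]
      congr 1
      ring

theorem nProd_current (a : L ⊕ M) (m : ℤ) (v : UniversalAffine M κ) :
    nProd m (current a (-1) (vac M κ)) v = current a m v := by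
  rw [nProd, vertexOperator_current]

theorem translation_vertexOperator_vac (u : UniversalAffine M κ) (m : ℤ) :
    translation (vertexOperator u m (vac M κ)) =
      (-m : ℂ) • vertexOperator u (m - 1) (vac M κ) := by
  have hu := isVertexOperator_vertexOperator u
  rcases lt_or_ge m 0 with h | h
  · obtain ⟨j, rfl⟩ : ∃ j : ℕ, m = -(j : ℤ) - 1 := ⟨(-m - 1).toNat, by omega⟩
    have h1 := hu.vac_neg j
    have h2 := hu.vac_neg (j + 1)
    have h3 : ((j.factorial : ℕ) : ℂ) ≠ 0 := by exact_mod_cast Nat.factorial_ne_zero _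
    apply smul_right_injective _ h3
    simp only
    rw [← map_smul, h1, ← Module.End.mul_apply, ← pow_succ', ← h2, smul_smul, Nat.factorial_succ]
    push_cast
    rw [show -((j : ℤ) + 1) - 1 = -(j : ℤ) - 1 - 1 by ring]
    congr 1
    ring
  · rw [hu.vac_nonneg m h, map_zero]
    rcases h.eq_or_lt with rfl | h
    · simp
    · rw [hu.vac_nonneg _ (by omega), smul_zero]

/-- The commutator of a current with a family that is local with respect to all currents is local
with respect to all currents. -/
theorem isLocal_bracket_even {u : UniversalAffine M κ} (x : L) (m : ℤ) (a : L ⊕ M) :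
    IsLocal fun l r => (even x m * vertexOperator u l - vertexOperator u l * even x m) * current a r -
      current a r * (parity ^ currentParity a *
        (even x m * vertexOperator u l - vertexOperator u l * even x m) *
        parity ^ currentParity a) := by
  have hu := isVertexOperator_vertexOperator u
  have hpar : ∀ k : ℕ, parity ^ k * even (M := M) (κ := κ) x m = even x m * parity ^ k := by
    intro k
    refine (Commute.pow_left ?_ k).eq
    ext v
    simpa [currentParity, current] using parity_current (κ := κ) (M := M) (.inl x) m v
  -- By the Jacobi identity `[[x_m, A], a_r] = [x_m, [A, a_r]] - [A, [x_m, a_r]]`. The inner bracket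
  -- `[x_m, a_r]` is a mode of a current of the same parity as `a`, plus a scalar. The scalar is
  -- nonzero only for `a` even, where it commutes with `A`.
  obtain ⟨c, k, hc, hk⟩ : ∃ (c : L ⊕ M) (k : ℂ), currentParity c = currentParity a ∧
      ∀ r, (even (κ := κ) x m * current a r - current a r * even x m = current c (m + r) +
        (if m + r = 0 then (m : ℂ) * k else 0) • 1) ∧
        (k = 0 ∨ currentParity a = 0) := by
    rcases a with y | y
    · exact ⟨.inl ⁅x, y⁆, κ x y, rfl, fun r => ⟨even_even x y m r, .inr rfl⟩⟩
    · refine ⟨.inr ⁅x, y⁆, 0, rfl, fun r => ⟨?_, .inl rfl⟩⟩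
      simpa [current] using even_odd (κ := κ) x y m r
  have h1 := (hu.isLocal a).map (LinearMap.mulLeft ℂ (even x m) - LinearMap.mulRight ℂ (even x m))
  have h2 := (hu.isLocal c).translate 0 m
  rw [hc] at h2
  convert h1.sub h2 using 1
  funext l r
  set P := (parity (M := M) (κ := κ)) ^ currentParity a with hP
  have e1 := (hk r).1
  simp only [zero_add, Pi.sub_apply, LinearMap.sub_apply, LinearMap.mulLeft_apply,
    LinearMap.mulRight_apply]
  have e2 : current c (m + r) = even (κ := κ) x m * current a r - current a r * even x m -
        (if m + r = 0 then (m : ℂ) * k else 0) • 1 := by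
    rw [e1, add_sub_cancel_right]
  have e3 : (if m + r = 0 then (m : ℂ) * k else 0) • (P * (vertexOperator u l * P)) =
      (if m + r = 0 then (m : ℂ) * k else 0) • vertexOperator u l := by
    rcases (hk r).2 with h | h
    · simp [h]
    · simp [hP, h]
  have e4 : P * (even x m * vertexOperator u l - vertexOperator u l * even x m) * P =
      even x m * (P * vertexOperator u l * P) - P * vertexOperator u l * P * even x m := by
    rw [mul_sub, sub_mul, ← mul_assoc, hpar]
    simp only [mul_assoc]
    rw [hpar]
  rw [e2, e4]
  simp only [mul_sub, sub_mul, mul_smul_comm, smul_mul_assoc, mul_one, one_mul, e3, mul_assoc]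
  abel

/-- The commutator formula for a current and a state which is primary for it. -/
theorem even_vertexOperator {u : UniversalAffine M κ} {x : L}
    (h : ∀ j : ℤ, 1 ≤ j → even x j u = 0) (m l : ℤ) :
    even x m * vertexOperator u l - vertexOperator u l * even x m =
      vertexOperator (even x 0 u) (m + l) := by
  have hu := isVertexOperator_vertexOperator u
  have hw := isVertexOperator_vertexOperator (even x 0 u)
  have htr := translation_current (κ := κ) (M := M) (.inl x)
  simp only [current] at htr
  -- On the vacuum the formula follows by applying `∂` repeatedly to the case `l = -1`, which is the
  -- hypothesis that `u` is primary.
  have hvac : ∀ m l : ℤ, 0 ≤ m → even x m (vertexOperator u l (vac M κ)) =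
      vertexOperator (even x 0 u) (m + l) (vac M κ) := by
    intro m l hm
    rcases lt_or_ge l 0 with hl | hl
    · obtain ⟨j, rfl⟩ : ∃ j : ℕ, l = -(j : ℤ) - 1 := ⟨(-l - 1).toNat, by omega⟩
      clear hl
      induction j generalizing m with
      | zero =>
        simp only [CharP.cast_eq_zero, neg_zero, zero_sub]
        rw [vertexOperator_vac_neg_one]
        rcases hm.eq_or_lt with rfl | hm
        · rw [zero_add, vertexOperator_vac_neg_one]
        · rw [h m (by omega), hw.vac_nonneg _ (by omega)]
      | succ j ih =>
        have e1 := translation_vertexOperator_vac u (-(j : ℤ) - 1)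
        have e2 := htr m (vertexOperator u (-(j : ℤ) - 1) (vac M κ))
        have e3 : (m : ℂ) • even x (m - 1) (vertexOperator u (-(j : ℤ) - 1) (vac M κ)) =
            (m : ℂ) • vertexOperator (even x 0 u) (m - 1 + (-(j : ℤ) - 1)) (vac M κ) := by
          rcases hm.eq_or_lt with rfl | hm
          · simp
          · rw [ih (m - 1) (by omega)]
        rw [ih m hm, translation_vertexOperator_vac, e1, map_smul, neg_smul (m : ℂ), e3] at e2
        have hj : (j : ℂ) + 1 ≠ 0 := Nat.cast_add_one_ne_zero j
        apply smul_right_injective _ hj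
        push_cast
        rw [show -((j : ℤ) + 1) - 1 = -(j : ℤ) - 1 - 1 by ring,
          show m + (-(j : ℤ) - 1 - 1) = m - 1 + (-(j : ℤ) - 1) by ring]
        rw [show m + (-(j : ℤ) - 1) - 1 = m - 1 + (-(j : ℤ) - 1) by ring] at e2
        push_cast at e2
        linear_combination (norm := module) -e2
    · rw [hu.vac_nonneg l hl, hw.vac_nonneg _ (by omega), map_zero]
  -- For fixed `m ≥ 0` both sides are local with respect to all currents and agree on the vacuum, so
  -- Goddard's argument identifies them.
  have hnonneg : ∀ m : ℤ, 0 ≤ m → ∀ l, even x m * vertexOperator u l -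
      vertexOperator u l * even x m = vertexOperator (even x 0 u) (m + l) := by
    intro m hm l
    refine sub_eq_zero.1 (congrFun (eq_zero_of_isLocal_current
      (T := fun l => even x m * vertexOperator u l - vertexOperator u l * even x m -
        vertexOperator (even x 0 u) (m + l)) (fun l => ?_) fun a =>
      ⟨fun l => current a l * parity ^ currentParity a, currentParity a, ?_⟩) l)
    · have e : even x m (vac M κ) = 0 := current_vac (.inl x) hm
      simp [hvac m l hm, e]
    · convert (isLocal_bracket_even x m a (u := u)).sub ((hw.isLocal a).translate m 0) using 1
      funext m l
      ext v
      simp only [Pi.sub_apply, LinearMap.sub_apply, LinearMap.comp_apply, Module.End.mul_apply,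
        map_sub, zero_add]
      abel
  -- Negative modes of `x` are reached by locality in both variables: the difference is a local
  -- distribution that vanishes once the mode of `x` is nonnegative, hence everywhere.
  have hloc : IsLocal fun m l => even x l * vertexOperator u m - vertexOperator u m * even x l -
      vertexOperator (even x 0 u) (l + m) := by
    have h1 := hu.isLocal_even x
    have h2 : IsLocal fun m l : ℤ => vertexOperator (even x 0 u) (l + m) := by
      refine ⟨1, ?_⟩
      funext m l
      rw [pow_one, shiftSub_apply, show l + (m + 1) = l + 1 + m by ring]
      exact sub_self _
    convert h1.neg.sub h2 using 1
    funext m l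
    simp
  have h0 := eq_zero_of_isLocal hloc (L := 0) fun l m hm => sub_eq_zero.2 (hnonneg m hm l)
  exact sub_eq_zero.1 (congrFun (congrFun h0 l) m)

end UniversalAffine

end Currents

end

end RectW
namespace RectW

noncomputable section

/-! ### Extension of a primary cocycle to an odd derivation -/

section Derivations

universe u v w

variable {L : Type u} {M : Type v} {N : Type w} [LieRing L] [LieAlgebra ℂ L]
  [AddCommGroup M] [Module ℂ M] [LieRingModule L M] [AddCommGroup N] [Module ℂ N]
  [LieRingModule L N]

namespace UniversalAffine

variable {κ : LinearMap.BilinForm ℂ L}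

theorem map_even (φ : N →ₗ⁅ℂ, L⁆ M) (x : L) (m : ℤ) (v : UniversalAffine N κ) :
    map φ (even x m v) = even x m (map φ v) := by
  obtain ⟨a, rfl⟩ := toVac_surjective v
  simp [even_toVac, map_toVac, ModeAlgebra.map_gen]

theorem current_inr_of_subsingleton [Subsingleton N] (y : N) (m : ℤ) :
    current (κ := κ) (.inr y : L ⊕ N) m = 0 := by
  rw [Subsingleton.elim y 0]
  exact map_zero (oddHom N κ m)

theorem submodule_eq_top_of_even [Subsingleton N] {P : Submodule ℂ (UniversalAffine N κ)}
    (hv : vac N κ ∈ P) (hP : ∀ (x : L) (m), ∀ v ∈ P, even x m v ∈ P) : P = ⊤ := by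
  refine submodule_eq_top hv fun a m v hv => ?_
  rcases a with x | y
  · exact hP x m v hv
  · rw [current_inr_of_subsingleton]
    exact P.zero_mem

theorem ext_even [Subsingleton N] {W : Type*} [AddCommGroup W] [Module ℂ W]
    {f g : UniversalAffine N κ →ₗ[ℂ] W} (hv : f (vac N κ) = g (vac N κ))
    (h : ∀ (x : L) m v, f v = g v → f (even x m v) = g (even x m v)) : f = g :=
  LinearMap.eqLocus_eq_top.1 (submodule_eq_top_of_even hv h)

theorem map_translation [Subsingleton N] (φ : N →ₗ⁅ℂ, L⁆ M) (v : UniversalAffine N κ) :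
    map φ (translation v) = translation (map φ v) := by
  refine DFunLike.congr_fun (ext_even (f := map φ ∘ₗ translation) (g := translation ∘ₗ map φ)
    ?_ fun x m v h => ?_) v
  · simp [translation_vac, map_vac]
  · have h1 := translation_current (κ := κ) (.inl x : L ⊕ N) m v
    have h2 := translation_current (κ := κ) (.inl x : L ⊕ M) m (map φ v)
    simp only [current, LinearMap.comp_apply] at h h1 h2 ⊢
    rw [h1, map_even, h2, map_add, map_smul, map_even, map_even, h]

theorem parity_map [Subsingleton N] (φ : N →ₗ⁅ℂ, L⁆ M) (v : UniversalAffine N κ) :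
    parity (map φ v) = map φ v := by
  refine DFunLike.congr_fun (ext_even (f := parity ∘ₗ map φ) (g := map φ)
    ?_ fun x m v h => ?_) v
  · simp [parity_vac, map_vac]
  · have h1 := parity_current (κ := κ) (.inl x : L ⊕ M) m (map φ v)
    simp only [current, LinearMap.comp_apply, currentParity, pow_zero, one_smul] at h h1 ⊢
    rw [map_even, h1, h]

theorem map_mem_stateSubmodule [Subsingleton N] (φ : N →ₗ⁅ℂ, L⁆ M) (v : UniversalAffine N κ) :
    map φ v ∈ stateSubmodule M κ 0 := by
  have h : (stateSubmodule M κ 0).comap (map φ) = ⊤ := by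
    refine submodule_eq_top_of_translation ?_ (fun v hv => ?_) fun a v hv => ?_
    · rw [Submodule.mem_comap, map_vac]
      exact vac_mem_stateSubmodule
    · rw [Submodule.mem_comap, map_translation]
      exact translation_mem_stateSubmodule hv
    · rcases a with x | y
      · rw [Submodule.mem_comap, current, map_even]
        exact current_mem_stateSubmodule (.inl x : L ⊕ M) hv
      · rw [current_inr_of_subsingleton]
        exact Submodule.zero_mem _
  exact (h ▸ Submodule.mem_top : v ∈ (stateSubmodule M κ 0).comap (map φ))

/-- A family which kills the vacuum and is local with respect to the even currents is zero, if
there are no odd currents. -/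
theorem eq_zero_of_isLocal_even [Subsingleton N] {W : Type*} [AddCommGroup W] [Module ℂ W]
    {T : ℤ → UniversalAffine N κ →ₗ[ℂ] W} (hvac : ∀ m, T m (vac N κ) = 0)
    (b : L → ℤ → Module.End ℂ W)
    (h : ∀ x, IsLocal fun m l => T m ∘ₗ even x l - b x l ∘ₗ T m) : T = 0 := by
  refine eq_zero_of_isLocal_current hvac fun a => ?_
  rcases a with x | y
  · exact ⟨b x, 0, h x⟩
  · refine ⟨0, 0, ?_⟩
    convert isLocal_zero using 1
    funext m l
    rw [current_inr_of_subsingleton]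
    simp

theorem vertexOperator_vac_eq {W : Type*} [AddCommGroup W] [Module ℂ W] (f : Module.End ℂ W)
    {g : UniversalAffine N κ →ₗ[ℂ] W} (hg : ∀ v, g (translation v) = f (g v))
    (u : UniversalAffine N κ) (j : ℕ) :
    (j.factorial : ℂ) • g (vertexOperator u (-(j : ℤ) - 1) (vac N κ)) = (f ^ j) (g u) := by
  rw [← map_smul, (isVertexOperator_vertexOperator u).vac_neg]
  induction j with
  | zero => rfl
  | succ j ih => rw [pow_succ', Module.End.mul_apply, hg, ih, pow_succ', Module.End.mul_apply]

/-- A linear map that commutes with `∂` maps `Y(u, z)|0⟩` to `Y(g u, z)|0⟩`. -/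
theorem map_vertexOperator_vac {g : UniversalAffine N κ →ₗ[ℂ] UniversalAffine M κ}
    (hg : ∀ v, g (translation v) = translation (g v)) (u : UniversalAffine N κ) (m : ℤ) :
    g (vertexOperator u m (vac N κ)) = vertexOperator (g u) m (vac M κ) := by
  have hu := isVertexOperator_vertexOperator u
  have hw := isVertexOperator_vertexOperator (g u)
  rcases lt_or_ge m 0 with h | h
  · obtain ⟨j, rfl⟩ : ∃ j : ℕ, m = -(j : ℤ) - 1 := ⟨(-m - 1).toNat, by omega⟩
    have h3 : ((j.factorial : ℕ) : ℂ) ≠ 0 := by exact_mod_cast Nat.factorial_ne_zero _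
    exact smul_right_injective _ h3
      ((vertexOperator_vac_eq translation hg u j).trans (hw.vac_neg j).symm)
  · rw [hu.vac_nonneg m h, hw.vac_nonneg m h, map_zero]

theorem map_vertexOperator [Subsingleton N] (φ : N →ₗ⁅ℂ, L⁆ M) (u : UniversalAffine N κ) (m : ℤ)
    (v : UniversalAffine N κ) :
    map φ (vertexOperator u m v) = vertexOperator (map φ u) m (map φ v) := by
  have hu := isVertexOperator_vertexOperator u
  have hw := isVertexOperator_vertexOperator (map φ u)
  refine sub_eq_zero.1 (DFunLike.congr_fun (congrFun (eq_zero_of_isLocal_even (N := N)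
    (T := fun m => map φ ∘ₗ vertexOperator u m - vertexOperator (map φ u) m ∘ₗ map φ)
    (fun m => ?_) even fun x => ?_) m) v)
  · simp [map_vertexOperator_vac (map_translation φ), map_vac]
  · convert ((hu.isLocal_even x).map (LinearMap.compRight ℂ (map φ))).sub
      ((hw.isLocal_even x).map (LinearMap.lcomp ℂ _ (map φ))) using 1
    funext m l
    ext v
    simp [map_even]
    abel

variable (N κ) in
/-- The homomorphism to the dual numbers given by a cocycle `δ` of `L` with values in states which
are primary for the currents. -/
def cocycleHom (δ : L →ₗ[ℂ] UniversalAffine M κ)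
    (hprim : ∀ x y (j : ℤ), 1 ≤ j → even x j (δ y) = 0)
    (hcoc : ∀ x y, even x 0 (δ y) - even y 0 (δ x) = δ ⁅x, y⁆) :
    ModeAlgebra N κ →ₐ[ℂ] DualNumber (Module.End ℂ (UniversalAffine M κ)) :=
  ModeAlgebra.lift (fun g => match g with
    | .even x m => TrivSqZeroExt.inl (even x m) + TrivSqZeroExt.inr (vertexOperator (δ x) m)
    | .odd _ _ => 0) (by
      intro a b h
      induction h with
      | even_add x y m =>
        ext1 <;> simp [even_add, vertexOperator_add]
      | even_smul c x m =>
        ext1 <;> simp [even_smul, vertexOperator_smul]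
      | odd_add x y m => simp
      | odd_smul c x m => simp
      | even_even x y m l =>
        rw [map_sub, map_mul, map_mul, map_add, AlgHom.commutes]
        simp only [FreeAlgebra.lift_ι_apply]
        ext1
        · have h := even_even (M := M) (κ := κ) x y m l
          rw [← Algebra.algebraMap_eq_smul_one] at h
          simpa [TrivSqZeroExt.algebraMap_eq_inl'] using h
        · have h1 := even_vertexOperator (fun j hj => hprim x y j hj) m l
          have h2 := even_vertexOperator (fun j hj => hprim y x j hj) l m
          have h3 := vertexOperator_add (δ ⁅x, y⁆) (even y 0 (δ x))
          rw [← hcoc, sub_add_cancel, hcoc] at h3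
          have h4 := congrFun h3 (m + l)
          rw [Pi.add_apply, ← h1, add_comm m l, ← h2] at h4
          simp [TrivSqZeroExt.algebraMap_eq_inl']
          rw [add_comm m l]
          linear_combination (norm := module) h4
      | even_odd x y m l => simp
      | odd_odd x y m l => simp)

section Extension

variable {δ : L →ₗ[ℂ] UniversalAffine M κ}
  (hprim : ∀ x y (j : ℤ), 1 ≤ j → even x j (δ y) = 0)
  (hcoc : ∀ x y, even x 0 (δ y) - even y 0 (δ x) = δ ⁅x, y⁆)

theorem cocycleHom_gen_even (x : L) (m : ℤ) :
    cocycleHom N κ δ hprim hcoc (ModeAlgebra.gen κ (.even x m)) =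
      TrivSqZeroExt.inl (even x m) + TrivSqZeroExt.inr (vertexOperator (δ x) m) := by
  rw [cocycleHom, ModeAlgebra.lift_gen]

theorem cocycleHom_gen_odd (y : N) (m : ℤ) :
    cocycleHom N κ δ hprim hcoc (ModeAlgebra.gen κ (.odd y m)) = 0 := by
  rw [cocycleHom, ModeAlgebra.lift_gen]

/-- The first component is the action through `φ`; this is how `φ` enters the Leibniz rule for the
second one. -/
theorem cocycleHom_fst [Subsingleton N] (φ : N →ₗ⁅ℂ, L⁆ M) (a : ModeAlgebra N κ) :
    (cocycleHom N κ δ hprim hcoc a).fst = Algebra.lsmul ℂ ℂ _ (ModeAlgebra.map κ φ a) := by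
  have h : (TrivSqZeroExt.fstHom ℂ (Module.End ℂ (UniversalAffine M κ))
      (Module.End ℂ (UniversalAffine M κ))).comp (cocycleHom N κ δ hprim hcoc) =
      (Algebra.lsmul ℂ ℂ (UniversalAffine M κ)).comp (ModeAlgebra.map κ φ) := by
    apply ModeAlgebra.hom_ext
    intro g
    rcases g with ⟨x, m⟩ | ⟨y, m⟩
    · simp only [AlgHom.comp_apply, cocycleHom_gen_even, ModeAlgebra.map_gen]
      simp [even]
    · simp only [AlgHom.comp_apply, cocycleHom_gen_odd, ModeAlgebra.map_gen]
      rw [Subsingleton.elim y 0, map_zero φ]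
      exact (map_zero _).trans (map_zero (oddHom M κ m)).symm
  exact DFunLike.congr_fun h a

/-- Elements both of whose components kill the vacuum form a left ideal, since `(ra).snd` is a
combination of `a.fst` and `a.snd` with operators on the left. It contains the generators because
nonnegative modes of any state kill `|0⟩`. -/
theorem cocycleHom_vac {a : ModeAlgebra N κ} (ha : a ∈ ModeAlgebra.annihilationIdeal N κ) :
    (cocycleHom N κ δ hprim hcoc a).fst (vac M κ) = 0 ∧
      (cocycleHom N κ δ hprim hcoc a).snd (vac M κ) = 0 := by
  induction ha using Submodule.span_induction with
  | mem a h =>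
    obtain ⟨g, hg, rfl⟩ := h
    rcases g with ⟨x, m⟩ | ⟨y, m⟩
    · change 0 ≤ m at hg
      rw [cocycleHom_gen_even]
      constructor
      · simpa [current] using current_vac (κ := κ) (.inl x : L ⊕ M) hg
      · simpa using (isVertexOperator_vertexOperator (δ x)).vac_nonneg m hg
    · rw [cocycleHom_gen_odd]
      simp
  | zero => simp
  | add a b _ _ h1 h2 => simp [h1, h2]
  | smul r a _ h => simp [h]

variable (N) in
/-- The extension of a cocycle to the universal affine vertex algebra. -/
def cocycleExtension : UniversalAffine N κ →ₗ[ℂ] UniversalAffine M κ :=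
  descend (LinearMap.applyₗ (vac M κ) ∘ₗ
    (TrivSqZeroExt.sndHom _ (Module.End ℂ (UniversalAffine M κ))).restrictScalars ℂ ∘ₗ
    (cocycleHom N κ δ hprim hcoc).toLinearMap) fun _ ha => (cocycleHom_vac hprim hcoc ha).2

theorem cocycleExtension_toVac (a : ModeAlgebra N κ) :
    cocycleExtension N hprim hcoc (toVac κ a) =
      (cocycleHom N κ δ hprim hcoc a).snd (vac M κ) := rfl

theorem cocycleExtension_vac : cocycleExtension N hprim hcoc (vac N κ) = 0 := by
  rw [vac, cocycleExtension_toVac, map_one, TrivSqZeroExt.snd_one, LinearMap.zero_apply]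

/-- The product rule for the `ε`-part in the dual numbers. There is no sign because `x` is even. -/
theorem cocycleExtension_even [Subsingleton N] (φ : N →ₗ⁅ℂ, L⁆ M) (x : L) (m : ℤ)
    (v : UniversalAffine N κ) : cocycleExtension N hprim hcoc (even x m v) =
      even x m (cocycleExtension N hprim hcoc v) + vertexOperator (δ x) m (map φ v) := by
  obtain ⟨a, rfl⟩ := toVac_surjective v
  rw [even_toVac, cocycleExtension_toVac, cocycleExtension_toVac, map_mul, TrivSqZeroExt.snd_mul,
    cocycleHom_gen_even, cocycleHom_fst hprim hcoc φ, map_toVac, toVac_eq_smul]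
  simp

theorem cocycleExtension_generator [Subsingleton N] (φ : N →ₗ⁅ℂ, L⁆ M) (x : L) :
    cocycleExtension N hprim hcoc (even x (-1) (vac N κ)) = δ x := by
  rw [cocycleExtension_even hprim hcoc φ, cocycleExtension_vac, map_vac, map_zero, zero_add,
    vertexOperator_vac_neg_one]

section Parity

variable (hodd : ∀ x, δ x ∈ stateSubmodule M κ 1)
include hodd

theorem parity_cocycleExtension [Subsingleton N] (φ : N →ₗ⁅ℂ, L⁆ M) (v : UniversalAffine N κ) :
    parity (cocycleExtension N hprim hcoc v) = - cocycleExtension N hprim hcoc v := by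
  refine DFunLike.congr_fun (ext_even (f := parity ∘ₗ cocycleExtension N hprim hcoc)
    (g := -cocycleExtension N hprim hcoc) ?_ fun x m v h => ?_) v
  · simp [cocycleExtension_vac]
  · have h1 := parity_current (κ := κ) (.inl x : L ⊕ M) m (cocycleExtension N hprim hcoc v)
    have h2 := (isStateField_vertexOperator_odd (hodd x)).parity_apply m (map φ v)
    simp only [current, currentParity, LinearMap.comp_apply, LinearMap.neg_apply, pow_zero,
      one_smul, pow_one] at h h1 h2 ⊢
    rw [cocycleExtension_even hprim hcoc φ, map_add, h1, h2, h, parity_map]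
    simp only [map_neg]
    module

theorem cocycleExtension_translation [Subsingleton N] (φ : N →ₗ⁅ℂ, L⁆ M)
    (v : UniversalAffine N κ) : cocycleExtension N hprim hcoc (translation v) =
      translation (cocycleExtension N hprim hcoc v) := by
  refine DFunLike.congr_fun (ext_even (f := cocycleExtension N hprim hcoc ∘ₗ translation)
    (g := translation ∘ₗ cocycleExtension N hprim hcoc) ?_ fun x m v h => ?_) v
  · simp [cocycleExtension_vac, translation_vac]
  · have h1 := translation_current (κ := κ) (.inl x : L ⊕ M) m (cocycleExtension N hprim hcoc v)
    have h2 := (isStateField_vertexOperator_odd (hodd x)).translation_apply m (map φ v)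
    have h3 := translation_current (κ := κ) (.inl x : L ⊕ N) m v
    simp only [current, LinearMap.comp_apply] at h h1 h2 h3 ⊢
    rw [h3, map_add, map_smul]
    simp only [cocycleExtension_even hprim hcoc φ, map_add, h1, h2, h, map_translation]
    module

/-- The extension of a cocycle is a derivation of all products. -/
theorem cocycleExtension_vertexOperator [Subsingleton N] (φ : N →ₗ⁅ℂ, L⁆ M)
    (u : UniversalAffine N κ) (m : ℤ) (v : UniversalAffine N κ) :
    cocycleExtension N hprim hcoc (vertexOperator u m v) =
      vertexOperator (cocycleExtension N hprim hcoc u) m (map φ v) +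
      vertexOperator (map φ u) m (cocycleExtension N hprim hcoc v) := by
  set d := cocycleExtension N hprim hcoc with hd
  have hu := isVertexOperator_vertexOperator u
  have hi := isVertexOperator_vertexOperator (map φ u)
  have hdu := isVertexOperator_vertexOperator (d u)
  refine sub_eq_zero.1 ((DFunLike.congr_fun (congrFun (eq_zero_of_isLocal_even (N := N)
    (T := fun m => d ∘ₗ vertexOperator u m - (vertexOperator (d u) m ∘ₗ map φ +
      vertexOperator (map φ u) m ∘ₗ d)) (fun m => ?_) even fun x => ?_) m) v :))
  · simp [map_vertexOperator_vac (cocycleExtension_translation hprim hcoc hodd φ), map_vac,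
      hd, cocycleExtension_vac]
  · have h1 := (isStateField_vertexOperator_even (map_mem_stateSubmodule φ u)).isLocal 1
      (vertexOperator (δ x)) fun a => by
        simpa using (isStateField_vertexOperator_odd (hodd x)).isLocal_current a
    convert (((hu.isLocal_even x).map (LinearMap.compRight ℂ d)).sub
      ((hdu.isLocal_even x).map (LinearMap.lcomp ℂ _ (map φ)))).sub
      (((hi.isLocal_even x).map (LinearMap.lcomp ℂ _ d)).add
      (h1.map (LinearMap.lcomp ℂ _ (map φ)))) using 1
    funext m l
    ext v
    simp [map_even, signedBracket, cocycleExtension_even hprim hcoc φ, map_vertexOperator, hd]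
    abel

theorem cocycleExtension_nProd [Subsingleton N] (φ : N →ₗ⁅ℂ, L⁆ M)
    (u : UniversalAffine N κ) (m : ℤ) (v : UniversalAffine N κ) :
    cocycleExtension N hprim hcoc (nProd m u v) =
      nProd m (cocycleExtension N hprim hcoc u) (map φ v) +
      nProd m (map φ u) (cocycleExtension N hprim hcoc v) :=
  cocycleExtension_vertexOperator hprim hcoc hodd φ u m v

end Parity

end Extension

end UniversalAffine

end Derivations

end

end RectW
namespace RectW

noncomputable section

/-! ### The Lie algebra `𝔟` -/

namespace Idx

variable {n : ℕ}

theorem hi_injective : Function.Injective (hi (n := n)) := by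
  intro i j h
  have h' : (hi i).1 = (hi j).1 := congrArg Subtype.val h
  change (if 0 < i.1 then (n : ℤ) + i.1 else n + i.1 + 1) =
    (if 0 < j.1 then (n : ℤ) + j.1 else n + j.1 + 1) at h'
  have := i.ne_zero
  have := j.ne_zero
  apply Subtype.ext
  split_ifs at h' <;> omega

theorem neg_lo (i : Idx n) : -(lo i) = hi (-i) := by
  apply Subtype.ext
  change -(if 0 < i.1 then -(n : ℤ) + i.1 - 1 else -n + i.1) =
    (if 0 < -i.1 then (n : ℤ) + -i.1 else n + -i.1 + 1)
  have := i.ne_zero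
  split_ifs <;> omega

theorem neg_hi (i : Idx n) : -(hi i) = lo (-i) := by
  rw [← neg_inj, neg_neg, neg_lo, neg_neg]

theorem hi_inj {i j : Idx n} : hi i = hi j ↔ i = j := hi_injective.eq_iff

theorem lo_inj {i j : Idx n} : lo i = lo j ↔ i = j := by
  rw [← neg_inj, neg_lo, neg_lo, hi_inj, neg_inj]

theorem hi_ne_lo (i j : Idx n) : hi i ≠ lo j := fun h => by
  have := congrArg Idx.p h
  rw [p_hi, p_lo] at this
  omega

theorem lo_ne_hi (i j : Idx n) : lo i ≠ hi j := (hi_ne_lo j i).symm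

theorem exists_hi_or_lo (u : Idx (2 * n)) : (∃ i : Idx n, u = hi i) ∨ ∃ i : Idx n, u = lo i := by
  have key : ∀ u : Idx (2 * n), 0 < u.1 → ∃ i : Idx n, u = hi i := by
    intro u hu
    have h1 := u.bounds
    push_cast at h1
    by_cases h : (n : ℤ) < u.1
    · refine ⟨of (u.1 - n) (by omega) (by omega) (by omega), Subtype.ext ?_⟩
      change u.1 = if 0 < u.1 - n then (n : ℤ) + (u.1 - n) else n + (u.1 - n) + 1
      split_ifs <;> omega
    · refine ⟨of (u.1 - n - 1) (by omega) (by omega) (by omega), Subtype.ext ?_⟩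
      change u.1 = if 0 < u.1 - n - 1 then (n : ℤ) + (u.1 - n - 1) else n + (u.1 - n - 1) + 1
      split_ifs <;> omega
  rcases lt_or_gt_of_ne u.ne_zero with h | h
  · right
    obtain ⟨i, hi⟩ := key (-u) (by change 0 < -u.1; omega)
    exact ⟨-i, by rw [← neg_hi, ← hi, neg_neg]⟩
  · exact .inl (key u h)

theorem card : Fintype.card (Idx n) = 2 * n := by
  change Fintype.card {i : ℤ // i ∈ (Finset.Icc (-(n : ℤ)) n).erase 0} = 2 * n
  rw [Fintype.card_coe, Finset.card_erase_of_mem (by simp), Int.card_Icc]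
  omega

theorem eq_neg_comm {i j : Idx n} : i = -j ↔ j = -i := by
  rw [← neg_eq_iff_eq_neg, eq_comm]

end Idx

/-! ### Brackets and the form on the spanning elements of `𝔟` -/

section Generators

variable {n : ℕ}

open Matrix in
theorem Fhi_val (i j : Idx n) :
    (Fhi n i j).1 = single i.hi j.hi 1 - single (-j).lo (-i).lo 1 := by
  simp [Fhi, F, sgn, Idx.p_hi, Idx.neg_hi]

open Matrix in
theorem Flo_val (i j : Idx n) :
    (Flo n i j).1 = single i.lo j.lo 1 - single (-j).hi (-i).hi 1 := by
  simp [Flo, F, sgn, Idx.p_lo, Idx.neg_lo]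

open Matrix in
theorem Fhl_val (i j : Idx n) :
    (Fhl n i j).1 = single i.hi j.lo 1 + single (-j).hi (-i).lo 1 := by
  simp [Fhl, F, sgn, Idx.p_lo, Idx.p_hi, Idx.neg_hi, Idx.neg_lo]

/-- By `F_{-j,-i} = -(-1)^{p(i)+p(j)} F_{i,j}` the negative diagonal block is redundant, so later
checks involve only `Fhi` and `Fhl`. -/
theorem Flo_eq (i j : Idx n) : Flo n i j = - Fhi n (-j) (-i) := by
  apply Subtype.ext
  rw [NegMemClass.coe_neg, Flo_val, Fhi_val, neg_neg, neg_neg, neg_sub]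

theorem Fhl_symm (i j : Idx n) : Fhl n (-j) (-i) = Fhl n i j := by
  apply Subtype.ext
  rw [Fhl_val, Fhl_val, neg_neg, neg_neg, add_comm]

theorem psi_symm (i j : Idx n) : psi n (-j) (-i) = psi n i j :=
  Subtype.ext (Fhl_symm i j)

theorem single_mul_single_ite {I : Type*} [Fintype I] [DecidableEq I] (a b c d : I) :
    (Matrix.single a b 1 * Matrix.single c d 1 : Matrix I I ℂ) =
      if b = c then Matrix.single a d 1 else 0 := by
  split_ifs with h
  · subst h; simp
  · rw [Matrix.single_mul_single_of_ne _ _ _ _ h]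

theorem lie_Fhi_Fhi (a b i j : Idx n) : ⁅Fhi n a b, Fhi n i j⁆ =
    (if b = i then Fhi n a j else 0) - if j = a then Fhi n i b else 0 := by
  apply Subtype.ext
  have e : (⁅Fhi n a b, Fhi n i j⁆ : RectW.b n).1 =
    (Fhi n a b).1 * (Fhi n i j).1 - (Fhi n i j).1 * (Fhi n a b).1 := rfl
  rw [e, AddSubgroupClass.coe_sub, apply_ite Subtype.val, apply_ite Subtype.val]
  simp only [Fhi_val, mul_sub, sub_mul, single_mul_single_ite, Idx.hi_inj, Idx.lo_inj,
    Idx.hi_ne_lo, Idx.lo_ne_hi, if_false, neg_inj, ZeroMemClass.coe_zero]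
  simp only [eq_comm (a := a) (b := j), eq_comm (a := i) (b := b)]
  split_ifs <;> abel

theorem lie_Fhi_Fhl (a b i j : Idx n) : ⁅Fhi n a b, Fhl n i j⁆ =
    (if b = i then Fhl n a j else 0) + if b = -j then Fhl n i (-a) else 0 := by
  apply Subtype.ext
  have e : (⁅Fhi n a b, Fhl n i j⁆ : RectW.b n).1 =
    (Fhi n a b).1 * (Fhl n i j).1 - (Fhl n i j).1 * (Fhi n a b).1 := rfl
  rw [e, AddMemClass.coe_add, apply_ite Subtype.val, apply_ite Subtype.val]
  simp only [Fhi_val, Fhl_val, mul_sub, sub_mul, mul_add, add_mul, single_mul_single_ite,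
    Idx.hi_inj, Idx.lo_inj, Idx.lo_ne_hi, if_false, neg_inj, ZeroMemClass.coe_zero, neg_neg]
  simp only [eq_comm (a := i) (b := b), Idx.eq_neg_comm (i := j) (j := b)]
  split_ifs <;> abel

theorem lie_Fhl_Fhl (a b i j : Idx n) : ⁅Fhl n a b, Fhl n i j⁆ = 0 := by
  apply Subtype.ext
  have e : (⁅Fhl n a b, Fhl n i j⁆ : RectW.b n).1 =
    (Fhl n a b).1 * (Fhl n i j).1 - (Fhl n i j).1 * (Fhl n a b).1 := rfl
  rw [e]
  simp [Fhl_val, mul_add, add_mul, Idx.lo_ne_hi]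

theorem lie_Fhi_psi (a b i j : Idx n) : ⁅Fhi n a b, psi n i j⁆ =
    (if b = i then psi n a j else 0) + if b = -j then psi n i (-a) else 0 := by
  apply Subtype.ext
  refine (lie_Fhi_Fhl a b i j).trans ?_
  split_ifs <;> rfl

theorem lie_Fhl_psi (a b i j : Idx n) : ⁅Fhl n a b, psi n i j⁆ = 0 :=
  Subtype.ext (lie_Fhl_Fhl a b i j)

theorem trace_single_ite {I : Type*} [Fintype I] [DecidableEq I] (a b : I) :
    (Matrix.single a b (1 : ℂ)).trace = if a = b then 1 else 0 := by
  split_ifs with h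
  · subst h; simp
  · rw [Matrix.trace_single_eq_of_ne _ _ _ h]

theorem posTrace_Fhi (i j : Idx n) : posTrace n (Fhi n i j) = if i = j then 1 else 0 := by
  change ∑ u : Idx n, (Fhi n i j).1 u.hi u.hi = _
  simp only [Fhi_val, Matrix.sub_apply, Matrix.single_apply, Idx.hi_inj, Idx.lo_ne_hi, false_and,
    if_false, sub_zero]
  rw [Finset.sum_eq_single i]
  · simp [eq_comm]
  · intro u _ hu
    simp [hu.symm]
  · simp

theorem posTrace_Fhl (i j : Idx n) : posTrace n (Fhl n i j) = 0 := by
  change ∑ u : Idx n, (Fhl n i j).1 u.hi u.hi = _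
  simp [Fhl_val, Idx.lo_ne_hi]

/-- The two diagonal blocks contribute equally to the trace, which absorbs the factor `1/2` in
`α/2`. -/
theorem kappa_Fhi_Fhi (k : ℂ) (a b i j : Idx n) : kappa n k (Fhi n a b) (Fhi n i j) =
    (if b = i then if j = a then alpha n k else 0 else 0) +
      if a = b then if i = j then 1 else 0 else 0 := by
  change alpha n k / 2 * ((Fhi n a b).1 * (Fhi n i j).1).trace +
    posTrace n (Fhi n a b) * posTrace n (Fhi n i j) = _
  rw [posTrace_Fhi, posTrace_Fhi, Fhi_val, Fhi_val]
  simp only [mul_sub, sub_mul, single_mul_single_ite, Idx.hi_inj, Idx.lo_inj,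
    Idx.hi_ne_lo, Idx.lo_ne_hi, if_false, neg_inj, apply_ite Matrix.trace, Matrix.trace_sub,
    trace_single_ite, Matrix.trace_zero]
  simp only [eq_comm (a := a) (b := j)]
  split_ifs <;> ring

theorem kappa_Fhl_Fhi (k : ℂ) (a b i j : Idx n) : kappa n k (Fhl n a b) (Fhi n i j) = 0 := by
  change alpha n k / 2 * ((Fhl n a b).1 * (Fhi n i j).1).trace +
    posTrace n (Fhl n a b) * posTrace n (Fhi n i j) = _
  rw [posTrace_Fhl, Fhi_val, Fhl_val]
  simp only [mul_sub, add_mul, single_mul_single_ite, Idx.lo_inj, Idx.lo_ne_hi, if_false,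
    apply_ite Matrix.trace, Matrix.trace_sub, Matrix.trace_add, trace_single_ite,
    Matrix.trace_zero, Idx.hi_ne_lo]
  simp

/-- The symmetry `Fhl n (-j) (-i) = Fhl n i j` makes the full double sum count every off-diagonal
element twice; on `j = -i` the matrix entry itself is `2`. Hence the factor `1/2`. -/
theorem sum_Fhi_Fhl (x : b n) : x = ∑ i, ∑ j, (x.1 i.hi j.hi) • Fhi n i j +
    ∑ i, ∑ j, (x.1 i.hi j.lo / 2) • Fhl n i j := by
  have hsym := x.2.1
  apply Subtype.ext
  ext u v
  have e : (∑ i, ∑ j, (x.1 i.hi j.hi) • Fhi n i j + ∑ i, ∑ j, (x.1 i.hi j.lo / 2) • Fhl n i j :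
      b n).1 u v = ∑ i, ∑ j, (x.1 i.hi j.hi) * (Fhi n i j).1 u v +
      ∑ i, ∑ j, (x.1 i.hi j.lo / 2) * (Fhl n i j).1 u v := by
    simp [Matrix.sum_apply]
  rw [e]
  have key : ∀ (f : Idx n → Idx n → ℂ) (a c : Idx n),
      ∑ i, ∑ j, f i j * (if i = a ∧ j = c then 1 else 0) = f a c := by
    intro f a c
    rw [Finset.sum_eq_single a, Finset.sum_eq_single c]
    · simp
    · intro j _ hj; simp [hj]
    · simp
    · intro i _ hi; simp [hi]
    · simp
  have cond : ∀ i j a c : Idx n, (-j = a ∧ -i = c) ↔ (i = -c ∧ j = -a) := fun i j a c => by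
    rw [neg_eq_iff_eq_neg, neg_eq_iff_eq_neg, and_comm]
  rcases Idx.exists_hi_or_lo u with ⟨a, rfl⟩ | ⟨a, rfl⟩ <;>
    rcases Idx.exists_hi_or_lo v with ⟨c, rfl⟩ | ⟨c, rfl⟩ <;>
    simp only [Fhi_val, Fhl_val, Matrix.sub_apply, Matrix.add_apply, Matrix.single_apply,
      Idx.hi_inj, Idx.lo_inj, Idx.hi_ne_lo, Idx.lo_ne_hi, false_and, and_false, if_false,
      sub_zero, zero_sub, add_zero, mul_zero, Finset.sum_const_zero, zero_add, cond, mul_neg,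
      Finset.sum_neg_distrib, mul_add, Finset.sum_add_distrib, key]
  · have h := hsym a.hi c.lo
    simp only [Idx.neg_hi, Idx.neg_lo, sgn, Idx.p_hi, Idx.p_lo] at h
    rw [h]
    ring
  · exact x.2.2 _ _ (Idx.p_lo a) (Idx.p_hi c)
  · have h := hsym (-c).hi (-a).hi
    simp only [Idx.neg_hi, sgn, Idx.p_hi, neg_neg] at h
    rw [h]
    ring

theorem b_induction {P : b n → Prop} (add : ∀ x y, P x → P y → P (x + y))
    (smul : ∀ (c : ℂ) x, P x → P (c • x)) (hFhi : ∀ i j, P (Fhi n i j))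
    (hFhl : ∀ i j, P (Fhl n i j)) (h0 : P 0) (x : b n) : P x := by
  rw [sum_Fhi_Fhl x]
  exact add _ _
    (Finset.sum_induction _ P add h0 fun i _ => Finset.sum_induction _ P add h0
      fun j _ => smul _ _ (hFhi i j))
    (Finset.sum_induction _ P add h0 fun i _ => Finset.sum_induction _ P add h0
      fun j _ => smul _ _ (hFhl i j))

end Generators

end

end RectW
namespace RectW

noncomputable section

/-! ### The cocycle of `𝔟` -/

section GenericActions

universe u v w

variable {L : Type u} {M : Type v} [LieRing L] [LieAlgebra ℂ L]
  [AddCommGroup M] [Module ℂ M] [LieRingModule L M]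

namespace UniversalAffine

variable {κ : LinearMap.BilinForm ℂ L}

theorem odd_vac (y : M) {m : ℤ} (hm : 0 ≤ m) : odd (L := L) y m (vac M κ) = 0 :=
  current_vac (.inr y : L ⊕ M) hm

theorem even_vac (x : L) {m : ℤ} (hm : 0 ≤ m) : even x m (vac M κ) = 0 :=
  current_vac (.inl x : L ⊕ M) hm

theorem even_odd_vac (x : L) (y : M) {m : ℤ} (hm : 0 ≤ m) (l : ℤ) :
    even (κ := κ) x m (odd y l (vac M κ)) = odd ⁅x, y⁆ (m + l) (vac M κ) := by
  have h := DFunLike.congr_fun (even_odd (κ := κ) x y m l) (vac M κ)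
  rw [LinearMap.sub_apply, Module.End.mul_apply, Module.End.mul_apply, even_vac x hm, map_zero,
    sub_zero] at h
  exact h

theorem even_even_apply (x y : L) (m l : ℤ) (v : UniversalAffine M κ) :
    even x m (even y l v) = even y l (even x m v) + even ⁅x, y⁆ (m + l) v +
      (if m + l = 0 then (m : ℂ) * κ x y else 0) • v := by
  have h := DFunLike.congr_fun (even_even (M := M) (κ := κ) x y m l) v
  simp only [LinearMap.sub_apply, Module.End.mul_apply, LinearMap.add_apply, LinearMap.smul_apply,
    Module.End.one_apply, sub_eq_iff_eq_add] at h
  rw [h]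
  abel

/-- The action of `x t⁰` on a quadratic state. -/
theorem even_zero_even_odd (x y : L) (z : M) :
    even (κ := κ) x 0 (even y (-1) (odd z (-1) (vac M κ))) =
      even ⁅x, y⁆ (-1) (odd z (-1) (vac M κ)) + even y (-1) (odd ⁅x, z⁆ (-1) (vac M κ)) := by
  rw [even_even_apply, even_odd_vac x z le_rfl]
  simp [add_comm]

/-- The action of `x t` on a quadratic state. -/
theorem even_one_even_odd (x y : L) (z : M) :
    even (κ := κ) x 1 (even y (-1) (odd z (-1) (vac M κ))) =
      odd ⁅⁅x, y⁆, z⁆ (-1) (vac M κ) + κ x y • odd z (-1) (vac M κ) := by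
  rw [even_even_apply, even_odd_vac x z zero_le_one, odd_vac _ (by norm_num),
    even_odd_vac _ z (by norm_num)]
  simp

/-- The action of `x tʲ`, `j ≥ 2`, on a quadratic state. -/
theorem even_even_odd_of_two_le (x y : L) (z : M) {j : ℤ} (hj : 2 ≤ j) :
    even (κ := κ) x j (even y (-1) (odd z (-1) (vac M κ))) = 0 := by
  rw [even_even_apply, even_odd_vac x z (by omega), odd_vac _ (by omega),
    even_odd_vac _ z (by omega), odd_vac _ (by omega), if_neg (by omega)]
  simp

theorem odd_even_vac (y : M) (x : L) (m l : ℤ) (v : UniversalAffine M κ) :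
    odd y m (even x l v) = even x l (odd y m v) - odd ⁅x, y⁆ (l + m) v := by
  have h := DFunLike.congr_fun (even_odd (κ := κ) x y l m) v
  simp only [LinearMap.sub_apply, Module.End.mul_apply] at h
  rw [← h]
  abel

theorem odd_zero_apply (m : ℤ) (v : UniversalAffine M κ) : odd (0 : M) m v = 0 :=
  DFunLike.congr_fun (map_zero (oddHom M κ m)) v

theorem even_zero_apply (m : ℤ) (v : UniversalAffine M κ) : even (0 : L) m v = 0 :=
  DFunLike.congr_fun (map_zero (evenHom M κ m)) v

theorem odd_add_apply (y z : M) (m : ℤ) (v : UniversalAffine M κ) :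
    odd (y + z) m v = odd y m v + odd z m v :=
  DFunLike.congr_fun (odd_add y z m) v

theorem odd_sub_apply (y z : M) (m : ℤ) (v : UniversalAffine M κ) :
    odd (y - z) m v = odd y m v - odd z m v :=
  DFunLike.congr_fun (map_sub (oddHom M κ m) y z) v

theorem odd_neg_apply (y : M) (m : ℤ) (v : UniversalAffine M κ) :
    odd (-y) m v = - odd y m v :=
  DFunLike.congr_fun (map_neg (oddHom M κ m) y) v

theorem even_add_apply (x y : L) (m : ℤ) (v : UniversalAffine M κ) :
    even (x + y) m v = even x m v + even y m v :=
  DFunLike.congr_fun (even_add x y m) v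

theorem even_sub_apply (x y : L) (m : ℤ) (v : UniversalAffine M κ) :
    even (x - y) m v = even x m v - even y m v :=
  DFunLike.congr_fun (map_sub (evenHom M κ m) x y) v

theorem even_neg_apply (x : L) (m : ℤ) (v : UniversalAffine M κ) :
    even (-x) m v = - even x m v :=
  DFunLike.congr_fun (map_neg (evenHom M κ m) x) v

theorem even_smul_apply (c : ℂ) (x : L) (m : ℤ) (v : UniversalAffine M κ) :
    even (c • x) m v = c • even x m v :=
  DFunLike.congr_fun (even_smul c x m) v

theorem odd_ite_apply (p : Prop) [Decidable p] (y : M) (m : ℤ) (v : UniversalAffine M κ) :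
    odd (if p then y else 0) m v = if p then odd y m v else 0 := by
  split_ifs
  · rfl
  · exact odd_zero_apply m v

theorem even_ite_apply (p : Prop) [Decidable p] (x : L) (m : ℤ) (v : UniversalAffine M κ) :
    even (if p then x else 0) m v = if p then even x m v else 0 := by
  split_ifs
  · rfl
  · exact even_zero_apply m v

theorem even_lie_of_eq_ite {x y z w : L} {p q : Prop} [Decidable p] [Decidable q]
    (h : ⁅y, x⁆ = (if p then z else 0) + if q then w else 0) (m : ℤ) (v : UniversalAffine M κ) :
    even ⁅x, y⁆ m v = - (if p then even z m v else 0) - if q then even w m v else 0 := by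
  rw [← lie_skew, h, even_neg_apply, even_add_apply, even_ite_apply, even_ite_apply, neg_add,
    sub_eq_add_neg]

theorem smul_cocycle {δ : L →ₗ[ℂ] UniversalAffine M κ} (c : ℂ) {x y : L}
    (h : even x 0 (δ y) - even y 0 (δ x) = δ ⁅x, y⁆) :
    even x 0 (δ (c • y)) - even (c • y) 0 (δ x) = δ ⁅x, c • y⁆ := by
  rw [lie_smul, map_smul, map_smul, map_smul, ← h, even_smul_apply, smul_sub]

theorem add_cocycle {δ : L →ₗ[ℂ] UniversalAffine M κ} {x y z : L}
    (hy : even x 0 (δ y) - even y 0 (δ x) = δ ⁅x, y⁆)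
    (hz : even x 0 (δ z) - even z 0 (δ x) = δ ⁅x, z⁆) :
    even x 0 (δ (y + z)) - even (y + z) 0 (δ x) = δ ⁅x, y + z⁆ := by
  rw [lie_add, map_add, map_add, map_add, ← hy, ← hz, even_add_apply]
  abel

theorem zero_cocycle (δ : L →ₗ[ℂ] UniversalAffine M κ) (x : L) :
    even x 0 (δ 0) - even (0 : L) 0 (δ x) = δ ⁅x, (0 : L)⁆ := by
  rw [lie_zero, map_zero, map_zero, even_zero_apply, sub_zero]

theorem skew_cocycle {δ : L →ₗ[ℂ] UniversalAffine M κ} {x y : L}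
    (h : even x 0 (δ y) - even y 0 (δ x) = δ ⁅x, y⁆) :
    even y 0 (δ x) - even x 0 (δ y) = δ ⁅y, x⁆ := by
  rw [← lie_skew, map_neg, ← h]
  abel

theorem nProd_odd (y : M) (m : ℤ) (v : UniversalAffine M κ) :
    nProd m (odd y (-1) (vac M κ)) v = odd y m v :=
  nProd_current (.inr y : L ⊕ M) m v

theorem translation_even_vac (x : L) :
    translation (even x (-1) (vac M κ)) = even x (-2) (vac M κ) := by
  have h := translation_current (κ := κ) (.inl x : L ⊕ M) (-1) (vac M κ)
  rw [translation_vac, map_zero, zero_add] at h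
  exact h.trans (by norm_num [current])

theorem translation_odd_vac (y : M) :
    translation (odd y (-1) (vac M κ)) = odd (L := L) y (-2) (vac M κ) := by
  have h := translation_current (κ := κ) (.inr y : L ⊕ M) (-1) (vac M κ)
  rw [translation_vac, map_zero, zero_add] at h
  exact h.trans (by norm_num [current])

variable {N : Type w} [AddCommGroup N] [Module ℂ N] [LieRingModule L N]

/-- A map that commutes with `∂` is determined by its value at the vacuum and its commutators with
the operators `x t⁻¹`. -/
theorem linearMap_ext_of_even [Subsingleton N] {d d' : UniversalAffine N κ →ₗ[ℂ] UniversalAffine M κ}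
    (f : L → UniversalAffine N κ → UniversalAffine M κ)
    (hv : d (vac N κ) = d' (vac N κ)) (ht : ∀ v, d (translation v) = translation (d v))
    (ht' : ∀ v, d' (translation v) = translation (d' v))
    (hd : ∀ x v, d (even x (-1) v) = f x v + even x (-1) (d v))
    (hd' : ∀ x v, d' (even x (-1) v) = f x v + even x (-1) (d' v)) : d = d' := by
  refine LinearMap.eqLocus_eq_top.1 (submodule_eq_top_of_translation hv (fun v h => ?_)
    fun a v h => ?_)
  · rw [LinearMap.mem_eqLocus] at h ⊢
    rw [ht, ht', h]
  · rcases a with x | y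
    · rw [LinearMap.mem_eqLocus] at h ⊢
      rw [current, hd, hd', h]
    · rw [current_inr_of_subsingleton]
      exact Submodule.zero_mem _

/-- A derivation of the `(-1)`-product with given values at the generators. -/
theorem derivation_even {d : UniversalAffine N κ →ₗ[ℂ] UniversalAffine M κ} (φ : N →ₗ⁅ℂ, L⁆ M)
    (hd : ∀ u v, d (nProd (-1) u v) = nProd (-1) (d u) (map φ v) + nProd (-1) (map φ u) (d v))
    (x : L) (v : UniversalAffine N κ) : d (even x (-1) v) =
      nProd (-1) (d (even x (-1) (vac N κ))) (map φ v) + even x (-1) (d v) := by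
  have h1 := nProd_current (κ := κ) (.inl x : L ⊕ N) (-1) v
  have h2 := nProd_current (κ := κ) (.inl x : L ⊕ M) (-1) (d v)
  simp only [current] at h1 h2
  rw [← h1, hd, map_even, map_vac, h2]

end UniversalAffine

end GenericActions

theorem sum_sum_ite {V : Type*} [AddCommGroup V] [Module ℂ V] {I : Type*} [Fintype I]
    [DecidableEq I] (f : I → I → V) (a c : I) :
    ∑ i, ∑ j, (if a = i ∧ c = j then (1 : ℂ) else 0) • f i j = f a c := by
  rw [Finset.sum_eq_single a, Finset.sum_eq_single c]
  · simp
  · intro j _ hj; simp [hj.symm]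
  · simp
  · intro i _ hi; simp [hi.symm]
  · simp

/-! ### The cocycle of `𝔟`, its primarity and the cocycle identity -/

section Cocycle

open UniversalAffine

attribute [local irreducible] UniversalAffine.even UniversalAffine.odd UniversalAffine.vac
  UniversalAffine.translation UniversalAffine.parity UniversalAffine.nProd Fhi Fhl Flo psi kappa
  UniversalAffine b

variable (n : ℕ) (k : ℂ)

/-- The state `ψ_{i,j} t⁻ˢ|0⟩`. -/
def psiState (s : ℤ) (i j : Idx n) : Va n k := odd (psi n i j) s (vac _ _)

/-- The quadratic part of the differential of `F_{n+i,-n+j}`. -/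
def quadState (i j : Idx n) : Va n k :=
  ∑ u, even (Fhi n i u) (-1) (psiState n k (-1) u j)

/-- The differential of `F_{n+i,-n+j}`. -/
def diffState (i j : Idx n) : Va n k :=
  ((k + 3 * n + 2) • psiState n k (-2) i j - quadState n k i j) - quadState n k (-j) (-i)

theorem psiState_symm (s : ℤ) (i j : Idx n) :
    psiState n k s (-j) (-i) = psiState n k s i j := by
  rw [psiState, psi_symm, psiState]

theorem diffState_symm (i j : Idx n) : diffState n k (-j) (-i) = diffState n k i j := by
  rw [diffState, diffState, psiState_symm, neg_neg, neg_neg]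
  abel

/-- Each of the `2n` indices contributes `ψ_{i,j}`, and `u = -j` contributes `ψ_{-j,-i} = ψ_{i,j}`
once more. -/
theorem sum_psiState (s : ℤ) (i j : Idx n) :
    ∑ u, odd ⁅Fhi n i u, psi n u j⁆ s (vac (gm2 n) (kappa n k)) =
      (2 * n + 1 : ℂ) • psiState n k s i j := by
  simp only [lie_Fhi_psi, odd_add_apply, odd_ite_apply, Finset.sum_add_distrib, if_true,
    Finset.sum_const, Finset.card_univ, Idx.card, Finset.sum_ite_eq', Finset.mem_univ]
  rw [← psiState, ← psiState, psiState_symm, ← Nat.cast_smul_eq_nsmul ℂ]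
  push_cast
  module

/-- Reordering `ψF` into `Fψ` adds `(2n+1)ψ[-2]`, so `k+n+1` becomes `k+3n+2`. In the reordered form
the symmetry `(i, j) ↦ (-j, -i)` required by `F_{n+i,-n+j} = F_{n-j,-n-i}` is visible. -/
theorem diffState_eq (i j : Idx n) : diffState n k i j =
    ∑ u, even (Flo n u j) (-1) (odd (psi n i u) (-1) (vac _ _)) -
    ∑ u, odd (psi n u j) (-1) (even (Fhi n i u) (-1) (vac _ _)) +
    (k + n + 1) • odd (psi n i j) (-2) (vac _ _) := by
  have h1 : ∑ u, even (Flo n u j) (-1) (odd (psi n i u) (-1) (vac (gm2 n) (kappa n k))) =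
      - quadState n k (-j) (-i) := by
    rw [quadState, ← Finset.sum_neg_distrib, ← Equiv.sum_comp (Equiv.neg (Idx n))]
    refine Finset.sum_congr rfl fun u _ => ?_
    rw [Equiv.neg_apply, Flo_eq, even_neg_apply, neg_neg, ← psiState, ← psiState_symm, neg_neg]
  have h2 : ∑ u, odd (psi n u j) (-1) (even (Fhi n i u) (-1) (vac (gm2 n) (kappa n k))) =
      quadState n k i j - (2 * n + 1 : ℂ) • psiState n k (-2) i j := by
    rw [← sum_psiState, quadState, ← Finset.sum_sub_distrib]
    refine Finset.sum_congr rfl fun u _ => ?_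
    rw [odd_even_vac]
    rfl
  rw [h1, h2, ← psiState, diffState]
  module

/-- The cocycle `δ` with `δ F = d(F[-1])`. -/
def cocycle : b n →ₗ[ℂ] Va n k where
  -- The factor `1/2` compensates the double counting of the off-diagonal elements; the prescribed
  -- values are consistent by `diffState_symm`.
  toFun x := ∑ i, ∑ j, (x.1 i.hi j.lo / 2) • diffState n k i j -
    ∑ i, ∑ j, x.1 i.hi j.hi • psiState n k (-1) i j
  map_add' x y := by
    simp [add_div, add_smul, Finset.sum_add_distrib]
    abel
  map_smul' c x := by
    simp [mul_div_assoc, mul_smul, Finset.smul_sum, smul_sub]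

theorem cocycle_apply (x : b n) : cocycle n k x =
    ∑ i, ∑ j, (x.1 i.hi j.lo / 2) • diffState n k i j -
      ∑ i, ∑ j, x.1 i.hi j.hi • psiState n k (-1) i j := rfl

theorem cocycle_Fhi (i j : Idx n) : cocycle n k (Fhi n i j) = - psiState n k (-1) i j := by
  rw [cocycle_apply]
  simp only [Fhi_val, Matrix.sub_apply, Matrix.single_apply, Idx.hi_inj, Idx.hi_ne_lo,
    Idx.lo_ne_hi, false_and, and_false, if_false, sub_zero, zero_div, zero_smul,
    Finset.sum_const_zero, zero_sub, sum_sum_ite]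

theorem cocycle_Fhl (i j : Idx n) : cocycle n k (Fhl n i j) = diffState n k i j := by
  rw [cocycle_apply]
  simp only [Fhl_val, Matrix.add_apply, Matrix.single_apply, Idx.hi_inj, Idx.lo_inj, Idx.lo_ne_hi,
    and_false, if_false, zero_add, zero_smul, Finset.sum_const_zero, sub_zero, add_smul,
    Finset.sum_add_distrib, div_eq_inv_mul, mul_smul, ← Finset.smul_sum, sum_sum_ite,
    diffState_symm]
  module

theorem cocycle_Flo (i j : Idx n) : cocycle n k (Flo n i j) = psiState n k (-1) i j := by
  rw [Flo_eq, map_neg, cocycle_Fhi, neg_neg, psiState_symm]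

theorem psiState_mem (i j : Idx n) :
    psiState n k (-1) i j ∈ stateSubmodule (gm2 n) (kappa n k) 1 :=
  current_mem_stateSubmodule (.inr (psi n i j)) vac_mem_stateSubmodule

theorem quadState_mem (i j : Idx n) :
    quadState n k i j ∈ stateSubmodule (gm2 n) (kappa n k) 1 :=
  Submodule.sum_mem _ fun u _ =>
    current_mem_stateSubmodule (p := 1) (.inl (Fhi n i u)) (psiState_mem n k u j)

theorem diffState_mem (i j : Idx n) :
    diffState n k i j ∈ stateSubmodule (gm2 n) (kappa n k) 1 := by
  have h : psiState n k (-2) i j = translation (psiState n k (-1) i j) := by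
    rw [psiState, psiState, translation_odd_vac]
  refine Submodule.sub_mem _ (Submodule.sub_mem _ (Submodule.smul_mem _ _ ?_)
    (quadState_mem n k i j)) (quadState_mem n k _ _)
  rw [h]
  exact translation_mem_stateSubmodule (psiState_mem n k i j)

theorem cocycle_mem (x : b n) : cocycle n k x ∈ stateSubmodule (gm2 n) (kappa n k) 1 :=
  Submodule.sub_mem _
    (Submodule.sum_mem _ fun i _ => Submodule.sum_mem _ fun j _ =>
      Submodule.smul_mem _ _ (diffState_mem n k i j))
    (Submodule.sum_mem _ fun i _ => Submodule.sum_mem _ fun j _ =>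
      Submodule.smul_mem _ _ (psiState_mem n k i j))

attribute [local irreducible] cocycle diffState psiState quadState

theorem even_Fhi_psiState (a b i j : Idx n) {m : ℤ} (hm : 0 ≤ m) (s : ℤ) :
    even (Fhi n a b) m (psiState n k s i j) =
      (if b = i then psiState n k (m + s) a j else 0) +
        if b = -j then psiState n k (m + s) i (-a) else 0 := by
  rw [psiState, even_odd_vac _ _ hm, lie_Fhi_psi, odd_add_apply, odd_ite_apply, odd_ite_apply,
    psiState, psiState]

theorem even_Fhl_psiState (a b i j : Idx n) {m : ℤ} (hm : 0 ≤ m) (s : ℤ) :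
    even (Fhl n a b) m (psiState n k s i j) = 0 := by
  rw [psiState, even_odd_vac _ _ hm, lie_Fhl_psi, odd_zero_apply]

theorem psiState_nonneg {s : ℤ} (hs : 0 ≤ s) (i j : Idx n) : psiState n k s i j = 0 := by
  rw [psiState, odd_vac _ hs]

/-- The contracted index `u` is invariant: its contributions from the two factors cancel, and only
the free indices `i` and `j` are acted on. -/
theorem even_zero_Fhi_quadState (a b i j : Idx n) :
    even (Fhi n a b) 0 (quadState n k i j) =
      (if b = i then quadState n k a j else 0) +
        if b = -j then quadState n k i (-a) else 0 := by
  simp only [quadState, psiState, map_sum, even_zero_even_odd, lie_Fhi_Fhi, lie_Fhi_psi,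
    even_sub_apply, even_ite_apply, odd_add_apply, odd_ite_apply, map_add, Finset.sum_add_distrib,
    Finset.sum_sub_distrib, apply_ite (even _ _), map_zero, Finset.sum_ite_eq, Finset.sum_ite_eq',
    Finset.mem_univ, if_true]
  split_ifs <;> (try rw [Finset.sum_const_zero]) <;> abel

/-- The double bracket gives `2n+1` through `sum_psiState`, and `κ` gives `α`. The double bracket
also produces `-δ_{a,b} ψ_{i,j}`; the summand `tr₊ tr₊` of `κ` cancels exactly this term. -/
theorem even_one_Fhi_quadState (a b i j : Idx n) :
    even (Fhi n a b) 1 (quadState n k i j) =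
      (if b = i then (2 * n + 1 + alpha n k) • psiState n k (-1) a j else 0) -
        if b = -j then psiState n k (-1) a (-i) else 0 := by
  have h1 : ∀ u, odd ⁅⁅Fhi n a b, Fhi n i u⁆, psi n u j⁆ (-1) (vac (gm2 n) (kappa n k)) =
      (if b = i then odd ⁅Fhi n a u, psi n u j⁆ (-1) (vac (gm2 n) (kappa n k)) else 0) -
        if u = a then odd ⁅Fhi n i b, psi n a j⁆ (-1) (vac (gm2 n) (kappa n k)) else 0 := by
    intro u
    rw [lie_Fhi_Fhi, sub_lie, odd_sub_apply]
    congr 1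
    · split_ifs <;> simp [odd_zero_apply]
    · split_ifs with h
      · rw [h]
      · simp [odd_zero_apply]
  have h2 : ∀ u, kappa n k (Fhi n a b) (Fhi n i u) • psiState n k (-1) u j =
      (if u = a then if b = i then alpha n k • psiState n k (-1) a j else 0 else 0) +
        if i = u then if a = b then psiState n k (-1) i j else 0 else 0 := by
    intro u
    rw [kappa_Fhi_Fhi, add_smul]
    congr 1
    · split_ifs <;> simp_all
    · split_ifs <;> simp_all
  have h3 : ∑ u, (if b = i then odd ⁅Fhi n a u, psi n u j⁆ (-1) (vac (gm2 n) (kappa n k)) else 0) =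
      if b = i then (2 * n + 1 : ℂ) • psiState n k (-1) a j else 0 := by
    split_ifs
    · exact sum_psiState n k (-1) a j
    · simp
  rw [quadState, map_sum]
  have h4 : ∀ u, even (Fhi n a b) 1 (even (Fhi n i u) (-1) (psiState n k (-1) u j)) =
      odd ⁅⁅Fhi n a b, Fhi n i u⁆, psi n u j⁆ (-1) (vac (gm2 n) (kappa n k)) +
        kappa n k (Fhi n a b) (Fhi n i u) • psiState n k (-1) u j :=
    fun u => by rw [psiState, even_one_even_odd]
  simp only [h4, h1, h2, Finset.sum_add_distrib, Finset.sum_sub_distrib, h3, Finset.sum_ite_eq,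
    Finset.sum_ite_eq', Finset.mem_univ, if_true]
  simp only [lie_Fhi_psi, odd_add_apply, odd_ite_apply]
  have h6 : ∀ i j, odd (psi n i j) (-1) (vac (gm2 n) (kappa n k)) = psiState n k (-1) i j :=
    fun _ _ => by rw [psiState]
  simp only [h6, eq_comm (a := b) (b := a)]
  have h5 : psiState n k (-1) a (-i) = psiState n k (-1) i (-a) := by
    rw [← psiState_symm, neg_neg]
  rw [h5]
  split_ifs <;> module

theorem even_one_Fhl_quadState (a b i j : Idx n) :
    even (Fhl n a b) 1 (quadState n k i j) = 0 := by
  rw [quadState, map_sum]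
  refine Finset.sum_eq_zero fun u _ => ?_
  rw [psiState, even_one_even_odd, kappa_Fhl_Fhi, zero_smul, add_zero, ← lie_skew, lie_Fhi_Fhl,
    neg_lie, add_lie, odd_neg_apply, odd_add_apply]
  split_ifs <;> simp [lie_Fhl_psi, odd_zero_apply]

/-- `𝔤₋₂` is abelian, so only the factor `F_{n+i,n+u}` is acted on, and each of its two brackets
selects one `u`. -/
theorem even_zero_Fhl_quadState (a b i j : Idx n) :
    even (Fhl n a b) 0 (quadState n k i j) =
      - even (Fhl n i b) (-1) (psiState n k (-1) a j) -
        even (Fhl n a (-i)) (-1) (psiState n k (-1) (-b) j) := by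
  have h : ∀ u, even (Fhl n a b) 0 (even (Fhi n i u) (-1) (psiState n k (-1) u j)) =
      - (if u = a then even (Fhl n i b) (-1) (psiState n k (-1) a j) else 0) -
        if u = -b then even (Fhl n a (-i)) (-1) (psiState n k (-1) (-b) j) else 0 := by
    intro u
    rw [psiState, even_zero_even_odd, lie_Fhl_psi, odd_zero_apply, map_zero, add_zero]
    refine (even_lie_of_eq_ite (lie_Fhi_Fhl i u a b) _ _).trans ?_
    rw [← psiState]
    refine congrArg₂ (fun s t => -s - t) ?_ ?_
    · split_ifs with h
      · rw [h]
      · rfl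
    · split_ifs with h
      · rw [h]
      · rfl
  rw [quadState, map_sum, Finset.sum_congr rfl fun u _ => h u]
  simp

theorem even_quadState_of_two_le (x : b n) (i j : Idx n) {m : ℤ} (hm : 2 ≤ m) :
    even x m (quadState n k i j) = 0 := by
  rw [quadState, map_sum]
  exact Finset.sum_eq_zero fun u _ => by rw [psiState, even_even_odd_of_two_le _ _ _ hm]

/-- At `m = 1` the coefficient of each surviving `ψ` is `(k+3n+2) - (2n+1+α) + 1 = 0`. The final `1`
is the cross term of the other quadratic summand. -/
theorem even_Fhi_diffState (a b i j : Idx n) {m : ℤ} (hm : 1 ≤ m) :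
    even (Fhi n a b) m (diffState n k i j) = 0 := by
  rw [diffState, map_sub, map_sub, map_smul, even_Fhi_psiState _ _ _ _ _ _ (by omega)]
  rcases hm.eq_or_lt with rfl | hm
  · rw [even_one_Fhi_quadState, even_one_Fhi_quadState, neg_neg, neg_neg,
      ← psiState_symm n k (1 + -2) i (-a), neg_neg, alpha]
    norm_num
    split_ifs <;> module
  · have hm' : 2 ≤ m := hm
    simp only [even_quadState_of_two_le n k _ _ _ hm']
    simp [psiState_nonneg n k (show 0 ≤ m + -2 by omega)]

theorem even_Fhl_diffState (a b i j : Idx n) {m : ℤ} (hm : 1 ≤ m) :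
    even (Fhl n a b) m (diffState n k i j) = 0 := by
  rw [diffState, map_sub, map_sub, map_smul, even_Fhl_psiState _ _ _ _ _ _ (by omega)]
  rcases hm.eq_or_lt with rfl | hm
  · simp [even_one_Fhl_quadState]
  · have hm' : 2 ≤ m := hm
    simp [even_quadState_of_two_le n k _ _ _ hm']

theorem cocycle_primary (x y : b n) (m : ℤ) (hm : 1 ≤ m) : even x m (cocycle n k y) = 0 := by
  induction x using b_induction with
  | add x x' hx hx' => rw [even_add_apply, hx, hx', add_zero]
  | smul c x hx => rw [even_smul_apply, hx, smul_zero]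
  | h0 => exact even_zero_apply _ _
  | hFhi a b =>
    induction y using b_induction with
    | add y y' hy hy' => rw [map_add, map_add, hy, hy', add_zero]
    | smul c y hy => rw [map_smul, map_smul, hy, smul_zero]
    | h0 => rw [map_zero, map_zero]
    | hFhi i j =>
      rw [cocycle_Fhi, map_neg, even_Fhi_psiState _ _ _ _ _ _ (by omega),
        psiState_nonneg _ _ (by omega), psiState_nonneg _ _ (by omega)]
      simp
    | hFhl i j => rw [cocycle_Fhl, even_Fhi_diffState _ _ _ _ _ _ hm]
  | hFhl a b =>
    induction y using b_induction with
    | add y y' hy hy' => rw [map_add, map_add, hy, hy', add_zero]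
    | smul c y hy => rw [map_smul, map_smul, hy, smul_zero]
    | h0 => rw [map_zero, map_zero]
    | hFhi i j => rw [cocycle_Fhi, map_neg, even_Fhl_psiState _ _ _ _ _ _ (by omega), neg_zero]
    | hFhl i j => rw [cocycle_Fhl, even_Fhl_diffState _ _ _ _ _ _ hm]

theorem cocycle_lie_Fhi_Fhi (a b i j : Idx n) :
    even (Fhi n a b) 0 (cocycle n k (Fhi n i j)) - even (Fhi n i j) 0 (cocycle n k (Fhi n a b)) =
      cocycle n k ⁅Fhi n a b, Fhi n i j⁆ := by
  rw [lie_Fhi_Fhi, map_sub, apply_ite (cocycle n k), apply_ite (cocycle n k), map_zero, cocycle_Fhi,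
    cocycle_Fhi, cocycle_Fhi, cocycle_Fhi, map_neg, map_neg, even_Fhi_psiState _ _ _ _ _ _ le_rfl,
    even_Fhi_psiState _ _ _ _ _ _ le_rfl, ← psiState_symm n k _ i (-a), neg_neg, zero_add]
  simp only [Idx.eq_neg_comm (i := j) (j := b)]
  split_ifs <;> abel

theorem cocycle_lie_Fhi_Fhl (a b i j : Idx n) :
    even (Fhi n a b) 0 (cocycle n k (Fhl n i j)) - even (Fhl n i j) 0 (cocycle n k (Fhi n a b)) =
      cocycle n k ⁅Fhi n a b, Fhl n i j⁆ := by
  rw [lie_Fhi_Fhl, map_add, apply_ite (cocycle n k), apply_ite (cocycle n k), map_zero, cocycle_Fhi,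
    cocycle_Fhl, cocycle_Fhl, cocycle_Fhl, map_neg, even_Fhl_psiState _ _ _ _ _ _ le_rfl, neg_zero,
    sub_zero]
  simp only [diffState, map_sub, map_smul, even_Fhi_psiState _ _ _ _ _ _ le_rfl,
    even_zero_Fhi_quadState, neg_neg, zero_add]
  split_ifs <;> module

/-- The bracket is zero, so the two terms on the left must coincide. Each consists of four products
`Fψ`, and the symmetries of `Fhl` and `psi` match them pairwise. -/
theorem cocycle_lie_Fhl_Fhl (a b i j : Idx n) :
    even (Fhl n a b) 0 (cocycle n k (Fhl n i j)) - even (Fhl n i j) 0 (cocycle n k (Fhl n a b)) =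
      cocycle n k ⁅Fhl n a b, Fhl n i j⁆ := by
  have h1 : Fhl n (-j) b = Fhl n (-b) j := by rw [← Fhl_symm, neg_neg]
  have h2 : Fhl n i (-a) = Fhl n a (-i) := by rw [← Fhl_symm, neg_neg]
  have h3 : psiState n k (-1) i (-a) = psiState n k (-1) a (-i) := by rw [← psiState_symm, neg_neg]
  have h4 : psiState n k (-1) (-j) b = psiState n k (-1) (-b) j := by rw [← psiState_symm, neg_neg]
  rw [lie_Fhl_Fhl, map_zero, cocycle_Fhl, cocycle_Fhl]
  simp only [diffState, map_sub, map_smul, even_Fhl_psiState _ _ _ _ _ _ le_rfl,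
    even_zero_Fhl_quadState, neg_neg, smul_zero, psiState_symm, h1, h2, h3, h4]
  abel

theorem cocycle_lie (x y : b n) :
    even x 0 (cocycle n k y) - even y 0 (cocycle n k x) = cocycle n k ⁅x, y⁆ := by
  induction y using b_induction with
  | add y y' hy hy' => exact add_cocycle hy hy'
  | smul c y hy => exact smul_cocycle c hy
  | h0 => exact zero_cocycle _ _
  | hFhi i j =>
    refine skew_cocycle ?_
    induction x using b_induction with
    | add y y' hy hy' => exact add_cocycle hy hy'
    | smul c y hy => exact smul_cocycle c hy
    | h0 => exact zero_cocycle _ _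
    | hFhi a b => exact cocycle_lie_Fhi_Fhi n k i j a b
    | hFhl a b => exact cocycle_lie_Fhi_Fhl n k i j a b
  | hFhl i j =>
    refine skew_cocycle ?_
    induction x using b_induction with
    | add y y' hy hy' => exact add_cocycle hy hy'
    | smul c y hy => exact smul_cocycle c hy
    | h0 => exact zero_cocycle _ _
    | hFhi a b => exact skew_cocycle (cocycle_lie_Fhi_Fhl n k a b i j)
    | hFhl a b => exact cocycle_lie_Fhl_Fhl n k i j a b

/-! ### The differential -/

instance : Subsingleton (⊥ : LieSubmodule ℂ (b n) (gm2 n)) :=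
  inferInstanceAs (Subsingleton (⊥ : Submodule ℂ (gm2 n)))

/-- The differential `d₀`. -/
def differential : Vb n k →ₗ[ℂ] Va n k :=
  cocycleExtension _ (cocycle_primary n k) (cocycle_lie n k)

theorem differential_generator (x : b n) :
    differential n k (even x (-1) (vac _ _)) = cocycle n k x :=
  cocycleExtension_generator _ _ (⊥ : LieSubmodule ℂ (b n) (gm2 n)).incl x

theorem isDifferential_differential : IsDifferential n k (differential n k) where
  d_odd := parity_cocycleExtension _ _ (cocycle_mem n k)
    (⊥ : LieSubmodule ℂ (b n) (gm2 n)).incl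
  d_vac := cocycleExtension_vac _ _
  d_translation := cocycleExtension_translation _ _ (cocycle_mem n k)
    (⊥ : LieSubmodule ℂ (b n) (gm2 n)).incl
  d_leibniz u v := cocycleExtension_nProd _ _ (cocycle_mem n k)
    (⊥ : LieSubmodule ℂ (b n) (gm2 n)).incl u (-1) v
  d_Flo i j := by rw [differential_generator, cocycle_Flo, psiState]
  d_Fhi i j := by rw [differential_generator, cocycle_Fhi, psiState]
  d_Fhl i j := by rw [differential_generator, cocycle_Fhl, diffState_eq]

variable {n k}

namespace IsDifferential

variable {d d' : Vb n k →ₗ[ℂ] Va n k}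

theorem eq_cocycle (h : IsDifferential n k d) (x : b n) :
    d (even x (-1) (vac _ _)) = cocycle n k x := by
  induction x using b_induction with
  | add x y hx hy => rw [even_add_apply, map_add, hx, hy, map_add]
  | smul c x hx => rw [even_smul_apply, map_smul, hx, map_smul]
  | h0 => rw [even_zero_apply, map_zero, map_zero]
  | hFhi i j => rw [h.d_Fhi, cocycle_Fhi, psiState]
  | hFhl i j =>
    exact (h.d_Fhl i j).trans ((diffState_eq n k i j).symm.trans (cocycle_Fhl n k i j).symm)

theorem d_even (h : IsDifferential n k d) (x : b n) (v : Vb n k) :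
    d (even x (-1) v) = nProd (-1) (cocycle n k x) (incl n k v) + even x (-1) (d v) :=
  (derivation_even _ h.d_leibniz x v).trans
    (congrArg (nProd (-1) · (incl n k v) + even x (-1) (d v)) (h.eq_cocycle x))

theorem unique (h : IsDifferential n k d) (h' : IsDifferential n k d') : d = d' :=
  linearMap_ext_of_even (fun x v => nProd (-1) (cocycle n k x) (incl n k v))
    (h.d_vac.trans h'.d_vac.symm) h.d_translation h'.d_translation h.d_even h'.d_even

theorem W1_mem (h : IsDifferential n k d) (i j : Idx n) : W1 n k i j ∈ WAlgebra n k d := by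
  rw [WAlgebra, LinearMap.mem_ker, W1, map_add, h.d_Flo, h.d_Fhi, add_neg_cancel]

theorem d_Fhi_neg_two (h : IsDifferential n k d) (i j : Idx n) :
    d (even (Fhi n i j) (-2) (vac _ _)) = - odd (psi n i j) (-2) (vac _ _) :=
  calc d (even (Fhi n i j) (-2) (vac _ _))
      = d (translation (even (Fhi n i j) (-1) (vac _ _))) :=
        congrArg d (translation_even_vac (Fhi n i j)).symm
    _ = translation (d (even (Fhi n i j) (-1) (vac _ _))) := h.d_translation _
    _ = translation (- odd (psi n i j) (-1) (vac _ _)) := congrArg translation (h.d_Fhi i j)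
    _ = - translation (odd (psi n i j) (-1) (vac _ _)) := map_neg _ _
    _ = - odd (psi n i j) (-2) (vac _ _) :=
        congrArg (- ·) (translation_odd_vac (psi n i j))

/-- The relative minus sign is that of `d(F_{n+i,n+u}[-1]) = -ψ[-1]`. Summed over `u`, the result is
the negative of the quadratic part in `d_Fhl`. -/
theorem d_Flo_Fhi (h : IsDifferential n k d) (i j u : Idx n) :
    d (even (Flo n u j) (-1) (even (Fhi n i u) (-1) (vac _ _))) =
      odd (psi n u j) (-1) (even (Fhi n i u) (-1) (vac _ _)) -
        even (Flo n u j) (-1) (odd (psi n i u) (-1) (vac _ _)) := by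
  have e : incl n k (even (Fhi n i u) (-1) (vac _ _)) = even (Fhi n i u) (-1) (vac _ _) := by
    rw [incl, map_even, map_vac]
  have e' : cocycle n k (Flo n u j) = odd (psi n u j) (-1) (vac _ _) := by
    rw [cocycle_Flo, psiState]
  calc d (even (Flo n u j) (-1) (even (Fhi n i u) (-1) (vac _ _)))
      = nProd (-1) (cocycle n k (Flo n u j)) (incl n k (even (Fhi n i u) (-1) (vac _ _))) +
          even (Flo n u j) (-1) (d (even (Fhi n i u) (-1) (vac _ _))) := h.d_even _ _
    _ = nProd (-1) (odd (psi n u j) (-1) (vac _ _)) (even (Fhi n i u) (-1) (vac _ _)) +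
          even (Flo n u j) (-1) (- odd (psi n i u) (-1) (vac _ _)) :=
        congrArg₂ (· + ·) (congrArg₂ (nProd (-1)) e' e)
          (congrArg (even (Flo n u j) (-1)) (h.d_Fhi i u))
    _ = _ := (congrArg₂ (· + ·) (nProd_odd _ _ _) (map_neg _ _)).trans (sub_eq_add_neg _ _).symm

theorem W2_mem (h : IsDifferential n k d) (i j : Idx n) : W2 n k i j ∈ WAlgebra n k d := by
  have h1 : d (∑ u, even (Flo n u j) (-1) (even (Fhi n i u) (-1) (vac _ _))) =
      ∑ u, odd (psi n u j) (-1) (even (Fhi n i u) (-1) (vac _ _)) -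
        ∑ u, even (Flo n u j) (-1) (odd (psi n i u) (-1) (vac _ _)) :=
    (map_sum d _ _).trans
      ((Finset.sum_congr rfl fun u _ => h.d_Flo_Fhi i j u).trans (Finset.sum_sub_distrib _ _))
  have h2 : d ((alpha n k - 1) • even (Fhi n i j) (-2) (vac _ _)) =
      (alpha n k - 1) • - odd (psi n i j) (-2) (vac _ _) :=
    (map_smul d _ _).trans (congrArg ((alpha n k - 1) • ·) (h.d_Fhi_neg_two i j))
  have h3 := congrArg₂ (· + ·) (congrArg₂ (· + ·) (h.d_Fhl i j) h2) h1
  refine ((map_add d _ _).trans (congrArg (· + d _) (map_add d _ _))).trans (h3.trans ?_)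
  -- The quadratic sums cancel, and the remaining coefficient of `ψ[-2]` is `(k+n+1) - (α-1) = 0`.
  rw [alpha]
  module

end IsDifferential

end Cocycle

end

end RectW

theorem mainTheorem5 (n : ℕ) (k : ℂ) :
    (∃! d : RectW.Vb n k →ₗ[ℂ] RectW.Va n k, RectW.IsDifferential n k d) ∧
    ∀ d : RectW.Vb n k →ₗ[ℂ] RectW.Va n k, RectW.IsDifferential n k d →
      ∀ i j : RectW.Idx n,
        RectW.W1 n k i j ∈ RectW.WAlgebra n k d ∧ RectW.W2 n k i j ∈ RectW.WAlgebra n k d :=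
  ⟨⟨_, RectW.isDifferential_differential n k,
    fun _ h => h.unique (RectW.isDifferential_differential n k)⟩,
    fun _ h i j => ⟨h.W1_mem i j, h.W2_mem i j⟩⟩
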